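/- Let $n\ge 1$. For $k\ge n$ put $c_{n,k}=k\prod_{0<j<n}(k^2-j^2)$. Let $\mathcal H^{(n)}$ be the one-particle Hilbert space of the $(n-1)$-th derivative of the $U(1)$-current, i.e. the completion of $C^\infty(S^1,\mathbb R)$, modulo trigonometric polynomials of degree $<n$, for the norm $\|f\|^2=\sum_{k\ge n}c_{n,k}|\hat f(k)|^2$, with the complex structure that multiplies $\hat f(k)$ by $-i\,\mathrm{sgn}(k)$; equivalently $\mathcal H^{(n)}=\ell^2(\{k: k\ge n\})$, the class of $f$ being the vector $(\sqrt{c_{n,k}}\,\hat f(-k))_{k\ge n}$. An interval is a connected set $I\subset S^1$ such that $I$ and its complement $I'$ have non-empty interior. For an interval $I$ let $H^{(n)}(I)\subset\mathcal H^{(n)}$ be the closed real subspace generated by the classes of the smooth real functions with support in $I$. On the full Fock space $\mathcal F=\mathcal F(\mathcal H^{(n)})=\bigoplus_{k\ge 0}(\mathcal H^{(n)})^{\otimes k}$ let $\ell(h)$ and $r(h)$ be the left and right creation operators, $\ell(h)(\varphi_1\otimes\cdots\otimes\varphi_k)=h\otimes\varphi_1\otimes\cdots\otimes\varphi_k$ and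 $r(h)(\varphi_1\otimes\cdots\otimes\varphi_k)=\varphi_1\otimes\cdots\otimes\varphi_k\otimes h$, and let $s(h)=\ell(h)+\ell(h)^*$, $d(h)=r(h)+r(h)^*$. Define the von Neumann algebras $$\mathcal A_n(I)=\{s(h): h\in H^{(n)}(I)\}'',\qquad \mathcal B_n(I)=\{d(h): h\in H^{(n)}(I)\}'',$$ and the dual net $\hat{\mathcal A}_n(I)=\mathcal A_n(I')'$, where $'$ on algebras denotes the commutant. Then for every $n\ge1$ and every interval $I$ of $S^1$: (i) $\mathcal B_n(I)=\hat{\mathcal A}_n(I)$; (ii) $\mathcal A_n(I)\cap\mathcal B_n(I)=\mathbb C\cdot 1$; (iii) $\mathcal A_n(I)\vee\mathcal B_n(I)=B(\mathcal F)$, where $\vee$ denotes the generated von Neumann algebra. -/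

import Mathlib

open scoped ContDiff ENNReal ComplexInnerProductSpace

namespace FreeNet

/-! ### The full Fock space -/

section Fock

variable {ι : Type*}

/-- The complex Hilbert space `ℓ²(ι)`. -/
abbrev Ell (ι : Type*) : Type _ := lp (fun _ : ι => ℂ) 2

/-- The full Fock space (Boltzmann statistics) `⨁ₖ ℓ²(ι)^{⊗ k}` over the Hilbert space `ℓ²(ι)`.
The Hilbert space tensor power `ℓ²(ι)^{⊗ k}` is `ℓ²(ι^k)`, so that the direct sum over all `k` is
`ℓ²` of the set of all words in `ι`; the word `[i₁, …, iₖ]` stands for `e_{i₁} ⊗ ⋯ ⊗ e_{iₖ}`.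
See `FreeNet.tensor` below for the simple tensors. -/
abbrev FullFock (ι : Type*) : Type _ := Ell (List ι)

/-- The vacuum vector, i.e. the basis vector of the empty word. -/
noncomputable def vacuum (ι : Type*) : FullFock ι := by
  classical exact lp.single 2 ([] : List ι) (1 : ℂ)

theorem summable_sq (h : Ell ι) : Summable fun i => ‖h i‖ ^ 2 := by
  have := (lp.memℓp h).summable (by norm_num)
  simpa using this

theorem norm_sq_eq_tsum (h : Ell ι) : ‖h‖ ^ 2 = ∑' i, ‖h i‖ ^ 2 := by
  have := lp.norm_rpow_eq_tsum (p := 2) (by norm_num) h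
  simpa using this

theorem summable_pair (h : Ell ι) (ψ : FullFock ι) :
    Summable fun p : ι × List ι => ‖h p.1 * ψ p.2‖ ^ 2 := by
  have := (summable_sq h).mul_of_nonneg (summable_sq ψ) (fun _ => by positivity)
    (fun _ => by positivity)
  simpa [mul_pow] using this

theorem extend_sq {e : ι × List ι → List ι} (he : Function.Injective e) (h : Ell ι)
    (ψ : FullFock ι) :
    (fun w => ‖Function.extend e (fun p => h p.1 * ψ p.2) 0 w‖ ^ 2) =
      Function.extend e (fun p => ‖h p.1 * ψ p.2‖ ^ 2) 0 := by
  funext w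
  by_cases hw : ∃ p, e p = w
  · obtain ⟨p, rfl⟩ := hw
    simp [he.extend_apply]
  · simp [Function.extend_apply' _ _ _ hw]

theorem memlp_extend {e : ι × List ι → List ι} (he : Function.Injective e) (h : Ell ι)
    (ψ : FullFock ι) :
    Memℓp (E := fun _ : List ι => ℂ) (Function.extend e (fun p => h p.1 * ψ p.2) 0) 2 := by
  apply memℓp_gen
  have h2 : Summable (Function.extend e (fun p => ‖h p.1 * ψ p.2‖ ^ 2) (0 : List ι → ℝ)) :=
    (summable_extend_zero he).2 (summable_pair h ψ)
  rw [← extend_sq he] at h2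
  simpa using h2

/-- For an injective way `e` of adding a letter to a word, the vector with the coordinates
`h i * ψ w` at `e (i, w)`, and `0` at the words not of the form `e (i, w)`. -/
noncomputable def creationVec (e : ι × List ι → List ι) (he : Function.Injective e) (h : Ell ι)
    (ψ : FullFock ι) : FullFock ι :=
  ⟨Function.extend e (fun p => h p.1 * ψ p.2) 0, memlp_extend he h ψ⟩

theorem creationVec_apply {e : ι × List ι → List ι} (he : Function.Injective e) (h : Ell ι)
    (ψ : FullFock ι) (p : ι × List ι) : creationVec e he h ψ (e p) = h p.1 * ψ p.2 :=
  he.extend_apply (fun p : ι × List ι => h p.1 * ψ p.2) 0 p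

theorem creationVec_apply_of_not {e : ι × List ι → List ι} (he : Function.Injective e) (h : Ell ι)
    (ψ : FullFock ι) {w : List ι} (hw : ¬∃ p, e p = w) : creationVec e he h ψ w = 0 :=
  Function.extend_apply' (fun p : ι × List ι => h p.1 * ψ p.2) (0 : List ι → ℂ) w hw

/-- The bounded operator `ψ ↦ creationVec e he h ψ`. -/
noncomputable def creation (e : ι × List ι → List ι) (he : Function.Injective e) (h : Ell ι) :
    FullFock ι →L[ℂ] FullFock ι :=
  LinearMap.mkContinuous
    { toFun := creationVec e he h
      map_add' := by
        intro φ ψ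
        apply lp.ext
        funext w
        rw [lp.coeFn_add, Pi.add_apply]
        by_cases hw : ∃ p, e p = w
        · obtain ⟨p, rfl⟩ := hw
          rw [creationVec_apply, creationVec_apply, creationVec_apply, lp.coeFn_add, Pi.add_apply,
            mul_add]
        · simp [creationVec_apply_of_not _ _ _ hw]
      map_smul' := by
        intro c ψ
        apply lp.ext
        funext w
        rw [lp.coeFn_smul, Pi.smul_apply]
        by_cases hw : ∃ p, e p = w
        · obtain ⟨p, rfl⟩ := hw
          rw [creationVec_apply, creationVec_apply, lp.coeFn_smul, Pi.smul_apply]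
          simp [mul_left_comm]
        · simp [creationVec_apply_of_not _ _ _ hw] }
    ‖h‖
    (by
      intro ψ
      refine abs_le_of_sq_le_sq' ?_ (by positivity) |>.2
      rw [norm_sq_eq_tsum, mul_pow, norm_sq_eq_tsum h, norm_sq_eq_tsum ψ]
      change ∑' w, ‖Function.extend e (fun p => h p.1 * ψ p.2) 0 w‖ ^ 2 ≤ _
      rw [extend_sq he, tsum_extend_zero he,
        (summable_sq h).tsum_mul_tsum (summable_sq ψ)
          (by simpa [mul_pow] using summable_pair h ψ)]
      simp [mul_pow])

theorem cons_injective : Function.Injective fun p : ι × List ι => p.1 :: p.2 := by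
  rintro ⟨i, v⟩ ⟨j, w⟩ h
  simpa using h

theorem snoc_injective : Function.Injective fun p : ι × List ι => p.2 ++ [p.1] := by
  rintro ⟨i, v⟩ ⟨j, w⟩ h
  have := List.append_inj' h rfl
  simp_all

/-- Left creation operator `ℓ(h) : φ₁ ⊗ ⋯ ⊗ φₖ ↦ h ⊗ φ₁ ⊗ ⋯ ⊗ φₖ`. -/
noncomputable def leftCreation (h : Ell ι) : FullFock ι →L[ℂ] FullFock ι :=
  creation (fun p => p.1 :: p.2) cons_injective h

/-- Right creation operator `r(h) : φ₁ ⊗ ⋯ ⊗ φₖ ↦ φ₁ ⊗ ⋯ ⊗ φₖ ⊗ h`. -/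
noncomputable def rightCreation (h : Ell ι) : FullFock ι →L[ℂ] FullFock ι :=
  creation (fun p => p.2 ++ [p.1]) snoc_injective h

@[simp] theorem leftCreation_nil (h : Ell ι) (ψ : FullFock ι) : leftCreation h ψ [] = 0 :=
  creationVec_apply_of_not cons_injective h ψ (by simp)

@[simp] theorem leftCreation_cons (h : Ell ι) (ψ : FullFock ι) (i : ι) (w : List ι) :
    leftCreation h ψ (i :: w) = h i * ψ w :=
  creationVec_apply cons_injective h ψ (i, w)

@[simp] theorem rightCreation_nil (h : Ell ι) (ψ : FullFock ι) : rightCreation h ψ [] = 0 :=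
  creationVec_apply_of_not snoc_injective h ψ (by simp)

@[simp] theorem rightCreation_snoc (h : Ell ι) (ψ : FullFock ι) (w : List ι) (i : ι) :
    rightCreation h ψ (w ++ [i]) = h i * ψ w :=
  creationVec_apply snoc_injective h ψ (i, w)

/-- The simple tensor `h₁ ⊗ ⋯ ⊗ hₖ` in the full Fock space, whose coordinate at the word
`[i₁, …, iₖ]` is `h₁(i₁) ⋯ hₖ(iₖ)`. -/
noncomputable def tensor : List (Ell ι) → FullFock ι
  | [] => vacuum ι
  | h :: L => leftCreation h (tensor L)

theorem tensor_apply (L : List (Ell ι)) (w : List ι) :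
    tensor L w =
      if L.length = w.length then (List.zipWith (fun (h : Ell ι) (i : ι) => h i) L w).prod
      else 0 := by
  induction L generalizing w with
  | nil => cases w <;> simp [tensor, vacuum]
  | cons h L ih => cases w <;> simp [tensor, ih]

theorem leftCreation_tensor (h : Ell ι) (L : List (Ell ι)) :
    leftCreation h (tensor L) = tensor (h :: L) := rfl

theorem rightCreation_tensor (h : Ell ι) (L : List (Ell ι)) :
    rightCreation h (tensor L) = tensor (L ++ [h]) := by
  ext w
  rcases List.eq_nil_or_concat w with rfl | ⟨v, i, rfl⟩
  · rw [rightCreation_nil, tensor_apply]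
    simp
  · rw [List.concat_eq_append, rightCreation_snoc, tensor_apply, tensor_apply]
    by_cases hl : L.length = v.length
    · simp [hl, List.zipWith_append, mul_comm]
    · simp [hl]

theorem inner_leftCreation (h k : Ell ι) (φ ψ : FullFock ι) :
    ⟪leftCreation h φ, leftCreation k ψ⟫ = ⟪h, k⟫ * ⟪φ, ψ⟫ := by
  have s1 : Summable fun i => ‖⟪h i, k i⟫‖ := (lp.summable_inner (𝕜 := ℂ) h k).norm
  have s2 : Summable fun w => ‖⟪φ w, ψ w⟫‖ := (lp.summable_inner (𝕜 := ℂ) φ ψ).norm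
  have h1 : (∑' i, ⟪h i, k i⟫) * ∑' w, ⟪φ w, ψ w⟫ =
      ∑' p : ι × List ι, ⟪h p.1, k p.1⟫ * ⟪φ p.2, ψ p.2⟫ :=
    tsum_mul_tsum_of_summable_norm s1 s2
  have h2 : ∑' p : ι × List ι, ⟪leftCreation h φ (p.1 :: p.2), leftCreation k ψ (p.1 :: p.2)⟫ =
      ∑' w, ⟪leftCreation h φ w, leftCreation k ψ w⟫ :=
    cons_injective.tsum_eq (f := fun w => ⟪leftCreation h φ w, leftCreation k ψ w⟫) (by
      intro w hw
      cases w with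
      | nil => simp at hw
      | cons i w => exact ⟨(i, w), rfl⟩)
  rw [lp.inner_eq_tsum, lp.inner_eq_tsum h, lp.inner_eq_tsum φ, h1, ← h2]
  refine tsum_congr fun p => ?_
  simp only [leftCreation_cons, RCLike.inner_apply, map_mul]
  ring

theorem inner_vacuum (ψ : FullFock ι) : ⟪vacuum ι, ψ⟫ = ψ [] := by
  classical
  rw [vacuum, lp.inner_single_left]
  simp

theorem inner_tensor (L M : List (Ell ι)) :
    ⟪tensor L, tensor M⟫ =
      if L.length = M.length then (List.zipWith (fun h k : Ell ι => ⟪h, k⟫) L M).prod else 0 := by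
  induction L generalizing M with
  | nil => cases M <;> simp [tensor, inner_vacuum] ; simp [vacuum]
  | cons h L ih =>
    cases M with
    | nil => rw [← inner_conj_symm]; simp [tensor, inner_vacuum]
    | cons k M => simp [tensor, inner_leftCreation, ih]

/-- The left field `s(h) = ℓ(h) + ℓ(h)*`. -/
noncomputable def leftField (h : Ell ι) : FullFock ι →L[ℂ] FullFock ι :=
  leftCreation h + (leftCreation h).adjoint

/-- The right field `d(h) = r(h) + r(h)*`. -/
noncomputable def rightField (h : Ell ι) : FullFock ι →L[ℂ] FullFock ι :=
  rightCreation h + (rightCreation h).adjoint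

end Fock

/-- The von Neumann algebra generated by a set `S` of bounded operators: the double commutant
of `S ∪ S*`. -/
noncomputable def generated {K : Type*} [NormedAddCommGroup K] [InnerProductSpace ℂ K]
    [CompleteSpace K] (S : Set (K →L[ℂ] K)) : VonNeumannAlgebra K where
  toStarSubalgebra :=
    StarSubalgebra.centralizer ℂ (StarSubalgebra.centralizer ℂ S : Set (K →L[ℂ] K))
  centralizer_centralizer' := by
    change Set.centralizer (Set.centralizer (StarSubalgebra.centralizer ℂ
      (StarSubalgebra.centralizer ℂ S : Set (K →L[ℂ] K)) : Set (K →L[ℂ] K))) =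
      (StarSubalgebra.centralizer ℂ
        (StarSubalgebra.centralizer ℂ S : Set (K →L[ℂ] K)) : Set (K →L[ℂ] K))
    rw [StarSubalgebra.coe_centralizer_centralizer, Set.centralizer_centralizer_centralizer]

@[simp] theorem coe_generated {K : Type*} [NormedAddCommGroup K] [InnerProductSpace ℂ K]
    [CompleteSpace K] (S : Set (K →L[ℂ] K)) :
    (generated S : Set (K →L[ℂ] K)) = Set.centralizer (Set.centralizer (S ∪ star S)) :=
  StarSubalgebra.coe_centralizer_centralizer ℂ S

/-! ### The one-particle space and the local real subspaces -/

/-- The smooth real functions on the circle `S¹ = ℝ / ℤ`. -/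
def SmoothReal (f : UnitAddCircle → ℝ) : Prop :=
  ContDiff ℝ ∞ fun t : ℝ => f (t : UnitAddCircle)

/-- `c_{n,k} = k ∏_{0 < j < n} (k² - j²)`. -/
noncomputable def weight (n k : ℕ) : ℝ :=
  (k : ℝ) * ∏ j ∈ Finset.Ico 1 n, ((k : ℝ) ^ 2 - (j : ℝ) ^ 2)

theorem weight_le (n k : ℕ) (hn : 1 ≤ n) (hk : n ≤ k) : weight n k ≤ (k : ℝ) ^ (2 * n) := by
  have hk1 : (1 : ℝ) ≤ k := by exact_mod_cast hn.trans hk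
  have h : ∏ j ∈ Finset.Ico 1 n, ((k : ℝ) ^ 2 - (j : ℝ) ^ 2) ≤
      ∏ j ∈ Finset.Ico 1 n, (k : ℝ) ^ 2 := by
    refine Finset.prod_le_prod (fun j hj => ?_) (fun j _ => by nlinarith [sq_nonneg (j : ℝ)])
    have : (j : ℝ) ≤ k := by
      exact_mod_cast ((Finset.mem_Ico.1 hj).2.le.trans hk)
    nlinarith [(Nat.cast_nonneg j : (0 : ℝ) ≤ j)]
  rw [Finset.prod_const, Nat.card_Ico, ← pow_mul] at h
  calc weight n k ≤ (k : ℝ) * (k : ℝ) ^ (2 * (n - 1)) := by unfold weight; gcongr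
    _ = (k : ℝ) ^ (2 * (n - 1) + 1) := by ring
    _ ≤ (k : ℝ) ^ (2 * n) := pow_le_pow_right₀ hk1 (by omega)

theorem norm_fourierCoeffOn_le (N : ℕ) (g : ℝ → ℂ) (hg : ContDiff ℝ ∞ g)
    (hp : Function.Periodic g 1) :
    ∃ C : ℝ, ∀ k : ℤ, ‖fourierCoeffOn (zero_lt_one' ℝ) g k‖ * |(k : ℝ)| ^ N ≤ C := by
  induction N generalizing g with
  | zero =>
    obtain ⟨C, hC⟩ := (isCompact_Icc (a := (0 : ℝ)) (b := 1)).exists_bound_of_continuousOn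
      hg.continuous.continuousOn
    refine ⟨C, fun k => ?_⟩
    rw [fourierCoeffOn_eq_integral]
    have := intervalIntegral.norm_integral_le_of_norm_le_const (a := (0 : ℝ)) (b := 1) (C := C)
      (f := fun x => fourier (-k) (x : AddCircle ((1 : ℝ) - 0)) • g x) (by
        intro x hx
        rw [norm_smul]
        have hx' : x ∈ Set.Icc (0 : ℝ) 1 := by
          rw [Set.uIoc_of_le zero_le_one] at hx
          exact Set.Ioc_subset_Icc_self hx
        rw [fourier_apply, Circle.norm_coe, one_mul]
        exact hC x hx')
    simpa using this
  | succ N ih =>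
    have hd : ContDiff ℝ ∞ (deriv g) := (contDiff_infty_iff_deriv.1 hg).2
    have hdp : Function.Periodic (deriv g) 1 := by
      intro x
      rw [← deriv_comp_add_const]
      congr 1
      exact funext hp
    obtain ⟨C, hC⟩ := ih (deriv g) hd hdp
    refine ⟨C, fun k => ?_⟩
    have hC0 : 0 ≤ C := le_trans (by positivity) (hC 0)
    rcases eq_or_ne k 0 with rfl | hk
    · simpa using hC0
    have h1 := fourierCoeffOn_of_hasDerivAt (zero_lt_one' ℝ) hk (f := g) (f' := deriv g)
      (fun x _ => ((contDiff_infty_iff_deriv.1 hg).1 x).hasDerivAt)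
      (hd.continuous.intervalIntegrable _ _)
    have h2 : g 1 - g 0 = 0 := by
      have := hp 0
      rw [zero_add] at this
      rw [this, sub_self]
    rw [h2] at h1
    have hk' : (0 : ℝ) < |(k : ℝ)| := by simpa using hk
    have h3 : ‖fourierCoeffOn (zero_lt_one' ℝ) g k‖ =
        (2 * Real.pi)⁻¹ * (|(k : ℝ)|⁻¹ * ‖fourierCoeffOn (zero_lt_one' ℝ) (deriv g) k‖) := by
      rw [h1]
      simp [abs_of_pos Real.pi_pos]
      ring
    have h4 : (2 * Real.pi)⁻¹ ≤ 1 := inv_le_one_of_one_le₀ (by linarith [Real.pi_gt_three])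
    calc _ = (2 * Real.pi)⁻¹ *
          (‖fourierCoeffOn (zero_lt_one' ℝ) (deriv g) k‖ * |(k : ℝ)| ^ N) := by
          rw [h3, pow_succ]
          field_simp
      _ ≤ 1 * C := by
          gcongr
          exact hC k
      _ = C := one_mul C

/-- The Fourier coefficients of a smooth function are rapidly decreasing. -/
theorem norm_fourierCoeff_le (N : ℕ) {f : UnitAddCircle → ℝ} (hf : SmoothReal f) :
    ∃ C : ℝ, ∀ k : ℤ, ‖fourierCoeff (fun x => (f x : ℂ)) k‖ * |(k : ℝ)| ^ N ≤ C := by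
  obtain ⟨C, hC⟩ := norm_fourierCoeffOn_le N (fun t : ℝ => (f (t : UnitAddCircle) : ℂ))
    (Complex.ofRealCLM.contDiff.comp hf) (fun t => by simp)
  refine ⟨C, fun k => ?_⟩
  have := hC k
  rw [fourierCoeffOn_eq_integral] at this
  rw [fourierCoeff_eq_intervalIntegral _ _ 0]
  simpa using this

/-- The frequencies `k ≥ n`. -/
abbrev Mode (n : ℕ) : Type := {k : ℕ // n ≤ k}

/-- The one-particle space of the `(n - 1)`-th derivative of the `U(1)`-current: the completion of
the smooth real functions on the circle, modulo trigonometric polynomials of degree `< n`, for the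
norm `‖f‖² = ∑_{k ≥ n} c_{n,k} |f̂(k)|²` and the complex structure multiplying `f̂(k)` by
`-i sgn k`. The normalised coordinates `√c_{n,k} f̂(-k)`, `k ≥ n`, identify it with `ℓ²`. -/
abbrev OneParticle (n : ℕ) : Type := Ell (Mode n)

theorem memlp_field (n : ℕ) (hn : 1 ≤ n) {f : UnitAddCircle → ℝ} (hf : SmoothReal f) :
    Memℓp (E := fun _ : Mode n => ℂ)
      (fun k => (Real.sqrt (weight n k) : ℂ) * fourierCoeff (fun x => (f x : ℂ)) (-(k : ℤ))) 2 := by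
  obtain ⟨C, hC⟩ := norm_fourierCoeff_le (n + 1) hf
  apply memℓp_gen
  have hs : Summable fun k : Mode n => C ^ 2 * (1 / ((k : ℕ) : ℝ) ^ 2) :=
    ((Real.summable_one_div_nat_pow.2 one_lt_two).comp_injective
      Subtype.val_injective).mul_left (C ^ 2)
  refine hs.of_nonneg_of_le (fun k => by positivity) fun ⟨k, hk⟩ => ?_
  have hk0 : (0 : ℝ) < k := by exact_mod_cast lt_of_lt_of_le hn hk
  have h1 : Real.sqrt (weight n k) ≤ (k : ℝ) ^ n :=
    Real.sqrt_le_iff.2 ⟨by positivity, by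
      rw [← pow_mul, mul_comm n 2]
      exact weight_le n k hn hk⟩
  have h2 := hC (-(k : ℤ))
  simp only [Int.cast_neg, Int.cast_natCast, abs_neg, Nat.abs_cast] at h2
  have h3 : Real.sqrt (weight n k) * ‖fourierCoeff (fun x => (f x : ℂ)) (-(k : ℤ))‖ ≤ C / k := by
    rw [le_div_iff₀ hk0]
    calc _ ≤ (k : ℝ) ^ n * ‖fourierCoeff (fun x => (f x : ℂ)) (-(k : ℤ))‖ * k := by gcongr
      _ = ‖fourierCoeff (fun x => (f x : ℂ)) (-(k : ℤ))‖ * (k : ℝ) ^ (n + 1) := by ring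
      _ ≤ C := h2
  have h4 := pow_le_pow_left₀ (by positivity) h3 2
  simpa [mul_pow, div_eq_mul_inv, abs_of_nonneg (Real.sqrt_nonneg _)] using h4

/-- The class of the smooth real function `f` in the one-particle space, i.e. the vector with the
coordinates `√c_{n,k} f̂(-k)`, `k ≥ n`. -/
noncomputable def field (n : ℕ) (hn : 1 ≤ n) (f : UnitAddCircle → ℝ) (hf : SmoothReal f) :
    OneParticle n :=
  ⟨_, memlp_field n hn hf⟩

/-- The local real subspace `H(I)` of the one-particle space: the closed real subspace generated by
the smooth real functions with support in `I`. -/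
noncomputable def localSubspace (n : ℕ) (hn : 1 ≤ n) (I : Set UnitAddCircle) :
    ClosedSubmodule ℝ (OneParticle n) :=
  (Submodule.span ℝ
    {v | ∃ (f : UnitAddCircle → ℝ) (hf : SmoothReal f), tsupport f ⊆ I ∧ v = field n hn f hf}).closure

/-- An interval of the circle: a connected set which has, together with its complement,
non-empty interior. -/
structure IsInterval (I : Set UnitAddCircle) : Prop where
  isConnected : IsConnected I
  interior_nonempty : (interior I).Nonempty
  interior_compl_nonempty : (interior Iᶜ).Nonempty


/-! ### The free nets -/

/-- `𝒜(H) = {s(h) : h ∈ H}''` for a closed real subspace `H` of the one-particle space. -/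
noncomputable def leftAlgebra {ι : Type*} (H : ClosedSubmodule ℝ (Ell ι)) :
    VonNeumannAlgebra (FullFock ι) :=
  generated {x | ∃ h ∈ H, x = leftField h}

/-- `ℬ(H) = {d(h) : h ∈ H}''` for a closed real subspace `H` of the one-particle space. -/
noncomputable def rightAlgebra {ι : Type*} (H : ClosedSubmodule ℝ (Ell ι)) :
    VonNeumannAlgebra (FullFock ι) :=
  generated {x | ∃ h ∈ H, x = rightField h}

/-- The free net `I ↦ 𝒜ₙ(I)`. -/
noncomputable def netA (n : ℕ) (hn : 1 ≤ n) (I : Set UnitAddCircle) :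
    VonNeumannAlgebra (FullFock (Mode n)) :=
  leftAlgebra (localSubspace n hn I)

/-- The free net `I ↦ ℬₙ(I)`. -/
noncomputable def netB (n : ℕ) (hn : 1 ≤ n) (I : Set UnitAddCircle) :
    VonNeumannAlgebra (FullFock (Mode n)) :=
  rightAlgebra (localSubspace n hn I)

/-- The dual net `Â(I) = A(I')'` of a net `A`, where `I'` is the complement of `I`. -/
noncomputable def dualNet {K : Type*} [NormedAddCommGroup K] [InnerProductSpace ℂ K]
    [CompleteSpace K] (A : Set UnitAddCircle → VonNeumannAlgebra K) (I : Set UnitAddCircle) :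
    VonNeumannAlgebra K :=
  (A Iᶜ).commutant

end FreeNet

namespace FreeNet

section FockOperators

variable {ι X Y Z : Type*}

/-- Pullback of square-summable families along an injective map. -/
noncomputable def comap (e : X → Z) (he : Function.Injective e) : Ell Z →L[ℂ] Ell X :=
  LinearMap.mkContinuous
    { toFun := fun f => ⟨fun x => f (e x), memℓp_gen (by
        simpa [Function.comp_def] using (summable_sq f).comp_injective he)⟩
      map_add' := fun _ _ => rfl
      map_smul' := fun _ _ => rfl }
    1
    (by
      intro f
      refine abs_le_of_sq_le_sq' ?_ (by positivity) |>.2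
      rw [one_mul, norm_sq_eq_tsum, norm_sq_eq_tsum]
      exact ((summable_sq f).comp_injective he).tsum_le_tsum_of_inj e he (fun _ _ => by positivity)
        (fun _ => le_rfl) (summable_sq f))

@[simp] theorem comap_apply (e : X → Z) (he : Function.Injective e) (f : Ell Z) (x : X) :
    comap e he f x = f (e x) := rfl

theorem injective_pair_left {e : X × Y → Z} (he : Function.Injective e) (y : Y) :
    Function.Injective fun x => e (x, y) := fun a b h => by simpa using he h

/-- The slice `x ↦ f (e (x, y))`. -/
noncomputable def slice (e : X × Y → Z) (he : Function.Injective e) (y : Y) : Ell Z →L[ℂ] Ell X :=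
  comap (fun x => e (x, y)) (injective_pair_left he y)

theorem slice_apply {e : X × Y → Z} (he : Function.Injective e) (f : Ell Z) (x : X) (y : Y) :
    slice e he y f x = f (e (x, y)) := rfl

theorem summable_slice {e : X × Y → Z} (he : Function.Injective e) (f : Ell Z) :
    (Summable fun y => ‖slice e he y f‖ ^ 2) ∧ ∑' y, ‖slice e he y f‖ ^ 2 ≤ ‖f‖ ^ 2 := by
  have s0 : Summable fun p : Y × X => ‖f (e (p.2, p.1))‖ ^ 2 :=
    (summable_sq f).comp_injective (he.comp Prod.swap_injective)
  have h1 : ∀ y, ‖slice e he y f‖ ^ 2 = ∑' x, ‖f (e (x, y))‖ ^ 2 := fun y => norm_sq_eq_tsum _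
  simp_rw [h1]
  refine ⟨s0.prod, ?_⟩
  rw [← s0.tsum_prod, norm_sq_eq_tsum f]
  exact s0.tsum_le_tsum_of_inj (fun p : Y × X => e (p.2, p.1)) (he.comp Prod.swap_injective)
    (fun _ _ => by positivity) (fun _ => le_rfl) (summable_sq f)

theorem summable_amplify {e : X × Y → Z} (he : Function.Injective e) (T : Ell X →L[ℂ] Ell X)
    (f : Ell Z) :
    (Summable fun p : X × Y => ‖T (slice e he p.2 f) p.1‖ ^ 2) ∧
      ∑' p : X × Y, ‖T (slice e he p.2 f) p.1‖ ^ 2 ≤ ‖T‖ ^ 2 * ‖f‖ ^ 2 := by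
  obtain ⟨s1, h1⟩ := summable_slice he f
  have hb : ∀ y : Y, ‖T (slice e he y f)‖ ^ 2 ≤ ‖T‖ ^ 2 * ‖slice e he y f‖ ^ 2 := by
    intro y
    rw [← mul_pow]
    exact pow_le_pow_left₀ (norm_nonneg _) (T.le_opNorm _) 2
  have s3 : Summable fun y => ‖T (slice e he y f)‖ ^ 2 :=
    (s1.mul_left (‖T‖ ^ 2)).of_nonneg_of_le (fun _ => by positivity) hb
  have s2 : Summable fun p : Y × X => ‖T (slice e he p.1 f) p.2‖ ^ 2 := by
    rw [summable_prod_of_nonneg (fun _ => by positivity)]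
    refine ⟨fun y => summable_sq (T (slice e he y f)), ?_⟩
    have h3 : ∀ y, ∑' x, ‖T (slice e he y f) x‖ ^ 2 = ‖T (slice e he y f)‖ ^ 2 :=
      fun y => (norm_sq_eq_tsum _).symm
    simpa only [h3] using s3
  refine ⟨(Equiv.prodComm X Y).summable_iff.2 s2, ?_⟩
  have h2 := (Equiv.prodComm X Y).tsum_eq (fun p : Y × X => ‖T (slice e he p.1 f) p.2‖ ^ 2)
  refine (le_of_eq h2).trans ?_
  rw [s2.tsum_prod]
  have h3 : ∀ y, ∑' x, ‖T (slice e he y f) x‖ ^ 2 = ‖T (slice e he y f)‖ ^ 2 :=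
    fun y => (norm_sq_eq_tsum _).symm
  simp only [h3]
  calc _ ≤ ∑' y : Y, ‖T‖ ^ 2 * ‖slice e he y f‖ ^ 2 := s3.tsum_le_tsum hb (s1.mul_left _)
    _ ≤ ‖T‖ ^ 2 * ‖f‖ ^ 2 := by
        rw [tsum_mul_left]
        gcongr

theorem norm_extend_sq {e : X × Y → Z} (he : Function.Injective e) (g : X × Y → ℂ) :
    (fun z => ‖Function.extend e g 0 z‖ ^ 2) = Function.extend e (fun p => ‖g p‖ ^ 2) 0 := by
  funext w
  by_cases hw : ∃ p, e p = w
  · obtain ⟨p, rfl⟩ := hw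
    simp [he.extend_apply]
  · simp [Function.extend_apply' _ _ _ hw]

theorem memlp_amplify {e : X × Y → Z} (he : Function.Injective e) (T : Ell X →L[ℂ] Ell X)
    (f : Ell Z) : Memℓp (E := fun _ : Z => ℂ)
      (Function.extend e (fun p => T (slice e he p.2 f) p.1) 0) 2 := by
  apply memℓp_gen
  have h2 := (summable_extend_zero he).2 (summable_amplify he T f).1
  rw [← norm_extend_sq he] at h2
  simpa using h2

/-- The vector acted upon by `T` in the first variable of `e (x, y)`, and `0` off the range
of `e`. -/
noncomputable def amplifyVec (e : X × Y → Z) (he : Function.Injective e) (T : Ell X →L[ℂ] Ell X)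
    (f : Ell Z) : Ell Z :=
  ⟨Function.extend e (fun p => T (slice e he p.2 f) p.1) 0, memlp_amplify he T f⟩

theorem amplifyVec_apply {e : X × Y → Z} (he : Function.Injective e) (T : Ell X →L[ℂ] Ell X)
    (f : Ell Z) (p : X × Y) : amplifyVec e he T f (e p) = T (slice e he p.2 f) p.1 :=
  he.extend_apply (fun p : X × Y => T (slice e he p.2 f) p.1) 0 p

theorem amplifyVec_apply_of_not {e : X × Y → Z} (he : Function.Injective e)
    (T : Ell X →L[ℂ] Ell X) (f : Ell Z) {z : Z} (hz : ¬∃ p, e p = z) :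
    amplifyVec e he T f z = 0 :=
  Function.extend_apply' (fun p : X × Y => T (slice e he p.2 f) p.1) (0 : Z → ℂ) z hz

/-- The operator acting as `T` on the first variable of `e (x, y)`, and as `0` off the range
of `e`. -/
noncomputable def amplify (e : X × Y → Z) (he : Function.Injective e) (T : Ell X →L[ℂ] Ell X) :
    Ell Z →L[ℂ] Ell Z :=
  LinearMap.mkContinuous
    { toFun := amplifyVec e he T
      map_add' := by
        intro f g
        apply lp.ext
        funext w
        rw [lp.coeFn_add, Pi.add_apply]
        by_cases hw : ∃ p, e p = w
        · obtain ⟨p, rfl⟩ := hw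
          simp only [amplifyVec_apply, map_add, lp.coeFn_add, Pi.add_apply]
        · simp [amplifyVec_apply_of_not _ _ _ hw]
      map_smul' := by
        intro c f
        apply lp.ext
        funext w
        rw [lp.coeFn_smul, Pi.smul_apply]
        by_cases hw : ∃ p, e p = w
        · obtain ⟨p, rfl⟩ := hw
          simp only [amplifyVec_apply, map_smul, lp.coeFn_smul, Pi.smul_apply, RingHom.id_apply]
        · simp [amplifyVec_apply_of_not _ _ _ hw] }
    ‖T‖
    (by
      intro f
      refine abs_le_of_sq_le_sq' ?_ (by positivity) |>.2
      rw [norm_sq_eq_tsum, mul_pow]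
      change ∑' w, ‖Function.extend e _ (0 : Z → ℂ) w‖ ^ 2 ≤ _
      rw [norm_extend_sq he, tsum_extend_zero he]
      exact (summable_amplify he T f).2)

theorem amplify_apply {e : X × Y → Z} (he : Function.Injective e) (T : Ell X →L[ℂ] Ell X)
    (f : Ell Z) (x : X) (y : Y) :
    amplify e he T f (e (x, y)) = T (slice e he y f) x :=
  amplifyVec_apply he T f (x, y)

theorem amplify_apply_of_not {e : X × Y → Z} (he : Function.Injective e) (T : Ell X →L[ℂ] Ell X)
    (f : Ell Z) {z : Z} (hz : ¬∃ p, e p = z) : amplify e he T f z = 0 :=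
  amplifyVec_apply_of_not he T f hz

theorem cons_swap_injective : Function.Injective fun p : List ι × ι => p.2 :: p.1 :=
  cons_injective.comp Prod.swap_injective

@[simp] theorem vacuum_nil : vacuum ι [] = 1 := by simp [vacuum]

@[simp] theorem vacuum_cons (i : ι) (w : List ι) : vacuum ι (i :: w) = 0 := by simp [vacuum]

/-- The operator `A ⊗ T` on `ℓ²(ι) ⊗ ℱ ⊆ ℱ`. -/
noncomputable def consOp (A : Ell ι →L[ℂ] Ell ι) (T : FullFock ι →L[ℂ] FullFock ι) :
    FullFock ι →L[ℂ] FullFock ι :=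
  amplify (fun p : ι × List ι => p.1 :: p.2) cons_injective A ∘L
    amplify (fun p : List ι × ι => p.2 :: p.1) cons_swap_injective T

theorem consOp_vacuum (A : Ell ι →L[ℂ] Ell ι) (T : FullFock ι →L[ℂ] FullFock ι) :
    consOp A T (vacuum ι) = 0 := by
  have : amplify (fun p : List ι × ι => p.2 :: p.1) cons_swap_injective T (vacuum ι) = 0 := by
    ext w
    cases w with
    | nil => exact amplify_apply_of_not _ _ _ (by simp)
    | cons i w =>
      refine (amplify_apply cons_swap_injective T _ w i).trans ?_
      have : slice (fun p : List ι × ι => p.2 :: p.1) cons_swap_injective i (vacuum ι) = 0 := by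
        ext; simp [slice_apply]
      rw [this]; simp
  rw [consOp, ContinuousLinearMap.comp_apply, this, map_zero]

theorem consOp_leftCreation (A : Ell ι →L[ℂ] Ell ι) (T : FullFock ι →L[ℂ] FullFock ι) (h : Ell ι)
    (ψ : FullFock ι) : consOp A T (leftCreation h ψ) = leftCreation (A h) (T ψ) := by
  have h1 : amplify (fun p : List ι × ι => p.2 :: p.1) cons_swap_injective T (leftCreation h ψ) =
      leftCreation h (T ψ) := by
    ext w
    cases w with
    | nil => rw [amplify_apply_of_not _ _ _ (by simp)]; simp
    | cons i w =>
      refine (amplify_apply cons_swap_injective T _ w i).trans ?_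
      have : slice (fun p : List ι × ι => p.2 :: p.1) cons_swap_injective i
          (leftCreation h ψ) = h i • ψ := by
        ext; simp [slice_apply]
      rw [this]; simp
  rw [consOp, ContinuousLinearMap.comp_apply, h1]
  ext w
  cases w with
  | nil => rw [amplify_apply_of_not _ _ _ (by simp)]; simp
  | cons i w =>
    refine (amplify_apply cons_injective A _ i w).trans ?_
    have : slice (fun p : ι × List ι => p.1 :: p.2) cons_injective w
        (leftCreation h (T ψ)) = (T ψ) w • h := by
      ext; simp [slice_apply, mul_comm]
    rw [this]; simp [mul_comm]

theorem apply_slice_eq_zero_of_consOp {A : Ell ι →L[ℂ] Ell ι} (hA : Function.Injective A)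
    {T : FullFock ι →L[ℂ] FullFock ι} {ψ : FullFock ι} (h : consOp A T ψ = 0) (i : ι) :
    T (comap (fun w => i :: w) (fun _ _ h => by simpa using h) ψ) = 0 := by
  set φ := amplify (fun p : List ι × ι => p.2 :: p.1) cons_swap_injective T ψ with hφ
  have h1 : ∀ w, slice (fun p : ι × List ι => p.1 :: p.2) cons_injective w φ = 0 := by
    intro w
    apply hA
    rw [map_zero]
    ext j
    refine (amplify_apply cons_injective A φ j w).symm.trans ?_
    change consOp A T ψ _ = _
    rw [h]; rfl
  ext w
  refine (amplify_apply cons_swap_injective T ψ w i).symm.trans ?_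
  change φ (i :: w) = _
  have := congrArg (fun f : Ell ι => f i) (h1 w)
  simpa [slice_apply] using this

theorem single_nil [DecidableEq (List ι)] (c : ℂ) :
    (lp.single 2 ([] : List ι) c : FullFock ι) = c • vacuum ι := by
  ext w
  cases w <;> simp [lp.single_apply]

theorem single_cons [DecidableEq (List ι)] [DecidableEq ι] (i : ι) (w : List ι) (c : ℂ) :
    (lp.single 2 (i :: w) c : FullFock ι) =
      leftCreation (lp.single 2 i (1 : ℂ)) (lp.single 2 w c) := by
  ext v
  cases v with
  | nil => simp [lp.single_apply]
  | cons j v =>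
    rw [leftCreation_cons, lp.single_apply, lp.single_apply, lp.single_apply]
    by_cases hj : j = i
    · subst hj
      by_cases hv : v = w
      · subst hv; simp
      · simp [hv]
    · simp [Pi.single_apply, hj]

/-- Bounded operators on the full Fock space are determined by their values on simple tensors. -/
theorem ext_tensor {E : Type*} [NormedAddCommGroup E] [NormedSpace ℂ E]
    {S T : FullFock ι →L[ℂ] E} (h : ∀ L, S (tensor L) = T (tensor L)) : S = T := by
  classical
  have h1 : ∀ w : List ι, (lp.single 2 w (1 : ℂ) : FullFock ι) =
      tensor (w.map fun i => lp.single 2 i (1 : ℂ)) := by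
    intro w
    induction w with
    | nil => simp [single_nil, tensor]
    | cons i w ih => rw [single_cons, ih]; rfl
  ext ψ
  have hs := lp.hasSum_single (p := 2) (by norm_num) ψ
  refine (hs.mapL S).unique ?_
  convert hs.mapL T using 2 with w
  have : (lp.single 2 w (ψ w) : FullFock ι) = ψ w • lp.single 2 w (1 : ℂ) := by
    rw [← lp.single_smul]; simp
  rw [this, map_smul, map_smul, h1, h]

theorem ext_leftCreation {E : Type*} [NormedAddCommGroup E] [NormedSpace ℂ E]
    {S T : FullFock ι →L[ℂ] E} (h0 : S (vacuum ι) = T (vacuum ι))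
    (h : ∀ k ψ, S (leftCreation k ψ) = T (leftCreation k ψ)) : S = T :=
  ext_tensor fun L => by cases L with
    | nil => exact h0
    | cons k L => exact h _ _

theorem inner_vacuum_leftCreation (h : Ell ι) (ψ : FullFock ι) :
    ⟪vacuum ι, leftCreation h ψ⟫ = 0 := by simp [inner_vacuum]

theorem inner_leftCreation_vacuum (h : Ell ι) (ψ : FullFock ι) :
    ⟪leftCreation h ψ, vacuum ι⟫ = 0 := by
  rw [← inner_conj_symm, inner_vacuum_leftCreation, map_zero]

theorem ext_inner_fock {φ ψ : FullFock ι} (h0 : φ [] = ψ [])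
    (h : ∀ k χ, ⟪leftCreation k χ, φ⟫ = ⟪leftCreation k χ, ψ⟫) : φ = ψ := by
  have : innerSL ℂ φ = innerSL ℂ ψ := by
    refine ext_leftCreation ?_ fun k χ => ?_
    · rw [innerSL_apply_apply, innerSL_apply_apply, ← inner_conj_symm, inner_vacuum, h0,
        ← inner_vacuum, inner_conj_symm]
    · rw [innerSL_apply_apply, innerSL_apply_apply, ← inner_conj_symm, h, inner_conj_symm]
  refine ext_inner_right ℂ fun v => ?_
  simpa using congrArg (fun f => f v) this

theorem adjoint_leftCreation_leftCreation (h k : Ell ι) (ψ : FullFock ι) :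
    (leftCreation h).adjoint (leftCreation k ψ) = ⟪h, k⟫ • ψ := by
  refine ext_inner_left ℂ fun v => ?_
  rw [ContinuousLinearMap.adjoint_inner_right, inner_leftCreation, inner_smul_right]

theorem adjoint_leftCreation_vacuum (h : Ell ι) : (leftCreation h).adjoint (vacuum ι) = 0 := by
  refine ext_inner_left ℂ fun v => ?_
  rw [ContinuousLinearMap.adjoint_inner_right, inner_leftCreation_vacuum, inner_zero_right]

theorem adjoint_consOp (A : Ell ι →L[ℂ] Ell ι) (T : FullFock ι →L[ℂ] FullFock ι) :
    (consOp A T).adjoint = consOp A.adjoint T.adjoint := by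
  refine ext_leftCreation ?_ fun k ψ => ?_
  · rw [consOp_vacuum]
    refine ext_inner_fock ?_ fun h φ => ?_
    · rw [← inner_vacuum, ContinuousLinearMap.adjoint_inner_right, consOp_vacuum, inner_zero_left]
      rfl
    · rw [ContinuousLinearMap.adjoint_inner_right, consOp_leftCreation, inner_leftCreation_vacuum,
        inner_zero_right]
  · rw [consOp_leftCreation]
    refine ext_inner_fock ?_ fun h φ => ?_
    · rw [← inner_vacuum, ContinuousLinearMap.adjoint_inner_right, consOp_vacuum, inner_zero_left]
      simp
    · rw [ContinuousLinearMap.adjoint_inner_right, consOp_leftCreation, inner_leftCreation,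
        inner_leftCreation, ContinuousLinearMap.adjoint_inner_right,
        ContinuousLinearMap.adjoint_inner_right]

theorem consOp_mul (A B : Ell ι →L[ℂ] Ell ι) (S T : FullFock ι →L[ℂ] FullFock ι) :
    consOp A S * consOp B T = consOp (A * B) (S * T) := by
  refine ext_leftCreation ?_ fun k ψ => ?_
  · simp [consOp_vacuum]
  · simp [consOp_leftCreation]

/-- The projection onto the vacuum. -/
noncomputable def vacuumProj (ι : Type*) : FullFock ι →L[ℂ] FullFock ι :=
  (innerSL ℂ (vacuum ι)).smulRight (vacuum ι)

theorem vacuumProj_apply (ψ : FullFock ι) : vacuumProj ι ψ = ψ [] • vacuum ι := by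
  simp [vacuumProj, inner_vacuum]

theorem adjoint_vacuumProj : (vacuumProj ι).adjoint = vacuumProj ι := by
  rw [eq_comm, ContinuousLinearMap.eq_adjoint_iff]
  intro φ ψ
  simp only [vacuumProj_apply, inner_smul_left, inner_smul_right, inner_vacuum]
  rw [← inner_conj_symm φ, inner_vacuum, mul_comm]

theorem vacuumProj_mul_self : vacuumProj ι * vacuumProj ι = vacuumProj ι := by
  ext1 ψ
  simp [vacuumProj_apply]

/-- `A^{⊗ k}` on the words of length `k`, and `0` on the words of other lengths. -/
noncomputable def tensorPow (A : Ell ι →L[ℂ] Ell ι) : ℕ → FullFock ι →L[ℂ] FullFock ι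
  | 0 => vacuumProj ι
  | k + 1 => consOp A (tensorPow A k)

theorem tensorPow_tensor (A : Ell ι →L[ℂ] Ell ι) (k : ℕ) (L : List (Ell ι)) :
    tensorPow A k (tensor L) = if L.length = k then tensor (L.map A) else 0 := by
  induction k generalizing L with
  | zero => cases L <;> simp [tensorPow, vacuumProj_apply, tensor]
  | succ k ih =>
    cases L with
    | nil => simp [tensorPow, tensor, consOp_vacuum]
    | cons h L =>
      simp only [tensorPow, tensor, consOp_leftCreation, ih, List.length_cons, add_left_inj,
        List.map_cons]
      split_ifs <;> simp

theorem tensorPow_adjoint_mul (B : Ell ι →L[ℂ] Ell ι) (k : ℕ) :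
    (tensorPow B k).adjoint * tensorPow B k = tensorPow (B.adjoint * B) k := by
  induction k with
  | zero => simp only [tensorPow]; rw [adjoint_vacuumProj, vacuumProj_mul_self]
  | succ k ih =>
    simp only [tensorPow]
    rw [adjoint_consOp, consOp_mul, ih]

theorem eq_zero_of_tensorPow_eq_zero {B : Ell ι →L[ℂ] Ell ι} (hB : Function.Injective B) (w : List ι)
    {ψ : FullFock ι} (h : tensorPow B w.length ψ = 0) : ψ w = 0 := by
  induction w generalizing ψ with
  | nil =>
    have := congrArg (fun φ : FullFock ι => φ []) h
    simpa [tensorPow, vacuumProj_apply] using this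
  | cons i w ih => exact ih (apply_slice_eq_zero_of_consOp hB h i)

/-! ### The left and the right fields -/

theorem leftCreation_add (h k : Ell ι) (ψ : FullFock ι) :
    leftCreation (h + k) ψ = leftCreation h ψ + leftCreation k ψ := by
  ext w; cases w <;> simp [add_mul]

theorem leftCreation_smul (c : ℂ) (h : Ell ι) (ψ : FullFock ι) :
    leftCreation (c • h) ψ = c • leftCreation h ψ := by
  ext w; cases w <;> simp [mul_assoc]

theorem norm_leftCreation (h : Ell ι) (ψ : FullFock ι) : ‖leftCreation h ψ‖ = ‖h‖ * ‖ψ‖ := by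
  have h1 := inner_leftCreation h h ψ ψ
  rw [inner_self_eq_norm_sq_to_K, inner_self_eq_norm_sq_to_K, inner_self_eq_norm_sq_to_K] at h1
  have h2 : ‖leftCreation h ψ‖ ^ 2 = (‖h‖ * ‖ψ‖) ^ 2 := by
    rw [mul_pow]; exact_mod_cast h1
  exact (pow_left_inj₀ (norm_nonneg _) (by positivity) two_ne_zero).1 h2

/-- `h ↦ ℓ(h) ψ`. -/
noncomputable def leftCreationCLM (ψ : FullFock ι) : Ell ι →L[ℂ] FullFock ι :=
  LinearMap.mkContinuous
    { toFun := fun h => leftCreation h ψ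
      map_add' := fun h k => leftCreation_add h k ψ
      map_smul' := fun c h => leftCreation_smul c h ψ } ‖ψ‖
    fun h => by rw [mul_comm]; exact (norm_leftCreation h ψ).le

@[simp] theorem leftCreationCLM_apply (ψ : FullFock ι) (h : Ell ι) :
    leftCreationCLM ψ h = leftCreation h ψ := rfl

theorem tensor_append_add (L M : List (Ell ι)) (h k : Ell ι) :
    tensor (L ++ (h + k) :: M) = tensor (L ++ h :: M) + tensor (L ++ k :: M) := by
  induction L with
  | nil => exact leftCreation_add h k _
  | cons g L ih => simp only [List.cons_append, tensor, ih, map_add]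

theorem tensor_append_smul (L M : List (Ell ι)) (c : ℂ) (h : Ell ι) :
    tensor (L ++ (c • h) :: M) = c • tensor (L ++ h :: M) := by
  induction L with
  | nil => exact leftCreation_smul c h _
  | cons g L ih => simp only [List.cons_append, tensor, ih, map_smul]

/-- The unitary reversing the order of the tensor factors. -/
noncomputable def flip (ι : Type*) : FullFock ι →L[ℂ] FullFock ι :=
  comap List.reverse List.reverse_injective

theorem flip_apply (ψ : FullFock ι) (w : List ι) : flip ι ψ w = ψ w.reverse := rfl

theorem flip_mul_flip : flip ι * flip ι = 1 := by
  ext ψ w; simp [flip_apply]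

theorem adjoint_flip : (flip ι).adjoint = flip ι := by
  rw [eq_comm, ContinuousLinearMap.eq_adjoint_iff]
  intro φ ψ
  rw [lp.inner_eq_tsum, lp.inner_eq_tsum]
  have := (Equiv.ofBijective (List.reverse (α := ι)) List.reverse_bijective).tsum_eq
    (fun w => ⟪flip ι φ w, ψ w⟫)
  rw [← this]
  simp [flip_apply]

theorem rightCreation_eq (h : Ell ι) : rightCreation h = flip ι * leftCreation h * flip ι := by
  ext ψ w
  rcases List.eq_nil_or_concat w with rfl | ⟨v, i, rfl⟩
  · simp [flip_apply]
  · rw [List.concat_eq_append, rightCreation_snoc]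
    simp [flip_apply]

theorem rightField_eq (h : Ell ι) : rightField h = flip ι * leftField h * flip ι := by
  have : (rightCreation h).adjoint = flip ι * (leftCreation h).adjoint * flip ι := by
    rw [rightCreation_eq]
    simp only [ContinuousLinearMap.mul_def, ContinuousLinearMap.adjoint_comp, adjoint_flip,
      ContinuousLinearMap.comp_assoc]
  rw [rightField, leftField, this, rightCreation_eq, mul_add, add_mul]

theorem flip_tensor (L : List (Ell ι)) : flip ι (tensor L) = tensor L.reverse := by
  induction L with
  | nil => ext w; simp [flip_apply, tensor]; cases w <;> simp [vacuum]
  | cons h L ih =>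
    rw [List.reverse_cons, ← rightCreation_tensor, rightCreation_eq]
    have h2 : flip ι (flip ι (tensor L)) = tensor L := by
      have := congrArg (fun T => T (tensor L)) (flip_mul_flip (ι := ι))
      simpa using this
    rw [← ih]
    simp only [mul_apply_eq_comp, h2, tensor]

theorem star_leftField (h : Ell ι) : star (leftField h) = leftField h := by
  rw [leftField, star_add, ← ContinuousLinearMap.star_eq_adjoint, star_star, add_comm]

theorem star_rightField (h : Ell ι) : star (rightField h) = rightField h := by
  rw [rightField, star_add, ← ContinuousLinearMap.star_eq_adjoint, star_star, add_comm]

theorem leftCreation_rightCreation (h k : Ell ι) (ψ : FullFock ι) :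
    leftCreation h (rightCreation k ψ) = rightCreation k (leftCreation h ψ) := by
  have : leftCreation h * rightCreation k = rightCreation k * leftCreation h := by
    refine ext_tensor fun L => ?_
    simp only [mul_apply_eq_comp, rightCreation_tensor, leftCreation_tensor,
      List.cons_append]
  exact congrArg (fun T => T ψ) this

theorem adjoint_leftCreation_rightCreation (h k : Ell ι) :
    (leftCreation h).adjoint * rightCreation k =
      rightCreation k * (leftCreation h).adjoint + ⟪h, k⟫ • vacuumProj ι := by
  refine ext_leftCreation ?_ fun g ψ => ?_
  · have : rightCreation k (vacuum ι) = leftCreation k (vacuum ι) := rightCreation_tensor k []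
    simp [adjoint_leftCreation_vacuum, vacuumProj_apply, this, adjoint_leftCreation_leftCreation]
  · simp [← leftCreation_rightCreation, adjoint_leftCreation_leftCreation, vacuumProj_apply]

theorem leftField_mul_rightField (h k : Ell ι) :
    leftField h * rightField k - rightField k * leftField h =
      (2 * (⟪h, k⟫.im : ℂ) * Complex.I) • vacuumProj ι := by
  have h1 := adjoint_leftCreation_rightCreation h k
  have h2 : (rightCreation k).adjoint * leftCreation h =
      leftCreation h * (rightCreation k).adjoint + ⟪k, h⟫ • vacuumProj ι := by
    have := congrArg star h1
    simp only [← ContinuousLinearMap.star_eq_adjoint, star_mul, star_star, star_add,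
      star_smul] at this ⊢
    rw [this, ContinuousLinearMap.star_eq_adjoint (vacuumProj ι), adjoint_vacuumProj]
    simp
  have h3 : leftCreation h * rightCreation k = rightCreation k * leftCreation h :=
    ContinuousLinearMap.ext fun ψ => leftCreation_rightCreation h k ψ
  have h4 : (leftCreation h).adjoint * (rightCreation k).adjoint =
      (rightCreation k).adjoint * (leftCreation h).adjoint := by
    have := congrArg star h3
    simpa only [← ContinuousLinearMap.star_eq_adjoint, star_mul] using this.symm
  have h5 : (2 * (⟪h, k⟫.im : ℂ) * Complex.I) = ⟪h, k⟫ - ⟪k, h⟫ := by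
    rw [← inner_conj_symm k h, Complex.sub_conj]; push_cast; ring
  rw [leftField, rightField, h5, sub_smul]
  simp only [add_mul, mul_add, h1, h2, h3, h4]
  abel

/-- `ℓ(h₁) ⋯ ℓ(hₖ)`. -/
noncomputable def creationProd (L : List (Ell ι)) : FullFock ι →L[ℂ] FullFock ι :=
  (L.map leftCreation).prod

/-- The Wick product of the left fields, `∑ⱼ ℓ(h₁) ⋯ ℓ(hⱼ) ℓ(hⱼ₊₁)* ⋯ ℓ(hₖ)*`. -/
noncomputable def wick : List (Ell ι) → FullFock ι →L[ℂ] FullFock ι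
  | [] => 1
  | h :: L => leftCreation h * wick L + star (creationProd (h :: L).reverse)

theorem wick_append_singleton (L : List (Ell ι)) (h : Ell ι) :
    wick (L ++ [h]) = wick L * star (leftCreation h) + creationProd (L ++ [h]) := by
  induction L with
  | nil => simp [wick, creationProd, add_comm]
  | cons g L ih =>
    simp only [List.cons_append, wick, ih]
    simp only [creationProd, List.reverse_cons, List.reverse_append, List.map_append,
      List.prod_append, List.map_cons, List.prod_cons, star_mul, mul_add, add_mul, mul_assoc,
      List.map_nil, List.prod_nil, mul_one, List.reverse_nil, List.nil_append, List.cons_append]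
    abel

theorem star_wick (L : List (Ell ι)) : star (wick L) = wick L.reverse := by
  induction L with
  | nil => simp [wick]
  | cons h L ih =>
    rw [List.reverse_cons, wick_append_singleton, wick, star_add, star_mul, star_star, ih,
      List.reverse_cons]

theorem star_creationProd_vacuum {L : List (Ell ι)} (hL : L ≠ []) :
    star (creationProd L) (vacuum ι) = 0 := by
  cases L with
  | nil => exact absurd rfl hL
  | cons h L =>
    simp [creationProd, ContinuousLinearMap.star_eq_adjoint, ContinuousLinearMap.mul_def,
      ContinuousLinearMap.adjoint_comp, adjoint_leftCreation_vacuum]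

theorem wick_vacuum (L : List (Ell ι)) : wick L (vacuum ι) = tensor L := by
  induction L with
  | nil => rfl
  | cons h L ih =>
    have := star_creationProd_vacuum (L := (h :: L).reverse) (by simp)
    rw [wick, add_apply, this, add_zero, mul_apply_eq_comp, ih]
    rfl

theorem leftField_mul_wick_singleton (h : Ell ι) : leftField h * wick [] = wick [h] := by
  simp [wick, creationProd, leftField, ContinuousLinearMap.star_eq_adjoint]

theorem leftField_mul_wick_cons (h k : Ell ι) (L : List (Ell ι)) :
    leftField h * wick (k :: L) = wick (h :: k :: L) + ⟪h, k⟫ • wick L := by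
  have h1 : star (leftCreation h) * leftCreation k = ⟪h, k⟫ • 1 := by
    ext1 ψ
    simp [ContinuousLinearMap.star_eq_adjoint, adjoint_leftCreation_leftCreation]
  have h2 : star (leftCreation h) * (leftCreation k * wick L) = ⟪h, k⟫ • wick L := by
    rw [← mul_assoc, h1, smul_one_mul]
  rw [leftField, ← ContinuousLinearMap.star_eq_adjoint, wick, wick, wick, add_mul, mul_add (star _),
    h2]
  have h3 : creationProd (h :: k :: L).reverse = creationProd (k :: L).reverse * leftCreation h := by
    rw [List.reverse_cons, creationProd, List.map_append, List.prod_append]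
    simp [creationProd]
  rw [h3, star_mul]
  abel

theorem wick_mem {M : Subalgebra ℂ (FullFock ι →L[ℂ] FullFock ι)} {H : Set (Ell ι)}
    (hM : ∀ h ∈ H, leftField h ∈ M) (L : List (Ell ι)) (hL : ∀ h ∈ L, h ∈ H) : wick L ∈ M := by
  have key : ∀ (k : ℕ) (L : List (Ell ι)), L.length ≤ k → (∀ h ∈ L, h ∈ H) → wick L ∈ M := by
    intro k
    induction k with
    | zero =>
      intro L hl _
      rw [List.length_eq_zero_iff.1 (Nat.le_zero.1 hl)]
      exact M.one_mem
    | succ k ih =>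
      intro L hl hL
      match L, hl, hL with
      | [], _, _ => exact M.one_mem
      | [h], _, hL =>
        rw [← leftField_mul_wick_singleton]
        exact M.mul_mem (hM h (hL h (by simp))) M.one_mem
      | h :: g :: L, hl, hL =>
        have h1 : wick (h :: g :: L) = leftField h * wick (g :: L) - ⟪h, g⟫ • wick L := by
          rw [leftField_mul_wick_cons, add_sub_cancel_right]
        rw [h1]
        simp only [List.length_cons] at hl
        refine M.sub_mem (M.mul_mem (hM h (hL h (by simp))) (ih _ (by simp; omega) ?_))
          (M.smul_mem (ih _ (by omega) ?_) _)
        · intro x hx; exact hL x (List.mem_cons_of_mem _ hx)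
        · intro x hx; exact hL x (List.mem_cons_of_mem _ (List.mem_cons_of_mem _ hx))
  exact key _ L le_rfl hL

end FockOperators

section RealSubspaces

variable {E : Type*} [NormedAddCommGroup E] [InnerProductSpace ℂ E]

/-- The real subspaces of a complex vector space, as sets. -/
structure IsRealSubspace (H : Set E) : Prop where
  zero_mem : (0 : E) ∈ H
  add_mem : ∀ {x y}, x ∈ H → y ∈ H → x + y ∈ H
  smul_mem : ∀ (r : ℝ) {x}, x ∈ H → (r : ℂ) • x ∈ H

theorem IsRealSubspace.neg_mem {H : Set E} (hH : IsRealSubspace H) {x : E} (hx : x ∈ H) :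
    -x ∈ H := by
  simpa using hH.smul_mem (-1) hx

theorem IsRealSubspace.closure {H : Set E} (hH : IsRealSubspace H) :
    IsRealSubspace (closure H) where
  zero_mem := subset_closure hH.zero_mem
  add_mem hx hy := map_mem_closure₂ continuous_add hx hy fun _ ha _ hb => hH.add_mem ha hb
  smul_mem r _ hx := map_mem_closure (continuous_const_smul (r : ℂ)) hx fun _ ha => hH.smul_mem r ha

theorem exists_proj_of_isClosed {F : Type*} [NormedAddCommGroup F] [InnerProductSpace ℝ F]
    [CompleteSpace F] {H : Set F} (h0 : (0 : F) ∈ H) (hadd : ∀ {x y}, x ∈ H → y ∈ H → x + y ∈ H)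
    (hsmul : ∀ (r : ℝ) (x : F), x ∈ H → r • x ∈ H) (hc : IsClosed H) :
    ∃ P : F →L[ℝ] F, (∀ u, P u ∈ H) ∧ ∀ u, ∀ h ∈ H, inner ℝ (u - P u) h = 0 := by
  let V : Submodule ℝ F :=
    { carrier := H
      zero_mem' := h0
      add_mem' := hadd
      smul_mem' := hsmul }
  have : IsClosed (V : Set F) := hc
  have : CompleteSpace V := this.completeSpace_coe
  have hm : ∀ u, V.starProjection u ∈ V := fun u => V.starProjection_apply_mem u
  refine ⟨V.starProjection, hm, fun u h hh => ?_⟩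
  exact (Submodule.mem_orthogonal' V _).1 (V.sub_starProjection_mem_orthogonal u) h hh

theorem exists_real_proj [CompleteSpace E] {H : Set E} (hH : IsRealSubspace H) (hc : IsClosed H) :
    ∃ P : E →L[ℝ] E, (∀ u, P u ∈ H) ∧ ∀ u, ∀ h ∈ H, (⟪u - P u, h⟫).re = 0 := by
  obtain ⟨P, hP, hPo⟩ := @exists_proj_of_isClosed E _ InnerProductSpace.complexToReal _ H hH.zero_mem
    hH.add_mem (fun r x hx => hH.smul_mem r hx) hc
  exact ⟨P, hP, fun u h hh => hPo u h hh⟩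

variable [CompleteSpace E]

/-- The sum of the real orthogonal projections onto `H` and `i H`. -/
theorem exists_sum_real_proj {H : Set E} (hH : IsRealSubspace H) (hc : IsClosed H) :
    ∃ (P : E → E) (R : E →L[ℂ] E), (∀ u, P u ∈ H) ∧ (∀ u, ∀ h ∈ H, (⟪u - P u, h⟫).re = 0) ∧
      (∀ u, R u = P u - Complex.I • P (Complex.I • u)) ∧ R.IsPositive ∧
      ((2 : ℂ) • ContinuousLinearMap.id ℂ E - R).IsPositive ∧
      ∀ u, R u = 0 → P u = 0 ∧ P (Complex.I • u) = 0 := by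
  obtain ⟨P, hP, hPo⟩ := exists_real_proj hH hc
  have hsmul : ∀ (r : ℝ) u, P ((r : ℂ) • u) = (r : ℂ) • P u := by
    intro r u
    rw [Complex.coe_smul, map_smul, Complex.coe_smul]
  let R : E →L[ℂ] E :=
    { toFun := fun u => P u - Complex.I • P (Complex.I • u)
      map_add' := fun u v => by simp only [smul_add, map_add]; abel
      map_smul' := fun c u => by
        have hc : c = (c.re : ℂ) + (c.im : ℂ) * Complex.I := (Complex.re_add_im c).symm
        rw [RingHom.id_apply, hc]
        have e1 : Complex.I • ((c.re : ℂ) + (c.im : ℂ) * Complex.I) • u =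
            (c.re : ℂ) • Complex.I • u - (c.im : ℂ) • u := by
          simp only [smul_smul, ← sub_smul]
          congr 1
          linear_combination (c.im : ℂ) * Complex.I_sq
        rw [e1, add_smul, mul_smul, map_add, map_sub, hsmul, hsmul, hsmul, hsmul]
        match_scalars
        · ring
        · linear_combination (c.im : ℂ) * Complex.I_sq
      cont := by fun_prop }
  have hR : ∀ u, R u = P u - Complex.I • P (Complex.I • u) := fun _ => rfl
  have hsym1 : ∀ u v, (⟪P u, v⟫).re = (⟪P u, P v⟫).re := by
    intro u v
    have := hPo v (P u) (hP u)
    rw [← inner_conj_symm, Complex.conj_re, inner_sub_right, Complex.sub_re] at this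
    linarith
  have hsym : ∀ u v, (⟪P u, v⟫).re = (⟪u, P v⟫).re := by
    intro u v
    rw [hsym1, ← inner_conj_symm u, Complex.conj_re, hsym1 v u, ← inner_conj_symm, Complex.conj_re]
  have hnn : ∀ u, (⟪P u, u⟫).re = ‖P u‖ ^ 2 := by
    intro u
    rw [hsym1]
    exact (norm_sq_eq_re_inner (𝕜 := ℂ) (P u)).symm
  have hI : ∀ x y : E, ⟪-(Complex.I • x), y⟫ = ⟪x, Complex.I • y⟫ := by
    intro x y
    rw [inner_neg_left, inner_smul_left, inner_smul_right]
    simp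
  have hre : ∀ u, (⟪R u, u⟫).re = ‖P u‖ ^ 2 + ‖P (Complex.I • u)‖ ^ 2 := by
    intro u
    rw [hR, sub_eq_add_neg, inner_add_left, hI, Complex.add_re, hnn, hnn]
  have him : ∀ u, (⟪R u, u⟫).im = 0 := by
    intro u
    have h1 : (⟪R u, u⟫).im = -(⟪R u, Complex.I • u⟫).re * 1 := by
      rw [inner_smul_right]; simp
    have h2 : (⟪R u, Complex.I • u⟫).re = 0 := by
      rw [hR, sub_eq_add_neg, inner_add_left, hI, Complex.add_re, hsym u]
      have : Complex.I • Complex.I • u = -u := by rw [smul_smul, Complex.I_mul_I, neg_one_smul]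
      rw [this, inner_neg_right, Complex.neg_re, ← inner_conj_symm u, Complex.conj_re]
      ring
    rw [h1, h2]; simp
  have hle : ∀ u, ‖P u‖ ^ 2 ≤ ‖u‖ ^ 2 := by
    intro u
    have h1 : ‖P u‖ ^ 2 ≤ ‖P u‖ * ‖u‖ := by
      rw [← hnn]
      exact (Complex.re_le_norm _).trans (norm_inner_le_norm _ _)
    nlinarith [norm_nonneg (P u), norm_nonneg u, sq_nonneg (‖P u‖ - ‖u‖)]
  refine ⟨P, R, hP, hPo, hR, ?_, ?_, ?_⟩
  · rw [ContinuousLinearMap.isPositive_iff_complex]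
    refine fun u => ⟨Complex.ext (by simp) (by simp [him]), ?_⟩
    change 0 ≤ (⟪R u, u⟫).re
    rw [hre]; positivity
  · rw [ContinuousLinearMap.isPositive_iff_complex]
    have e : ∀ u, ⟪((2 : ℂ) • ContinuousLinearMap.id ℂ E - R) u, u⟫ =
        ((2 * ‖u‖ ^ 2 : ℝ) : ℂ) - ⟪R u, u⟫ := by
      intro u
      simp [inner_self_eq_norm_sq_to_K, two_smul, two_mul]
    refine fun u => ⟨Complex.ext (by simp) ?_, ?_⟩
    · have h0 : (⟪((2 : ℂ) • ContinuousLinearMap.id ℂ E - R) u, u⟫).im = 0 := by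
        rw [e, Complex.sub_im, Complex.ofReal_im, him, sub_zero]
      rw [h0]
      exact Complex.ofReal_im _
    · rw [e]
      change 0 ≤ (((2 * ‖u‖ ^ 2 : ℝ) : ℂ) - ⟪R u, u⟫).re
      rw [Complex.sub_re, Complex.ofReal_re, hre]
      have h1 := hle u
      have h2 := hle (Complex.I • u)
      rw [norm_smul, Complex.norm_I, one_mul] at h2
      linarith
  · intro u hu
    have := hre u
    rw [hu, inner_zero_left, Complex.zero_re] at this
    constructor <;> rw [← norm_eq_zero] <;> nlinarith [sq_nonneg ‖P u‖, sq_nonneg ‖P (Complex.I • u)‖]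

theorem exists_adjoint_mul_self {R : E →L[ℂ] E} (hR : R.IsPositive) :
    ∃ B : E →L[ℂ] E, R = B.adjoint * B :=
  CStarAlgebra.nonneg_iff_eq_star_mul_self.1 ((ContinuousLinearMap.nonneg_iff_isPositive R).2 hR)

end RealSubspaces

section Commutation

variable {E : Type*} [NormedAddCommGroup E] [InnerProductSpace ℂ E] [CompleteSpace E]

theorem subset_generated (S : Set (E →L[ℂ] E)) : S ⊆ generated S := by
  rw [coe_generated]
  exact Set.subset_union_left.trans Set.subset_centralizer_centralizer

theorem generated_commute {S T : Set (E →L[ℂ] E)} (hS : ∀ a ∈ S, star a = a)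
    (hT : ∀ b ∈ T, star b = b) (h : ∀ a ∈ S, ∀ b ∈ T, a * b = b * a) :
    ∀ a ∈ generated S, ∀ b ∈ generated T, a * b = b * a := by
  have hS' : S ∪ star S = S := Set.union_eq_left.2 fun a ha => by
    have := hS _ ha; rw [star_star] at this; rw [this]; exact ha
  have hT' : T ∪ star T = T := Set.union_eq_left.2 fun a ha => by
    have := hT _ ha; rw [star_star] at this; rw [this]; exact ha
  intro a ha b hb
  have ha' : a ∈ Set.centralizer (Set.centralizer S) := by
    have : a ∈ (generated S : Set (E →L[ℂ] E)) := ha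
    rwa [coe_generated, hS'] at this
  have hb' : b ∈ Set.centralizer (Set.centralizer T) := by
    have : b ∈ (generated T : Set (E →L[ℂ] E)) := hb
    rwa [coe_generated, hT'] at this
  have h1 : T ⊆ Set.centralizer S := fun b hb a ha => h a ha b hb
  have h2 : Set.centralizer (Set.centralizer T) ⊆ Set.centralizer S := by
    rw [← Set.centralizer_centralizer_centralizer S]
    exact Set.centralizer_subset (Set.centralizer_subset h1)
  exact (ha' b (h2 hb')).symm

/-- A commutation theorem: commuting von Neumann algebras `M` and `N` are each other's commutants
if `Ω` is cyclic for `M` and the real subspace `M_sa Ω + i N_sa Ω` is dense. -/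
theorem commutant_eq_of_real_dense (M N : VonNeumannAlgebra E) (Ω : E)
    (hMN : ∀ a ∈ M, ∀ b ∈ N, a * b = b * a)
    (hcyc : ∀ ξ : E, (∀ a ∈ M, ⟪a Ω, ξ⟫ = 0) → ξ = 0)
    (hd : ∀ ξ : E, (∀ a ∈ M, star a = a → (⟪ξ, a Ω⟫).re = 0) →
      (∀ b ∈ N, star b = b → (⟪ξ, b Ω⟫).im = 0) → ξ = 0) :
    M.commutant = N := by
  have hsa : ∀ {x : E →L[ℂ] E}, star x = x → ∀ u v, ⟪x u, v⟫ = ⟪u, x v⟫ := by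
    intro x hx u v
    conv_rhs => rw [← hx, ContinuousLinearMap.star_eq_adjoint]
    rw [ContinuousLinearMap.adjoint_inner_right]
  have hreal : ∀ {x y : E →L[ℂ] E}, star x = x → star y = y → x * y = y * x →
      (⟪x Ω, y Ω⟫).im = 0 := by
    intro x y hx hy hxy
    rw [← Complex.conj_eq_iff_im, inner_conj_symm, hsa hy, hsa hx]
    change ⟪Ω, (y * x) Ω⟫ = ⟪Ω, (x * y) Ω⟫
    rw [hxy]
  set V : Set E := {v | ∃ b ∈ N, star b = b ∧ v = b Ω} with hV
  have hVr : IsRealSubspace V :=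
    { zero_mem := ⟨0, zero_mem N, star_zero _, by simp⟩
      add_mem := by
        rintro _ _ ⟨a, ha, ha', rfl⟩ ⟨b, hb, hb', rfl⟩
        exact ⟨a + b, add_mem ha hb, by rw [star_add, ha', hb'], by simp⟩
      smul_mem := by
        rintro r _ ⟨a, ha, ha', rfl⟩
        exact ⟨(r : ℂ) • a, N.smul_mem ha r, by rw [star_smul, ha']; simp, by simp⟩ }
  obtain ⟨P, hP, hPo⟩ := exists_real_proj hVr.closure isClosed_closure
  have hcl : ∀ v ∈ closure V, ∀ y : E →L[ℂ] E, (∀ b ∈ N, b * y = y * b) → star y = y →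
      (⟪v, y Ω⟫).im = 0 := by
    intro v hv y hy hy'
    have hc : IsClosed {v : E | (⟪v, y Ω⟫).im = 0} :=
      isClosed_eq (by fun_prop) continuous_const
    refine closure_minimal ?_ hc hv
    rintro _ ⟨b, hb, hb', rfl⟩
    exact hreal hb' hy' (hy b hb)
  have hmem : ∀ x ∈ M.commutant, star x = x → x Ω ∈ closure V := by
    intro x hx hx'
    rw [VonNeumannAlgebra.mem_commutant_iff] at hx
    have h0 : Complex.I • (x Ω - P (x Ω)) = 0 := by
      refine hd _ (fun a ha ha' => ?_) fun b hb hb' => ?_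
      · have h1 := hreal hx' ha' (hx a ha).symm
        have h2 := hcl _ (hP (x Ω)) a (fun b hb => (hMN a ha b hb).symm) ha'
        rw [inner_smul_left, inner_sub_left]
        simp [h1, h2]
      · have := hPo (x Ω) (b Ω) (subset_closure ⟨b, hb, hb', rfl⟩)
        rw [inner_smul_left]
        simp [this]
    have h1 : x Ω = P (x Ω) := by
      rw [smul_eq_zero, or_iff_right Complex.I_ne_zero, sub_eq_zero] at h0
      exact h0
    rw [h1]
    exact hP _
  have hsa_case : ∀ x ∈ M.commutant, star x = x → ∀ y ∈ N.commutant, star y = y →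
      ⟪Ω, (x * y) Ω⟫ = ⟪Ω, (y * x) Ω⟫ := by
    intro x hx hx' y hy hy'
    have h1 := hcl _ (hmem x hx hx') y (VonNeumannAlgebra.mem_commutant_iff.1 hy) hy'
    rw [← Complex.conj_eq_iff_im, inner_conj_symm, hsa hy', hsa hx'] at h1
    exact h1.symm
  have hdec : ∀ (A : VonNeumannAlgebra E) (x : E →L[ℂ] E), x ∈ A → ∃ x₁ x₂, x₁ ∈ A ∧ x₂ ∈ A ∧
      star x₁ = x₁ ∧ star x₂ = x₂ ∧ x = x₁ + Complex.I • x₂ := by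
    intro A x hx
    refine ⟨(2⁻¹ : ℂ) • (x + star x), (2⁻¹ : ℂ) • (Complex.I • (star x - x)),
      A.smul_mem (add_mem hx (star_mem hx)) _,
      A.smul_mem (A.smul_mem (sub_mem (star_mem hx) hx) _) _, ?_, ?_, ?_⟩
    · rw [star_smul, star_add, star_star, add_comm]; simp
    · rw [star_smul, star_smul, star_sub, star_star]
      simp [← smul_neg]
    · rw [smul_comm (2⁻¹ : ℂ), smul_smul, Complex.I_mul_I, neg_one_smul]
      rw [← sub_eq_add_neg, ← smul_sub]
      rw [show x + star x - (star x - x) = (2 : ℂ) • x by rw [two_smul]; abel, smul_smul]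
      norm_num
  have hgen : ∀ x ∈ M.commutant, ∀ y ∈ N.commutant, ⟪Ω, (x * y) Ω⟫ = ⟪Ω, (y * x) Ω⟫ := by
    intro x hx y hy
    obtain ⟨x₁, x₂, m1, m2, s1, s2, rfl⟩ := hdec _ x hx
    obtain ⟨y₁, y₂, n1, n2, t1, t2, rfl⟩ := hdec _ y hy
    have e1 := hsa_case x₁ m1 s1 y₁ n1 t1
    have e2 := hsa_case x₁ m1 s1 y₂ n2 t2
    have e3 := hsa_case x₂ m2 s2 y₁ n1 t1
    have e4 := hsa_case x₂ m2 s2 y₂ n2 t2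
    simp only [add_mul, mul_add, smul_mul_assoc, mul_smul_comm, add_apply,
      smul_apply, inner_add_right, inner_smul_right, e1, e2, e3, e4]
    ring
  have hcomm : ∀ x ∈ M.commutant, ∀ y ∈ N.commutant, x * y = y * x := by
    intro x hx y hy
    have hx1 := VonNeumannAlgebra.mem_commutant_iff.1 hx
    have hMN' : ∀ m ∈ M, m ∈ N.commutant := fun m hm =>
      VonNeumannAlgebra.mem_commutant_iff.2 fun b hb => (hMN m hm b hb).symm
    have key : ∀ m₁ ∈ M, ∀ m₂ ∈ M, ⟪m₁ Ω, (x * y - y * x) (m₂ Ω)⟫ = 0 := by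
      intro m₁ h1 m₂ h2
      have h := hgen x hx (star m₁ * y * m₂)
        (mul_mem (mul_mem (hMN' _ (star_mem h1)) hy) (hMN' _ h2))
      have e1 : x * (star m₁ * y * m₂) = star m₁ * (x * y * m₂) := by
        rw [mul_assoc, ← mul_assoc, ← hx1 _ (star_mem h1), mul_assoc, ← mul_assoc x]
      have e2 : star m₁ * y * m₂ * x = star m₁ * (y * x * m₂) := by
        rw [mul_assoc, hx1 _ h2, mul_assoc, mul_assoc]
      rw [e1, e2] at h
      have e3 : ∀ z : E →L[ℂ] E, ⟪Ω, (star m₁ * z) Ω⟫ = ⟪m₁ Ω, z Ω⟫ := by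
        intro z
        rw [ContinuousLinearMap.star_eq_adjoint, mul_apply_eq_comp,
          ContinuousLinearMap.adjoint_inner_right]
      rw [e3, e3] at h
      rw [sub_apply, inner_sub_right, sub_eq_zero]
      exact h
    rw [← sub_eq_zero]
    set c := x * y - y * x with hc
    have h1 : ∀ m ∈ M, c (m Ω) = 0 := fun m hm => hcyc _ fun a ha => key a ha m hm
    have h2 : ∀ u, c.adjoint u = 0 := fun u => hcyc _ fun a ha => by
      rw [ContinuousLinearMap.adjoint_inner_right, h1 a ha, inner_zero_left]
    have h3 : c.adjoint = 0 := ContinuousLinearMap.ext h2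
    have := congrArg star h3
    rwa [← ContinuousLinearMap.star_eq_adjoint, star_star, star_zero] at this
  refine SetLike.ext fun x => ⟨fun hx => ?_, fun hx => ?_⟩
  · rw [← N.commutant_commutant]
    exact VonNeumannAlgebra.mem_commutant_iff.2 fun y hy => (hcomm x hx y hy).symm
  · exact VonNeumannAlgebra.mem_commutant_iff.2 fun a ha => hMN a ha x hx

end Commutation

section FreeCommutant

variable {ι : Type*}

theorem isRealSubspace_coe (H : ClosedSubmodule ℝ (Ell ι)) : IsRealSubspace (H : Set (Ell ι)) where
  zero_mem := H.toSubmodule.zero_mem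
  add_mem hx hy := H.toSubmodule.add_mem hx hy
  smul_mem r x hx := by
    have : (r : ℂ) • x = r • x := Complex.coe_smul r x
    rw [this]
    exact H.toSubmodule.smul_mem r hx

/-- Complexification of an identity between a complex linear and an antilinear expression in simple
tensors over a real subspace. -/
theorem inner_tensor_complexify {H : Set (Ell ι)} {ξ : FullFock ι} {c : ℂ}
    (h : ∀ L : List (Ell ι), (∀ x ∈ L, x ∈ H) → ⟪ξ, tensor L⟫ = c * ⟪tensor L.reverse, ξ⟫)
    (a b : Ell ι → Ell ι) (ha : ∀ u, a u ∈ H) (hb : ∀ u, b u ∈ H) (us : List (Ell ι)) :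
    ⟪ξ, tensor (us.map fun u => a u + Complex.I • b u)⟫ =
      c * ⟪tensor (us.map fun u => a u - Complex.I • b u).reverse, ξ⟫ := by
  have key : ∀ us L : List (Ell ι), (∀ x ∈ L, x ∈ H) →
      ⟪ξ, tensor (L ++ us.map fun u => a u + Complex.I • b u)⟫ =
      c * ⟪tensor ((us.map fun u => a u - Complex.I • b u).reverse ++ L.reverse), ξ⟫ := by
    intro us
    induction us with
    | nil => intro L hL; simpa using h L hL
    | cons u us ih =>
      intro L hL
      have hL' : ∀ z ∈ H, ∀ x ∈ L ++ [z], x ∈ H := by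
        intro z hz x hx
        rcases List.mem_append.1 hx with hx | hx
        · exact hL x hx
        · rw [List.mem_singleton.1 hx]; exact hz
      have h1 := ih (L ++ [a u]) (hL' _ (ha u))
      have h2 := ih (L ++ [b u]) (hL' _ (hb u))
      simp only [List.append_assoc, List.singleton_append, List.reverse_append,
        List.reverse_singleton] at h1 h2
      simp only [List.map_cons, List.reverse_cons, List.append_assoc, List.singleton_append]
      rw [tensor_append_add, tensor_append_smul, sub_eq_add_neg, ← neg_smul, tensor_append_add,
        tensor_append_smul, inner_add_right, inner_smul_right, inner_add_left, inner_smul_left,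
        h1, h2]
      simp only [map_neg, Complex.conj_I, neg_neg]
      ring
  simpa using key us [] (by simp)

theorem eq_zero_of_inner_tensor {H : Set (Ell ι)} (hcyc : ∀ u : Ell ι, (∀ h ∈ H, ⟪h, u⟫ = 0) → u = 0)
    {ξ : FullFock ι} (h : ∀ L : List (Ell ι), (∀ x ∈ L, x ∈ H) → ⟪tensor L, ξ⟫ = 0) : ξ = 0 := by
  have key : ∀ (us : List (Ell ι)) (ξ : FullFock ι),
      (∀ L : List (Ell ι), (∀ x ∈ L, x ∈ H) → ⟪tensor L, ξ⟫ = 0) → ⟪tensor us, ξ⟫ = 0 := by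
    intro us
    induction us with
    | nil => intro ξ h; exact h [] (by simp)
    | cons u us ih =>
      intro ξ h
      have h1 : (leftCreationCLM (tensor us)).adjoint ξ = 0 := by
        refine hcyc _ fun g hg => ?_
        rw [ContinuousLinearMap.adjoint_inner_right, leftCreationCLM_apply,
          ← ContinuousLinearMap.adjoint_inner_right]
        refine ih _ fun L hL => ?_
        rw [ContinuousLinearMap.adjoint_inner_right, leftCreation_tensor]
        refine h _ fun x hx => ?_
        rcases List.mem_cons.1 hx with rfl | hx
        · exact hg
        · exact hL x hx
      change ⟪leftCreationCLM (tensor us) u, ξ⟫ = 0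
      rw [← ContinuousLinearMap.adjoint_inner_right, h1, inner_zero_right]
  have h0 : innerSL ℂ ξ = 0 := ext_tensor fun L => by
    rw [innerSL_apply_apply, ← inner_conj_symm, key L ξ h]; simp
  have := congrArg (fun f => f ξ) h0
  simpa using this

/-- The real density of `M_sa Ω + i N_sa Ω`, on the level of simple tensors. -/
theorem eq_zero_of_symm_tensor {H K : Set (Ell ι)} (hH : IsRealSubspace H) (hc : IsClosed H)
    (hK : ∀ k, k ∈ K ↔ ∀ h ∈ H, (⟪h, k⟫).im = 0)
    (hcyc : ∀ u : Ell ι, (∀ h ∈ H, ⟪h, u⟫ = 0) → u = 0) {ξ : FullFock ι}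
    (h1 : ∀ L : List (Ell ι), (∀ x ∈ L, x ∈ H) → ⟪ξ, tensor L⟫ = (-1) * ⟪tensor L.reverse, ξ⟫)
    (h2 : ∀ L : List (Ell ι), (∀ x ∈ L, x ∈ K) → ⟪ξ, tensor L⟫ = 1 * ⟪tensor L.reverse, ξ⟫) :
    ξ = 0 := by
  obtain ⟨P, R, hP, hPo, hR, hpos, hpos2, hker⟩ := exists_sum_real_proj hH hc
  set R2 := (2 : ℂ) • ContinuousLinearMap.id ℂ (Ell ι) - R with hR2
  have hinj : ∀ u, R u = 0 → u = 0 := by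
    intro u hu
    obtain ⟨e1, e2⟩ := hker u hu
    refine hcyc u fun g hg => ?_
    have i1 := hPo u g hg
    have i2 := hPo (Complex.I • u) g hg
    rw [e1, sub_zero] at i1
    rw [e2, sub_zero, inner_smul_left] at i2
    rw [← inner_conj_symm]
    have : ⟪u, g⟫ = 0 := Complex.ext i1 (by simpa using i2)
    rw [this, map_zero]
  have hI2 : ∀ x : Ell ι, Complex.I • Complex.I • x = -x := fun x => by
    rw [smul_smul, Complex.I_mul_I, neg_one_smul]
  -- the vectors `u - Q u` and `i (u - P u)` of the symplectic complement
  have hKI : ∀ z : Ell ι, (∀ h ∈ H, (⟪z, h⟫).re = 0) → Complex.I • z ∈ K := by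
    intro z hz
    rw [hK]
    intro h hh
    have := hz h hh
    rw [← inner_conj_symm, Complex.conj_re] at this
    rw [inner_smul_right]
    simp [this]
  have hkneg : ∀ k, k ∈ K → -k ∈ K := by
    intro k hk
    rw [hK] at hk ⊢
    intro h hh
    rw [inner_neg_right, Complex.neg_im, hk h hh, neg_zero]
  have key : ∀ us : List (Ell ι), ⟪ξ, tensor (us.map R)⟫ + ⟪ξ, tensor (us.map R2)⟫ = 0 := by
    intro us
    have e1 := inner_tensor_complexify h1 P (fun u => -P (Complex.I • u)) hP
      (fun u => hH.neg_mem (hP _)) us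
    have e2 := inner_tensor_complexify h2
      (fun u => -(Complex.I • (Complex.I • u - P (Complex.I • u)))) (fun u => Complex.I • (u - P u))
      (fun u => hkneg _ (hKI _ (hPo _))) (fun u => hKI _ (hPo _)) us.reverse
    have f1 : (fun u => P u + Complex.I • -P (Complex.I • u)) = R := by
      funext u; rw [hR, smul_neg, sub_eq_add_neg]
    have f2 : (fun u => -(Complex.I • (Complex.I • u - P (Complex.I • u))) +
        Complex.I • Complex.I • (u - P u)) =
        fun u => P u - Complex.I • -P (Complex.I • u) := by
      funext u
      simp only [smul_sub, smul_neg, hI2]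
      abel
    have f3 : (fun u => -(Complex.I • (Complex.I • u - P (Complex.I • u))) -
        Complex.I • Complex.I • (u - P u)) = R2 := by
      funext u
      have : R2 u = (2 : ℂ) • u - R u := rfl
      simp only [this, hR, smul_sub, hI2, two_smul]
      abel
    rw [f1] at e1
    rw [f2, f3, ← List.map_reverse, List.reverse_reverse] at e2
    rw [← List.map_reverse] at e1
    rw [e1, ← inner_conj_symm, e2, map_mul, inner_conj_symm]
    simp
  obtain ⟨B, hB⟩ := exists_adjoint_mul_self hpos
  obtain ⟨B2, hB2⟩ := exists_adjoint_mul_self hpos2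
  have hBinj : Function.Injective B := by
    rw [injective_iff_map_eq_zero]
    intro u hu
    apply hinj
    rw [hB, mul_apply_eq_comp, hu, map_zero]
  ext w
  refine eq_zero_of_tensorPow_eq_zero hBinj w ?_
  have hz : innerSL ℂ ξ ∘L (tensorPow R w.length + tensorPow R2 w.length) = 0 := by
    refine ext_tensor fun L => ?_
    simp only [ContinuousLinearMap.comp_apply, add_apply, tensorPow_tensor, innerSL_apply_apply,
      zero_apply]
    split_ifs
    · rw [inner_add_right, key]
    · simp
  have hz' : ⟪ξ, tensorPow R w.length ξ⟫ + ⟪ξ, tensorPow R2 w.length ξ⟫ = 0 := by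
    have := congrArg (fun f => f ξ) hz
    simpa [inner_add_right] using this
  rw [hB, hB2, ← tensorPow_adjoint_mul, ← tensorPow_adjoint_mul, mul_apply_eq_comp,
    mul_apply_eq_comp, ContinuousLinearMap.adjoint_inner_right,
    ContinuousLinearMap.adjoint_inner_right, inner_self_eq_norm_sq_to_K,
    inner_self_eq_norm_sq_to_K] at hz'
  have h3 : ‖tensorPow B w.length ξ‖ ^ 2 + ‖tensorPow B2 w.length ξ‖ ^ 2 = 0 := by
    have := congrArg Complex.re hz'
    simpa [← Complex.ofReal_pow] using this
  rw [← norm_eq_zero]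
  nlinarith [sq_nonneg ‖tensorPow B w.length ξ‖, sq_nonneg ‖tensorPow B2 w.length ξ‖]

theorem leftField_mem (H : ClosedSubmodule ℝ (Ell ι)) {h : Ell ι} (hh : h ∈ H) :
    leftField h ∈ leftAlgebra H :=
  subset_generated _ ⟨h, hh, rfl⟩

theorem rightField_mem (H : ClosedSubmodule ℝ (Ell ι)) {h : Ell ι} (hh : h ∈ H) :
    rightField h ∈ rightAlgebra H :=
  subset_generated _ ⟨h, hh, rfl⟩

theorem wick_mem_leftAlgebra (H : ClosedSubmodule ℝ (Ell ι)) {L : List (Ell ι)}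
    (hL : ∀ h ∈ L, h ∈ H) : wick L ∈ leftAlgebra H :=
  wick_mem (M := (leftAlgebra H).toStarSubalgebra.toSubalgebra) (H := (H : Set (Ell ι)))
    (fun _ hh => leftField_mem H hh) L hL

theorem flip_wick_flip_mem (H : ClosedSubmodule ℝ (Ell ι)) {L : List (Ell ι)}
    (hL : ∀ h ∈ L, h ∈ H) : flip ι * wick L * flip ι ∈ rightAlgebra H := by
  have hf : ∀ a : FullFock ι →L[ℂ] FullFock ι, flip ι * (flip ι * a) = a := fun a => by
    rw [← mul_assoc, flip_mul_flip, one_mul]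
  let M : Subalgebra ℂ (FullFock ι →L[ℂ] FullFock ι) :=
    { carrier := {a | flip ι * a * flip ι ∈ rightAlgebra H}
      mul_mem' := by
        intro a b ha hb
        have : flip ι * (a * b) * flip ι = (flip ι * a * flip ι) * (flip ι * b * flip ι) := by
          simp only [mul_assoc, hf]
        change _ ∈ rightAlgebra H
        rw [this]
        exact mul_mem ha hb
      add_mem' := by
        intro a b ha hb
        change _ ∈ rightAlgebra H
        rw [mul_add, add_mul]
        exact add_mem ha hb
      algebraMap_mem' := by
        intro c
        change _ ∈ rightAlgebra H
        have : flip ι * algebraMap ℂ _ c * flip ι = algebraMap ℂ _ c := by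
          rw [← Algebra.commutes, mul_assoc, flip_mul_flip, mul_one]
        rw [this]
        exact (rightAlgebra H).algebraMap_mem c }
  exact wick_mem (M := M) (H := (H : Set (Ell ι)))
    (fun h hh => by
      change _ ∈ rightAlgebra H
      rw [← rightField_eq]
      exact rightField_mem H hh) L hL

theorem inner_eq_of_re_eq_zero {E : Type*} [NormedAddCommGroup E] [InnerProductSpace ℂ E] {ξ u v : E}
    {s : ℝ} (h : ∀ c : ℂ, (c * ⟪ξ, u⟫).re + s * (star c * ⟪ξ, v⟫).re = 0) :
    ⟪ξ, u⟫ = (-s : ℂ) * ⟪v, ξ⟫ := by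
  have h1 := h 1
  have h2 := h Complex.I
  have e := inner_conj_symm (𝕜 := ℂ) v ξ
  have e1 : ⟪ξ, v⟫.re = ⟪v, ξ⟫.re := by rw [← e, Complex.conj_re]
  have e2 : ⟪ξ, v⟫.im = -⟪v, ξ⟫.im := by rw [← e, Complex.conj_im, neg_neg]
  apply Complex.ext
  · simp at h1 ⊢; rw [e1] at h1; linarith
  · simp at h2 ⊢; rw [e2] at h2; linarith

/-- The commutant of the free left von Neumann algebra of a cyclic real subspace is the free right
von Neumann algebra of the symplectic complement. -/
theorem commutant_leftAlgebra (H K : ClosedSubmodule ℝ (Ell ι))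
    (hK : ∀ k, k ∈ K ↔ ∀ h ∈ H, (⟪h, k⟫).im = 0)
    (hcyc : ∀ u : Ell ι, (∀ h ∈ H, ⟪h, u⟫ = 0) → u = 0) :
    (leftAlgebra H).commutant = rightAlgebra K := by
  refine commutant_eq_of_real_dense _ _ (vacuum ι) ?_ ?_ ?_
  · refine generated_commute ?_ ?_ ?_
    · rintro _ ⟨h, -, rfl⟩; exact star_leftField h
    · rintro _ ⟨h, -, rfl⟩; exact star_rightField h
    · rintro _ ⟨h, hh, rfl⟩ _ ⟨k, hk, rfl⟩
      rw [← sub_eq_zero, leftField_mul_rightField, (hK k).1 hk h hh]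
      simp
  · intro ξ hξ
    refine eq_zero_of_inner_tensor (H := (H : Set (Ell ι))) hcyc fun L hL => ?_
    rw [← wick_vacuum]
    exact hξ _ (wick_mem_leftAlgebra H hL)
  · intro ξ hM hN
    refine eq_zero_of_symm_tensor (H := (H : Set (Ell ι))) (K := (K : Set (Ell ι)))
      (isRealSubspace_coe H) H.isClosed' hK hcyc (fun L hL => ?_) fun L hL => ?_
    · have : ⟪ξ, tensor L⟫ = (-(1 : ℝ) : ℂ) * ⟪tensor L.reverse, ξ⟫ := by
        refine inner_eq_of_re_eq_zero fun c => ?_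
        have hm := wick_mem_leftAlgebra H hL
        have hm' := wick_mem_leftAlgebra H (L := L.reverse) (by simpa using hL)
        have := hM (c • wick L + star c • wick L.reverse)
          (add_mem ((leftAlgebra H).smul_mem hm c) ((leftAlgebra H).smul_mem hm' _))
          (by rw [star_add, star_smul, star_smul, star_star, star_wick, star_wick,
            List.reverse_reverse, add_comm])
        simpa [wick_vacuum, inner_add_right, inner_smul_right] using this
      simpa using this
    · set b : List (Ell ι) → FullFock ι →L[ℂ] FullFock ι := fun L => flip ι * wick L.reverse * flip ι
        with hb
      have hstar : ∀ L, star (b L) = b L.reverse := by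
        intro L
        simp only [hb, star_mul, star_wick, List.reverse_reverse, mul_assoc,
          ContinuousLinearMap.star_eq_adjoint (flip ι), adjoint_flip]
      have hvac : ∀ L, b L (vacuum ι) = tensor L := by
        intro L
        have : flip ι (vacuum ι) = vacuum ι := flip_tensor []
        simp only [hb, mul_apply_eq_comp, this, wick_vacuum, flip_tensor, List.reverse_reverse]
      have hmem : ∀ L : List (Ell ι), (∀ x ∈ L, x ∈ K) → b L ∈ rightAlgebra K := fun L hL =>
        flip_wick_flip_mem K (by simpa using hL)
      have : ⟪ξ, tensor L⟫ = (-(-1 : ℝ) : ℂ) * ⟪tensor L.reverse, ξ⟫ := by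
        refine inner_eq_of_re_eq_zero fun c => ?_
        have := hN ((Complex.I * c) • b L + star (Complex.I * c) • b L.reverse)
          (add_mem ((rightAlgebra K).smul_mem (hmem L hL) _)
            ((rightAlgebra K).smul_mem (hmem _ (by simpa using hL)) _))
          (by rw [star_add, star_smul, star_smul, star_star, hstar, hstar,
            List.reverse_reverse, add_comm])
        simp only [add_apply, smul_apply, hvac, inner_add_right,
          inner_smul_right, Complex.add_im] at this
        rw [← this]
        simp
        ring
      simpa using this

/-- The left and the right von Neumann algebras of a cyclic real subspace on which the symplectic
form does not vanish act irreducibly. -/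
theorem scalar_of_commute (H : ClosedSubmodule ℝ (Ell ι))
    (hcyc : ∀ u : Ell ι, (∀ h ∈ H, ⟪h, u⟫ = 0) → u = 0)
    {h k : Ell ι} (hh : h ∈ H) (hk : k ∈ H) (hhk : (⟪h, k⟫).im ≠ 0)
    {x : FullFock ι →L[ℂ] FullFock ι} (h1 : x ∈ (leftAlgebra H).commutant)
    (h2 : x ∈ (rightAlgebra H).commutant) : ∃ c : ℂ, x = c • ContinuousLinearMap.id ℂ _ := by
  rw [VonNeumannAlgebra.mem_commutant_iff] at h1 h2
  have hp : vacuumProj ι * x = x * vacuumProj ι := by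
    have e := leftField_mul_rightField h k
    have e1 := h1 _ (leftField_mem H hh)
    have e2 := h2 _ (rightField_mem H hk)
    have hne : (2 * ((⟪h, k⟫).im : ℂ) * Complex.I) ≠ 0 := by
      simp [hhk]
    have : (2 * ((⟪h, k⟫).im : ℂ) * Complex.I) • (vacuumProj ι * x) =
        (2 * ((⟪h, k⟫).im : ℂ) * Complex.I) • (x * vacuumProj ι) := by
      rw [← smul_mul_assoc, ← mul_smul_comm, ← e, sub_mul, mul_sub, mul_assoc, e2, ← mul_assoc, e1,
        mul_assoc, mul_assoc (rightField k), e1, ← mul_assoc (rightField k), e2, mul_assoc]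
    exact smul_right_injective _ hne this
  refine ⟨(x (vacuum ι)) [], sub_eq_zero.1 ?_⟩
  set c := (x (vacuum ι)) [] with hc
  have hx : x (vacuum ι) = c • vacuum ι := by
    have := congrArg (fun T => T (vacuum ι)) hp
    simp only [mul_apply_eq_comp, vacuumProj_apply, vacuum_nil, one_smul] at this
    exact this.symm
  have h3 : ∀ L : List (Ell ι), (∀ x ∈ L, x ∈ H) → (x - c • ContinuousLinearMap.id ℂ (FullFock ι)) (tensor L) = 0 := by
    intro L hL
    have := congrArg (fun T => T (vacuum ι)) (h1 _ (wick_mem_leftAlgebra H hL))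
    simp only [mul_apply_eq_comp, hx, map_smul, wick_vacuum] at this
    rw [sub_apply, ← this]
    simp
  have h4 : (x - c • ContinuousLinearMap.id ℂ (FullFock ι)).adjoint = 0 := by
    ext1 u
    refine eq_zero_of_inner_tensor (H := (H : Set (Ell ι))) hcyc fun L hL => ?_
    rw [ContinuousLinearMap.adjoint_inner_right, h3 L hL, inner_zero_left]
  have := congrArg star h4
  rwa [← ContinuousLinearMap.star_eq_adjoint, star_star, star_zero] at this

end FreeCommutant

section CircleFunctions

open MeasureTheory AddCircle

/-- The smooth complex functions on the circle `S¹ = ℝ / ℤ`. -/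
def SmoothComplex (f : UnitAddCircle → ℂ) : Prop :=
  ContDiff ℝ ∞ fun t : ℝ => f (t : UnitAddCircle)

theorem continuous_of_coe {X : Type*} [TopologicalSpace X] {f : UnitAddCircle → X}
    (hf : Continuous fun t : ℝ => f (t : UnitAddCircle)) : Continuous f :=
  (QuotientAddGroup.isQuotientMap_mk (N := AddSubgroup.zmultiples (1 : ℝ))).continuous_iff.2 hf

theorem SmoothComplex.continuous {f : UnitAddCircle → ℂ} (hf : SmoothComplex f) : Continuous f :=
  continuous_of_coe (ContDiff.continuous hf)

theorem SmoothReal.continuous {f : UnitAddCircle → ℝ} (hf : SmoothReal f) : Continuous f :=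
  continuous_of_coe (ContDiff.continuous hf)

theorem SmoothReal.ofReal {f : UnitAddCircle → ℝ} (hf : SmoothReal f) :
    SmoothComplex fun x => (f x : ℂ) :=
  Complex.ofRealCLM.contDiff.comp hf

theorem SmoothComplex.re {f : UnitAddCircle → ℂ} (hf : SmoothComplex f) :
    SmoothReal fun x => (f x).re :=
  Complex.reCLM.contDiff.comp hf

theorem SmoothComplex.im {f : UnitAddCircle → ℂ} (hf : SmoothComplex f) :
    SmoothReal fun x => (f x).im :=
  Complex.imCLM.contDiff.comp hf

theorem SmoothComplex.mul {f g : UnitAddCircle → ℂ} (hf : SmoothComplex f) (hg : SmoothComplex g) :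
    SmoothComplex fun x => f x * g x :=
  ContDiff.mul hf hg

theorem SmoothComplex.add {f g : UnitAddCircle → ℂ} (hf : SmoothComplex f) (hg : SmoothComplex g) :
    SmoothComplex fun x => f x + g x :=
  ContDiff.add hf hg

theorem SmoothComplex.const_mul {f : UnitAddCircle → ℂ} (hf : SmoothComplex f) (c : ℂ) :
    SmoothComplex fun x => c * f x :=
  ContDiff.mul contDiff_const hf

theorem SmoothComplex.const_sub {f : UnitAddCircle → ℂ} (hf : SmoothComplex f) (c : ℂ) :
    SmoothComplex fun x => c - f x :=
  ContDiff.sub contDiff_const hf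

theorem SmoothReal.comp_sub {f : UnitAddCircle → ℝ} (hf : SmoothReal f) (y : UnitAddCircle) :
    SmoothReal fun x => f (x - y) := by
  obtain ⟨s, rfl⟩ := QuotientAddGroup.mk_surjective y
  exact ContDiff.comp (g := fun t : ℝ => f (t : UnitAddCircle)) hf
    (contDiff_id.sub contDiff_const : ContDiff ℝ ∞ fun t : ℝ => t - s)

theorem SmoothComplex.comp_const_sub {f : UnitAddCircle → ℂ} (hf : SmoothComplex f)
    (y : UnitAddCircle) : SmoothComplex fun x => f (y - x) := by
  obtain ⟨s, rfl⟩ := QuotientAddGroup.mk_surjective y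
  exact ContDiff.comp (g := fun t : ℝ => f (t : UnitAddCircle)) hf
    (contDiff_const.sub contDiff_id : ContDiff ℝ ∞ fun t : ℝ => s - t)

theorem smoothComplex_fourier (k : ℤ) : SmoothComplex fun x => fourier k x := by
  unfold SmoothComplex
  simp only [fourier_coe_apply]
  have h : ContDiff ℝ ∞ fun t : ℝ => (t : ℂ) := Complex.ofRealCLM.contDiff
  exact ((contDiff_const.mul h).div_const _).cexp

theorem fourierCoeff_def (f : UnitAddCircle → ℂ) (k : ℤ) :
    fourierCoeff f k = ∫ x, fourier (-k) x * f x ∂haarAddCircle := rfl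

/-- Rapidly decreasing sequences. -/
def RapidDecay (a : ℤ → ℂ) : Prop := ∀ N : ℕ, ∃ C : ℝ, ∀ k : ℤ, ‖a k‖ * |(k : ℝ)| ^ N ≤ C

theorem SmoothComplex.rapidDecay {f : UnitAddCircle → ℂ} (hf : SmoothComplex f) :
    RapidDecay (fourierCoeff f) := by
  intro N
  obtain ⟨C, hC⟩ := norm_fourierCoeffOn_le N (fun t : ℝ => f (t : UnitAddCircle)) hf
    (fun t => by simp)
  refine ⟨C, fun k => ?_⟩
  have := hC k
  rw [fourierCoeffOn_eq_integral] at this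
  rw [fourierCoeff_eq_intervalIntegral _ _ 0]
  simpa using this

/-- Rapid decay, with a weight that is nowhere zero. -/
theorem RapidDecay.bound {a : ℤ → ℂ} (ha : RapidDecay a) (N : ℕ) :
    ∃ C : ℝ, ∀ k : ℤ, ‖a k‖ * (1 + |(k : ℝ)|) ^ N ≤ C := by
  obtain ⟨C0, h0⟩ := ha 0
  obtain ⟨C1, h1⟩ := ha N
  refine ⟨2 ^ N * (C0 + C1), fun k => ?_⟩
  have e : (1 + |(k : ℝ)|) ^ N ≤ 2 ^ N * (1 + |(k : ℝ)| ^ N) := by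
    rcases le_total (1 : ℝ) |(k : ℝ)| with h | h
    · calc (1 + |(k : ℝ)|) ^ N ≤ (2 * |(k : ℝ)|) ^ N := by gcongr; linarith
        _ = 2 ^ N * |(k : ℝ)| ^ N := mul_pow _ _ _
        _ ≤ _ := by gcongr; linarith
    · calc (1 + |(k : ℝ)|) ^ N ≤ 2 ^ N := by gcongr; linarith
        _ ≤ _ := le_mul_of_one_le_right (by positivity) (by linarith [pow_nonneg (abs_nonneg (k : ℝ)) N])
  calc _ ≤ ‖a k‖ * (2 ^ N * (1 + |(k : ℝ)| ^ N)) := by gcongr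
    _ = 2 ^ N * (‖a k‖ * |(k : ℝ)| ^ 0 + ‖a k‖ * |(k : ℝ)| ^ N) := by ring
    _ ≤ _ := by gcongr; exacts [h0 k, h1 k]

theorem summable_one_div_one_add_abs_sq :
    Summable fun k : ℤ => 1 / (1 + |(k : ℝ)|) ^ 2 := by
  have h : Summable fun k : ℕ => 1 / (1 + (k : ℝ)) ^ 2 := by
    have := (summable_nat_add_iff 1).2 (Real.summable_one_div_nat_pow.2 one_lt_two)
    refine this.congr fun k => ?_
    push_cast
    rw [add_comm]
  refine Summable.of_nat_of_neg ?_ ?_ <;> simpa using h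

theorem RapidDecay.summable {a : ℤ → ℂ} (ha : RapidDecay a) (N : ℕ) :
    Summable fun k => ‖a k‖ * (1 + |(k : ℝ)|) ^ N := by
  obtain ⟨C, hC⟩ := ha.bound (N + 2)
  refine (summable_one_div_one_add_abs_sq.mul_left C).of_nonneg_of_le (fun k => by positivity)
    fun k => ?_
  rw [mul_one_div, le_div_iff₀ (by positivity), mul_assoc, ← pow_add]
  exact hC k

theorem RapidDecay.summable_norm {a : ℤ → ℂ} (ha : RapidDecay a) : Summable fun k => ‖a k‖ := by
  simpa using ha.summable 0

theorem RapidDecay.mul_of_le {a b : ℤ → ℂ} (ha : RapidDecay a) {C : ℝ} {N : ℕ}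
    (hb : ∀ k, ‖b k‖ ≤ C * (1 + |(k : ℝ)|) ^ N) : RapidDecay fun k => b k * a k := by
  intro M
  obtain ⟨D, hD⟩ := ha.bound (N + M)
  have hC : 0 ≤ C := by simpa using (norm_nonneg _).trans (hb 0)
  refine ⟨C * D, fun k => ?_⟩
  calc ‖b k * a k‖ * |(k : ℝ)| ^ M ≤ (C * (1 + |(k : ℝ)|) ^ N * ‖a k‖) * (1 + |(k : ℝ)|) ^ M := by
        rw [norm_mul]
        gcongr
        · exact hb k
        · linarith
    _ = C * (‖a k‖ * (1 + |(k : ℝ)|) ^ (N + M)) := by rw [pow_add]; ring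
    _ ≤ C * D := by gcongr; exact hD k

theorem SmoothComplex.hasSum_fourier {f : UnitAddCircle → ℂ} (hf : SmoothComplex f)
    (x : UnitAddCircle) : HasSum (fun k => fourierCoeff f k * fourier k x) (f x) :=
  has_pointwise_sum_fourier_series_of_summable (f := ⟨f, hf.continuous⟩)
    hf.rapidDecay.summable_norm.of_norm x

/-- The Fourier coefficients of a product. -/
theorem SmoothComplex.hasSum_fourierCoeff_mul {f g : UnitAddCircle → ℂ} (hf : SmoothComplex f)
    (hg : Continuous g) (l : ℤ) :
    HasSum (fun k => fourierCoeff f k * fourierCoeff g (l - k))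
      (fourierCoeff (fun x => f x * g x) l) := by
  obtain ⟨C, hC⟩ := isCompact_univ.exists_bound_of_continuousOn hg.continuousOn
  have h1 := hasSum_integral_of_summable_integral_norm (μ := haarAddCircle)
    (F := fun (k : ℤ) (x : UnitAddCircle) =>
      fourier (-l) x * ((fourierCoeff f k * fourier k x) * g x))
    (fun k => (Continuous.integrable_of_hasCompactSupport (by fun_prop)
      (HasCompactSupport.of_compactSpace _)))
    (by
      refine (hf.rapidDecay.summable_norm.mul_right C).of_nonneg_of_le
        (fun k => integral_nonneg fun _ => norm_nonneg _) fun k => ?_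
      have : ∀ x : UnitAddCircle, ‖fourier (-l) x * ((fourierCoeff f k * fourier k x) * g x)‖ ≤
          ‖fourierCoeff f k‖ * C := by
        intro x
        rw [norm_mul, norm_mul, norm_mul, fourier_apply, fourier_apply, Circle.norm_coe,
          Circle.norm_coe, one_mul, mul_one]
        gcongr
        exact hC x trivial
      calc _ ≤ ∫ x : UnitAddCircle, ‖fourierCoeff f k‖ * C ∂haarAddCircle := by
            refine integral_mono_of_nonneg (Filter.Eventually.of_forall fun _ => norm_nonneg _)
              (integrable_const _) (Filter.Eventually.of_forall this)
        _ = _ := by simp)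
  have h2 : ∀ k, ∫ x, fourier (-l) x * ((fourierCoeff f k * fourier k x) * g x) ∂haarAddCircle =
      fourierCoeff f k * fourierCoeff g (l - k) := by
    intro k
    rw [fourierCoeff_def g, ← integral_const_mul]
    congr 1
    funext x
    rw [show -(l - k) = -l + k by ring, fourier_add]
    ring
  simp only [h2] at h1
  have h3 : ∀ x, ∑' k, fourier (-l) x * ((fourierCoeff f k * fourier k x) * g x) =
      fourier (-l) x * (f x * g x) := by
    intro x
    rw [tsum_mul_left, tsum_mul_right, (hf.hasSum_fourier x).tsum_eq]
  simp only [h3] at h1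
  exact h1

theorem fourierCoeff_conj (f : UnitAddCircle → ℂ) (k : ℤ) :
    fourierCoeff (fun x => star (f x)) k = star (fourierCoeff f (-k)) := by
  rw [fourierCoeff_def, fourierCoeff_def]
  refine Eq.trans ?_ (integral_conj (f := fun x => fourier (- -k) x * f x))
  congr 1
  funext x
  rw [map_mul, ← fourier_neg]
  simp

theorem fourierCoeff_ofReal_neg (f : UnitAddCircle → ℝ) (k : ℤ) :
    fourierCoeff (fun x => (f x : ℂ)) (-k) = star (fourierCoeff (fun x => (f x : ℂ)) k) := by
  have := fourierCoeff_conj (fun x => (f x : ℂ)) (-k)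
  simpa using this

theorem integrable_fourier_mul {f : UnitAddCircle → ℂ} (hf : Continuous f) (k : ℤ) :
    Integrable (fun x => fourier k x * f x) haarAddCircle :=
  Continuous.integrable_of_hasCompactSupport (by fun_prop) (HasCompactSupport.of_compactSpace _)

theorem fourierCoeff_add' {f g : UnitAddCircle → ℂ} (hf : Continuous f) (hg : Continuous g) (k : ℤ) :
    fourierCoeff (fun x => f x + g x) k = fourierCoeff f k + fourierCoeff g k := by
  simp only [fourierCoeff_def, mul_add]
  exact integral_add (integrable_fourier_mul hf _) (integrable_fourier_mul hg _)

theorem fourierCoeff_const_mul (f : UnitAddCircle → ℂ) (c : ℂ) (k : ℤ) :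
    fourierCoeff (fun x => c * f x) k = c * fourierCoeff f k :=
  fourierCoeff.const_smul f c k

theorem fourierCoeff_const_sub_comp (f : UnitAddCircle → ℂ) (y : UnitAddCircle) (k : ℤ) :
    fourierCoeff (fun x => f (y - x)) (-k) = fourier k y * fourierCoeff f k := by
  rw [fourierCoeff_def, fourierCoeff_def, ← integral_const_mul,
    ← integral_sub_left_eq_self (fun x => fourier k y * (fourier (-k) x * f x)) haarAddCircle y]
  congr 1
  funext x
  rw [neg_neg, ← mul_assoc]
  congr 1
  simp only [fourier_apply, ← Circle.coe_mul, ← toCircle_add]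
  congr 2
  simp only [neg_smul, smul_sub]
  abel

theorem fourierCoeff_sub_comp (f : UnitAddCircle → ℂ) (y : UnitAddCircle) (k : ℤ) :
    fourierCoeff (fun x => f (x - y)) k = fourier (-k) y * fourierCoeff f k := by
  rw [fourierCoeff_def, fourierCoeff_def, ← integral_const_mul,
    ← integral_sub_right_eq_self (fun x => fourier (-k) y * (fourier (-k) x * f x)) y]
  congr 1
  funext x
  rw [← mul_assoc]
  congr 1
  simp only [fourier_apply, ← Circle.coe_mul, ← toCircle_add]
  congr 2
  simp only [neg_smul, smul_sub]
  abel

theorem fourierCoeff_of_hasDerivAt {g g' : UnitAddCircle → ℂ}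
    (h : ∀ t : ℝ, HasDerivAt (fun s : ℝ => g s) (g' t) t) (hg' : Continuous g') (k : ℤ) :
    fourierCoeff g' k = 2 * Real.pi * Complex.I * k * fourierCoeff g k := by
  have hg : Continuous g := continuous_of_coe (continuous_iff_continuousAt.2 fun t =>
    (h t).continuousAt)
  have hd : ∀ t : ℝ, HasDerivAt (fun s : ℝ => fourier (-k) (s : UnitAddCircle) * g s)
      (-2 * Real.pi * Complex.I * k * (fourier (-k) (t : UnitAddCircle) * g t) +
        fourier (-k) (t : UnitAddCircle) * g' t) t := by
    intro t
    have := (hasDerivAt_fourier_neg 1 k t).mul (h t)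
    refine this.congr_deriv ?_
    simp only [Complex.ofReal_one, div_one]
    ring
  have hc : Continuous fun t : ℝ => (t : UnitAddCircle) := continuous_quotient_mk'
  have h1 := intervalIntegral.integral_eq_sub_of_hasDerivAt (a := 0) (b := 1) (fun t _ => hd t)
    (Continuous.intervalIntegrable (by fun_prop) _ _)
  rw [intervalIntegral.integral_add (Continuous.intervalIntegrable (by fun_prop) _ _)
    (Continuous.intervalIntegrable (by fun_prop) _ _), intervalIntegral.integral_const_mul] at h1
  have h2 : ∀ f : UnitAddCircle → ℂ, fourierCoeff f k =
      ∫ t in (0 : ℝ)..1, fourier (-k) (t : UnitAddCircle) * f t := by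
    intro f
    rw [fourierCoeff_eq_intervalIntegral _ _ 0]
    simp
  rw [← h2, ← h2] at h1
  have h3 : ((1 : ℝ) : UnitAddCircle) = ((0 : ℝ) : UnitAddCircle) := by
    simp [AddCircle.coe_period]
  rw [h3, sub_self] at h1
  linear_combination h1

/-- The derivative of a smooth function on the circle. -/
theorem SmoothComplex.exists_deriv {f : UnitAddCircle → ℂ} (hf : SmoothComplex f) :
    ∃ g : UnitAddCircle → ℂ, SmoothComplex g ∧ tsupport g ⊆ tsupport f ∧
      (∀ k, fourierCoeff g k = 2 * Real.pi * Complex.I * k * fourierCoeff f k) ∧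
      ∀ t : ℝ, HasDerivAt (fun s : ℝ => f s) (g t) t := by
  have hp : Function.Periodic (deriv fun s : ℝ => f s) (1 : ℝ) := by
    intro x
    rw [← deriv_comp_add_const]
    congr 1
    funext s
    simp
  have hd : ∀ t : ℝ, HasDerivAt (fun s : ℝ => f s) (hp.lift (t : UnitAddCircle)) t := fun t => by
    rw [hp.lift_coe]
    exact ((contDiff_infty_iff_deriv.1 hf).1 t).hasDerivAt
  have hs : SmoothComplex hp.lift := by
    unfold SmoothComplex
    simp only [hp.lift_coe]
    exact (contDiff_infty_iff_deriv.1 hf).2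
  refine ⟨hp.lift, hs, ?_, fun k => fourierCoeff_of_hasDerivAt hd hs.continuous k, hd⟩
  refine closure_minimal (fun x hx => ?_) (isClosed_tsupport f)
  by_contra hxf
  apply hx
  obtain ⟨t, rfl⟩ := QuotientAddGroup.mk_surjective x
  have h0 : f =ᶠ[nhds (t : UnitAddCircle)] 0 := notMem_tsupport_iff_eventuallyEq.1 hxf
  have hc : Continuous fun t : ℝ => (t : UnitAddCircle) := continuous_quotient_mk'
  have h1 : (fun s : ℝ => f s) =ᶠ[nhds t] fun _ => 0 := hc.continuousAt.eventually h0
  exact (hd t).unique ((hasDerivAt_const t (0 : ℂ)).congr_of_eventuallyEq h1)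

theorem SmoothComplex.exists_prod_deriv {f : UnitAddCircle → ℂ} (hf : SmoothComplex f)
    (F : Finset ℤ) : ∃ g : UnitAddCircle → ℂ, SmoothComplex g ∧ tsupport g ⊆ tsupport f ∧
      ∀ k, fourierCoeff g k = (∏ j ∈ F, ((k : ℂ) - j)) * fourierCoeff f k := by
  induction F using Finset.induction_on with
  | empty => exact ⟨f, hf, subset_rfl, by simp⟩
  | insert j F hj ih =>
    obtain ⟨g, hg, hgs, hgc⟩ := ih
    obtain ⟨g', hg', hgs', hgc', -⟩ := hg.exists_deriv
    have hpi : (2 * Real.pi * Complex.I : ℂ) ≠ 0 := Complex.two_pi_I_ne_zero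
    refine ⟨fun x => (2 * Real.pi * Complex.I)⁻¹ * g' x + (-j : ℂ) * g x,
      (hg'.const_mul _).add (hg.const_mul _), ?_, fun k => ?_⟩
    · refine closure_minimal (fun x hx => ?_) (isClosed_tsupport f)
      by_contra hxf
      apply hx
      have e1 : g x = 0 := image_eq_zero_of_notMem_tsupport fun h => hxf (hgs h)
      have e2 : g' x = 0 := image_eq_zero_of_notMem_tsupport fun h => hxf (hgs (hgs' h))
      simp [e1, e2]
    · rw [fourierCoeff_add' (hg'.const_mul _).continuous (hg.const_mul _).continuous,
        fourierCoeff_const_mul, fourierCoeff_const_mul, hgc', hgc, Finset.prod_insert hj]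
      field_simp
      ring

theorem eq_of_coe_eq_coe {s t : ℝ} (h : (s : UnitAddCircle) = t) (hst : |s - t| < 1) : s = t := by
  have h1 : ((s - t : ℝ) : UnitAddCircle) = 0 := by
    rw [AddCircle.coe_sub, h, sub_self]
  obtain ⟨m, hm⟩ := (AddCircle.coe_eq_zero_iff (1 : ℝ)).1 h1
  have hm' : (m : ℝ) = s - t := by simpa using hm
  rw [← hm'] at hst
  have : |m| < 1 := by exact_mod_cast hst
  rw [Int.abs_lt_one_iff] at this
  rw [this] at hm'
  simp at hm'
  linarith

theorem exists_coe_Ico (a : ℝ) (x : UnitAddCircle) : ∃ t ∈ Set.Ico a (a + 1), (t : UnitAddCircle) = x := by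
  have := AddCircle.coe_image_Ico_eq (1 : ℝ) a
  have hx : x ∈ ((↑) : ℝ → UnitAddCircle) '' Set.Ico a (a + 1) := by rw [this]; trivial
  obtain ⟨t, ht, rfl⟩ := hx
  exact ⟨t, ht, rfl⟩

/-- The image of an open interval in the circle. -/
def arc (a b : ℝ) : Set UnitAddCircle := (fun t : ℝ => (t : UnitAddCircle)) '' Set.Ioo a b

theorem isOpen_arc (a b : ℝ) : IsOpen (arc a b) :=
  QuotientAddGroup.isOpenMap_coe _ isOpen_Ioo

/-- The image of a closed interval in the circle. -/
def closedArc (a b : ℝ) : Set UnitAddCircle := (fun t : ℝ => (t : UnitAddCircle)) '' Set.Icc a b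

theorem continuous_coe : Continuous fun t : ℝ => (t : UnitAddCircle) := continuous_quotient_mk'

theorem isCompact_closedArc (a b : ℝ) : IsCompact (closedArc a b) :=
  isCompact_Icc.image continuous_coe

theorem exists_closedArc_of_isCompact {a b : ℝ} {K : Set UnitAddCircle}
    (hK : IsCompact K) (h : K ⊆ arc a b) :
    ∃ a' b', a < a' ∧ b' < b ∧ K ⊆ closedArc a' b' := by
  obtain ⟨m, hm⟩ := hK.elim_directed_cover (fun m : ℕ => arc (a + 1 / (m + 1)) (b - 1 / (m + 1)))
    (fun m => isOpen_arc _ _) (by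
      intro x hx
      obtain ⟨t, ht, rfl⟩ := h hx
      obtain ⟨m, hm⟩ := exists_nat_one_div_lt (lt_min (sub_pos.2 ht.1) (sub_pos.2 ht.2))
      refine Set.mem_iUnion.2 ⟨m, t, ⟨?_, ?_⟩, rfl⟩
      · have := hm.trans_le (min_le_left _ _); linarith
      · have := hm.trans_le (min_le_right _ _); linarith)
    (by
      refine (monotone_nat_of_le_succ fun m => ?_).directed_le
      have : (1 : ℝ) / ((m + 1 : ℕ) + 1) ≤ 1 / (m + 1) := by
        apply one_div_le_one_div_of_le (by positivity)
        push_cast; linarith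
      refine Set.image_mono (Set.Ioo_subset_Ioo ?_ ?_) <;> linarith)
  have : (0 : ℝ) < 1 / (m + 1) := by positivity
  exact ⟨a + 1 / (m + 1), b - 1 / (m + 1), by linarith, by linarith,
    hm.trans (Set.image_mono Set.Ioo_subset_Icc_self)⟩

/-- The equation `(∂ / 2πi - j) g = φ` has a solution supported in an arc if `φ` is supported
there and has a vanishing `j`-th Fourier coefficient. -/
theorem SmoothComplex.exists_primitive {φ : UnitAddCircle → ℂ} (hφ : SmoothComplex φ) {a b : ℝ}
    (hb : b ≤ a + 1) (hs : tsupport φ ⊆ arc a b) {j : ℤ} (hj : fourierCoeff φ j = 0) :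
    ∃ g : UnitAddCircle → ℂ, SmoothComplex g ∧ tsupport g ⊆ arc a b ∧
      ∀ m : ℤ, ((m : ℂ) - j) * fourierCoeff g m = fourierCoeff φ m := by
  obtain ⟨a', b', ha', hb', hK⟩ :=
    exists_closedArc_of_isCompact (isClosed_tsupport φ).isCompact hs
  set ψ : ℝ → ℂ := fun t => fourier (-j) (t : UnitAddCircle) * φ t with hψ
  have hψs : ContDiff ℝ ∞ ψ := (smoothComplex_fourier (-j)).mul hφ
  have hψp : Function.Periodic ψ 1 := fun t => by
    simp only [hψ, AddCircle.coe_add_period]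
  set Ψ : ℝ → ℂ := fun t => ∫ y in a..t, ψ y with hΨ
  have hint : ∀ s t, IntervalIntegrable ψ volume s t := fun s t =>
    hψs.continuous.intervalIntegrable _ _
  have h01 : ∀ s, ∫ y in s..s + 1, ψ y = 0 := by
    intro s
    rw [fourierCoeff_eq_intervalIntegral _ _ s] at hj
    simpa [hψ] using hj
  have hΨp : Function.Periodic Ψ 1 := by
    intro t
    simp only [hΨ]
    rw [← intervalIntegral.integral_add_adjacent_intervals (hint a t) (hint t (t + 1)), h01,
      add_zero]
  have hΨd : ∀ t, HasDerivAt Ψ (ψ t) t := fun t =>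
    intervalIntegral.integral_hasDerivAt_right (hint a t)
      (hψs.continuous.stronglyMeasurableAtFilter _ _) hψs.continuous.continuousAt
  have hΨs : ContDiff ℝ ∞ Ψ := by
    rw [contDiff_infty_iff_deriv]
    refine ⟨fun t => (hΨd t).differentiableAt, ?_⟩
    have : deriv Ψ = ψ := funext fun t => (hΨd t).deriv
    rwa [this]
  set g : UnitAddCircle → ℂ := fun x => (2 * Real.pi * Complex.I) * (fourier j x * hΨp.lift x)
    with hg
  have hgs : SmoothComplex g := by
    refine SmoothComplex.const_mul (SmoothComplex.mul (smoothComplex_fourier j) ?_) _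
    unfold SmoothComplex
    simpa only [hΨp.lift_coe] using hΨs
  have hψ0 : ∀ y : ℝ, (y : UnitAddCircle) ∉ closedArc a' b' → ψ y = 0 := by
    intro y hy
    have : φ y = 0 := image_eq_zero_of_notMem_tsupport fun h => hy (hK h)
    simp [hψ, this]
  have hout : ∀ y : ℝ, a ≤ y → y ≤ a + 1 → (y < a' ∨ b' < y) →
      (y : UnitAddCircle) ∉ closedArc a' b' := by
    rintro y h1 h2 h3 ⟨z, hz, hzy⟩
    have := eq_of_coe_eq_coe hzy (by rw [abs_lt]; constructor <;> linarith [hz.1, hz.2])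
    rcases h3 with h3 | h3 <;> linarith [hz.1, hz.2]
  refine ⟨g, hgs, ?_, fun m => ?_⟩
  · have hsub : tsupport g ⊆ closedArc a' b' := by
      refine closure_minimal (fun x hx => ?_) (isCompact_closedArc a' b').isClosed
      by_contra hxK
      apply hx
      obtain ⟨t, ht, rfl⟩ := exists_coe_Ico a x
      have hΨ0 : Ψ t = 0 := by
        by_cases hta : t < a'
        · simp only [hΨ]
          rw [intervalIntegral.integral_zero_ae]
          refine Filter.Eventually.of_forall fun y hy => hψ0 y ?_
          rw [Set.uIoc_of_le ht.1] at hy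
          exact hout y hy.1.le (by linarith [hy.2, ht.2]) (Or.inl (by linarith [hy.2]))
        · by_cases htb : b' < t
          · have h1 := intervalIntegral.integral_add_adjacent_intervals (hint a t) (hint t (a + 1))
            have h2 : ∫ y in t..(a + 1), ψ y = 0 := by
              rw [intervalIntegral.integral_zero_ae]
              refine Filter.Eventually.of_forall fun y hy => hψ0 y ?_
              rw [Set.uIoc_of_le ht.2.le] at hy
              exact hout y (by linarith [hy.1, ht.1]) hy.2 (Or.inr (by linarith [hy.1]))
            rw [h2, h01, add_zero] at h1
            exact h1
          · exact absurd ⟨t, ⟨not_lt.1 hta, not_lt.1 htb⟩, rfl⟩ hxK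
      simp [hg, hΨp.lift_coe, hΨ0]
    exact hsub.trans (Set.image_mono fun t ht => ⟨ha'.trans_le ht.1, ht.2.trans_lt hb'⟩)
  · have hd : ∀ t : ℝ, HasDerivAt (fun s : ℝ => g s)
        ((fun x => (2 * Real.pi * Complex.I * j) * g x + (2 * Real.pi * Complex.I) * φ x)
          (t : UnitAddCircle)) t := by
      intro t
      have h1 := ((hasDerivAt_fourier 1 j t).mul (hΨd t)).const_mul (2 * Real.pi * Complex.I)
      have h2 : (fun s : ℝ => g s) =
          fun s : ℝ => (2 * Real.pi * Complex.I) * (fourier j (s : UnitAddCircle) * Ψ s) := by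
        funext s
        simp only [hg, hΨp.lift_coe]
      rw [h2]
      refine h1.congr_deriv ?_
      have h3 : fourier j (t : UnitAddCircle) * fourier (-j) (t : UnitAddCircle) = 1 := by
        rw [← fourier_add]; simp
      simp only [hg, hΨp.lift_coe, hψ, Complex.ofReal_one, div_one]
      linear_combination (2 * Real.pi * Complex.I * φ t) * h3
    have h4 := fourierCoeff_of_hasDerivAt hd
      ((hgs.const_mul _).add (hφ.const_mul _)).continuous m
    rw [fourierCoeff_add' (hgs.const_mul _).continuous (hφ.const_mul _).continuous,
      fourierCoeff_const_mul g, fourierCoeff_const_mul φ] at h4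
    have hpi : (2 * Real.pi * Complex.I : ℂ) ≠ 0 := Complex.two_pi_I_ne_zero
    refine mul_left_cancel₀ hpi ?_
    linear_combination -h4

theorem SmoothComplex.exists_prod_primitive {φ : UnitAddCircle → ℂ} (hφ : SmoothComplex φ) {a b : ℝ}
    (hb : b ≤ a + 1) (hs : tsupport φ ⊆ arc a b) (F : Finset ℤ)
    (hF : ∀ j ∈ F, fourierCoeff φ j = 0) :
    ∃ g : UnitAddCircle → ℂ, SmoothComplex g ∧ tsupport g ⊆ arc a b ∧
      ∀ m : ℤ, (∏ j ∈ F, ((m : ℂ) - j)) * fourierCoeff g m = fourierCoeff φ m := by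
  induction F using Finset.induction_on with
  | empty => exact ⟨φ, hφ, hs, by simp⟩
  | insert j F hj ih =>
    obtain ⟨g, hg, hgs, hgc⟩ := ih fun i hi => hF i (Finset.mem_insert_of_mem hi)
    have h0 : fourierCoeff g j = 0 := by
      have h1 := hgc j
      rw [hF j (Finset.mem_insert_self _ _), mul_eq_zero, or_iff_right] at h1
      · exact h1
      · rw [Finset.prod_eq_zero_iff]
        rintro ⟨i, hi, h2⟩
        have : j = i := by exact_mod_cast sub_eq_zero.1 h2
        exact hj (this ▸ hi)
    obtain ⟨g', hg', hgs', hgc'⟩ := hg.exists_primitive hb hgs h0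
    refine ⟨g', hg', hgs', fun m => ?_⟩
    rw [Finset.prod_insert hj, ← hgc, ← hgc']
    ring

/-- Smooth bump functions on the circle. -/
theorem exists_smooth_bump {O : Set UnitAddCircle} (hO : IsOpen O) {x₀ : UnitAddCircle}
    (hx : x₀ ∈ O) : ∃ f : UnitAddCircle → ℝ, SmoothReal f ∧ (∀ x, 0 ≤ f x) ∧
      (∀ᶠ x in nhds x₀, f x = 1) ∧ tsupport f ⊆ O := by
  set c : UnitAddCircle → ℝ := fun x => (fourier 1 (x - x₀) : ℂ).re with hc
  have hcc : Continuous c := by fun_prop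
  have hc1 : ∀ x, c x ≤ 1 ∧ (c x = 1 → x = x₀) := by
    intro x
    have hn : ‖(fourier 1 (x - x₀) : ℂ)‖ = 1 := by rw [fourier_apply, Circle.norm_coe]
    refine ⟨hn ▸ Complex.re_le_norm _, fun h => ?_⟩
    have h1 : (fourier 1 (x - x₀) : ℂ) = 1 := by
      have h2 := Complex.sq_norm (fourier 1 (x - x₀) : ℂ)
      rw [hn, Complex.normSq_apply] at h2
      have h3 : (fourier 1 (x - x₀) : ℂ).re = 1 := h
      rw [h3] at h2
      have h4 : (fourier 1 (x - x₀) : ℂ).im = 0 := by nlinarith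
      exact Complex.ext h3 h4
    rw [fourier_one, Circle.coe_eq_one] at h1
    have h2 : toCircle (x - x₀) = toCircle (0 : UnitAddCircle) := by rw [h1, toCircle_zero]
    exact sub_eq_zero.1 (injective_toCircle one_ne_zero h2)
  have hκ : ∃ κ < 1, ∀ x ∈ Oᶜ, c x ≤ κ := by
    rcases (Oᶜ).eq_empty_or_nonempty with h | h
    · exact ⟨0, one_pos, by simp [h]⟩
    · obtain ⟨y, hy, hmax⟩ := hO.isClosed_compl.isCompact.exists_isMaxOn h hcc.continuousOn
      refine ⟨c y, lt_of_le_of_ne (hc1 y).1 fun h1 => hy ?_, fun x hx => hmax hx⟩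
      rw [(hc1 y).2 h1]; exact hx
  obtain ⟨κ, hκ1, hκ⟩ := hκ
  set l : UnitAddCircle → ℝ := fun x => 3 * (c x - κ) / (1 - κ) - 1 with hl
  have hlc : Continuous l := by fun_prop
  have hcs : SmoothReal c := by
    obtain ⟨s, rfl⟩ := QuotientAddGroup.mk_surjective x₀
    have h1 := SmoothComplex.re (smoothComplex_fourier 1)
    exact h1.comp_sub _
  refine ⟨fun x => Real.smoothTransition (l x), ?_, fun x => Real.smoothTransition.nonneg _, ?_, ?_⟩
  · refine Real.smoothTransition.contDiff.comp (g := Real.smoothTransition) ?_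
    refine ContDiff.sub (ContDiff.div_const (contDiff_const.mul (ContDiff.sub hcs contDiff_const)) _)
      contDiff_const
  · have h1 : l x₀ = 2 := by
      have : c x₀ = 1 := by simp [hc]
      simp only [hl, this]
      rw [mul_div_assoc, div_self (by linarith)]
      norm_num
    have h2 : ∀ᶠ x in nhds x₀, 1 < l x :=
      hlc.continuousAt.eventually (lt_mem_nhds (by rw [h1]; norm_num))
    filter_upwards [h2] with x hx
    exact Real.smoothTransition.one_of_one_le hx.le
  · have h1 : tsupport (fun x => Real.smoothTransition (l x)) ⊆ {x | 0 ≤ l x} := by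
      refine closure_minimal (fun x hx => ?_) (isClosed_le continuous_const hlc)
      by_contra h
      exact hx (Real.smoothTransition.zero_of_nonpos (not_le.1 h).le)
    refine h1.trans fun x hx => ?_
    by_contra hxO
    have h2 := hκ x hxO
    have h3 : 3 * (c x - κ) / (1 - κ) ≤ 0 :=
      div_nonpos_of_nonpos_of_nonneg (by linarith) (by linarith)
    have h4 : 0 ≤ 3 * (c x - κ) / (1 - κ) - 1 := hx
    linarith

end CircleFunctions

section Symplectic

open MeasureTheory AddCircle

/-- The polynomial `∏_{|j| < n} (m - j)`, an odd extension of the weights `c_{n,k}`. -/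
noncomputable def symbol (n : ℕ) (m : ℤ) : ℂ := ∏ j ∈ Finset.Ioo (-(n : ℤ)) n, ((m : ℂ) - j)

theorem symbol_natCast (n k : ℕ) (hn : 1 ≤ n) : symbol n k = weight n k := by
  induction n, hn using Nat.le_induction with
  | base =>
    have : Finset.Ioo (-((1 : ℕ) : ℤ)) (1 : ℕ) = {0} := by decide
    rw [symbol, this]
    simp [weight]
  | succ n hn ih =>
    have h1 : Finset.Ioo (-((n + 1 : ℕ) : ℤ)) (n + 1 : ℕ) =
        insert (n : ℤ) (insert (-(n : ℤ)) (Finset.Ioo (-(n : ℤ)) n)) := by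
      ext j
      simp only [Finset.mem_Ioo, Finset.mem_insert]
      omega
    have h2 : (n : ℤ) ∉ insert (-(n : ℤ)) (Finset.Ioo (-(n : ℤ)) n) := by
      simp only [Finset.mem_Ioo, Finset.mem_insert]
      omega
    have h3 : -(n : ℤ) ∉ Finset.Ioo (-(n : ℤ)) n := by simp
    rw [symbol] at ih
    rw [symbol, h1, Finset.prod_insert h2, Finset.prod_insert h3, ih, weight, weight,
      Finset.prod_Ico_succ_top hn]
    push_cast
    ring

theorem symbol_neg (n : ℕ) (hn : 1 ≤ n) (m : ℤ) : symbol n (-m) = -symbol n m := by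
  have h1 : symbol n (-m) = ∏ j ∈ Finset.Ioo (-(n : ℤ)) n, (-1 : ℂ) * ((m : ℂ) - j) := by
    unfold symbol
    refine Finset.prod_nbij' (fun j => -j) (fun j => -j) ?_ ?_ ?_ ?_ ?_
    · intro j hj; simp only [Finset.mem_Ioo] at hj ⊢; omega
    · intro j hj; simp only [Finset.mem_Ioo] at hj ⊢; omega
    · simp
    · simp
    · intro j _; push_cast; ring
  have h2 : (Finset.Ioo (-(n : ℤ)) n).card = 2 * (n - 1) + 1 := by
    rw [Int.card_Ioo]; omega
  rw [h1, Finset.prod_mul_distrib, Finset.prod_const, h2, pow_succ, pow_mul]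
  simp [symbol]

theorem symbol_eq_zero {n : ℕ} {m : ℤ} (h1 : -(n : ℤ) < m) (h2 : m < n) : symbol n m = 0 :=
  Finset.prod_eq_zero (Finset.mem_Ioo.2 ⟨h1, h2⟩) (sub_self _)

theorem weight_pos {n k : ℕ} (hn : 1 ≤ n) (hk : n ≤ k) : 0 < weight n k := by
  have hk0 : (0 : ℝ) < k := by exact_mod_cast lt_of_lt_of_le hn hk
  refine mul_pos hk0 (Finset.prod_pos fun j hj => ?_)
  have : (j : ℝ) < k := by exact_mod_cast (Finset.mem_Ico.1 hj).2.trans_le hk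
  nlinarith [(Nat.cast_nonneg j : (0 : ℝ) ≤ j)]

theorem weight_le_pow {n k : ℕ} (hn : 1 ≤ n) (hk : n ≤ k) :
    weight n k ≤ (1 + (k : ℝ)) ^ (2 * n - 1) := by
  have h : ∏ j ∈ Finset.Ico 1 n, ((k : ℝ) ^ 2 - (j : ℝ) ^ 2) ≤
      ∏ j ∈ Finset.Ico 1 n, (1 + (k : ℝ)) ^ 2 := by
    refine Finset.prod_le_prod (fun j hj => ?_) (fun j _ => by
      nlinarith [sq_nonneg (j : ℝ), (Nat.cast_nonneg k : (0 : ℝ) ≤ k)])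
    have : (j : ℝ) ≤ k := by exact_mod_cast ((Finset.mem_Ico.1 hj).2.le.trans hk)
    nlinarith [(Nat.cast_nonneg j : (0 : ℝ) ≤ j)]
  rw [Finset.prod_const, Nat.card_Ico, ← pow_mul] at h
  calc weight n k ≤ k * (1 + (k : ℝ)) ^ (2 * (n - 1)) :=
        mul_le_mul_of_nonneg_left h (Nat.cast_nonneg k)
    _ ≤ (1 + (k : ℝ)) * (1 + (k : ℝ)) ^ (2 * (n - 1)) := by gcongr; linarith
    _ = (1 + (k : ℝ)) ^ (2 * n - 1) := by
        rw [← pow_succ']; congr 1; omega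

theorem exists_pow_le_weight {n : ℕ} (hn : 1 ≤ n) :
    ∃ C : ℝ, ∀ k : ℕ, n ≤ k → (1 + (k : ℝ)) ^ (2 * n - 1) ≤ C * weight n k := by
  refine ⟨2 * (4 * n) ^ (n - 1), fun k hk => ?_⟩
  have hk1 : (1 : ℝ) ≤ k := by exact_mod_cast hn.trans hk
  have hn1 : (1 : ℝ) ≤ n := by exact_mod_cast hn
  have hnk : (n : ℝ) ≤ k := by exact_mod_cast hk
  have h : ∏ j ∈ Finset.Ico 1 n, (1 + (k : ℝ)) ^ 2 ≤
      ∏ j ∈ Finset.Ico 1 n, (4 * n) * ((k : ℝ) ^ 2 - (j : ℝ) ^ 2) := by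
    refine Finset.prod_le_prod (fun j _ => by positivity) fun j hj => ?_
    have hj1 : (j : ℝ) + 1 ≤ n := by exact_mod_cast (Finset.mem_Ico.1 hj).2
    have hj0 : (0 : ℝ) ≤ j := Nat.cast_nonneg j
    have e1 : (k : ℝ) ≤ n * (k - j) := by nlinarith
    have e2 : (k : ℝ) * k ≤ n * (k - j) * (k + j) := by nlinarith
    nlinarith
  rw [Finset.prod_const, Finset.prod_mul_distrib, Finset.prod_const, Nat.card_Ico, ← pow_mul] at h
  calc (1 + (k : ℝ)) ^ (2 * n - 1) = (1 + (k : ℝ)) * (1 + (k : ℝ)) ^ (2 * (n - 1)) := by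
        rw [← pow_succ']; congr 1; omega
    _ ≤ (2 * k) * ((4 * n) ^ (n - 1) * ∏ j ∈ Finset.Ico 1 n, ((k : ℝ) ^ 2 - (j : ℝ) ^ 2)) := by
        gcongr; linarith
    _ = _ := by unfold weight; ring

variable {n : ℕ}

theorem field_apply (hn : 1 ≤ n) {f : UnitAddCircle → ℝ} (hf : SmoothReal f) (k : Mode n) :
    field n hn f hf k =
      (Real.sqrt (weight n k) : ℂ) * fourierCoeff (fun x => (f x : ℂ)) (-((k : ℕ) : ℤ)) := rfl

theorem sqrt_weight_mul_self (hn : 1 ≤ n) (k : Mode n) :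
    (Real.sqrt (weight n k) : ℂ) * Real.sqrt (weight n k) = weight n k := by
  rw [← Complex.ofReal_mul, Real.mul_self_sqrt (weight_pos hn k.2).le]

theorem sqrt_weight_ne_zero (hn : 1 ≤ n) (k : Mode n) : (Real.sqrt (weight n k) : ℂ) ≠ 0 := by
  exact_mod_cast (Real.sqrt_pos.2 (weight_pos hn k.2)).ne'

/-- The symplectic form as a sum over all frequencies. -/
theorem hasSum_symplectic (hn : 1 ≤ n) {v : OneParticle n} {u : ℤ → ℂ}
    (hv : ∀ k : Mode n, v k = (Real.sqrt (weight n k) : ℂ) * u (-((k : ℕ) : ℤ)))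
    (hu : ∀ k : Mode n, u ((k : ℕ) : ℤ) = star (u (-((k : ℕ) : ℤ))))
    {f : UnitAddCircle → ℝ} (hf : SmoothReal f) :
    HasSum (fun k : ℤ => symbol n k * u k * fourierCoeff (fun x => (f x : ℂ)) (-k))
      (2 * (⟪v, field n hn f hf⟫.im : ℂ) * Complex.I) := by
  set T : ℤ → ℂ := fun k => symbol n k * u k * fourierCoeff (fun x => (f x : ℂ)) (-k) with hT
  have h1 : ∀ k : Mode n, T ((k : ℕ) : ℤ) = ⟪v k, field n hn f hf k⟫ := by
    intro k
    simp only [hT]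
    rw [symbol_natCast _ _ hn, hu, RCLike.inner_apply, field_apply, hv, ← sqrt_weight_mul_self hn,
      map_mul, Complex.conj_ofReal, starRingEnd_apply]
    ring
  have h2 : ∀ k : Mode n, T (-((k : ℕ) : ℤ)) = -star (T ((k : ℕ) : ℤ)) := by
    intro k
    simp only [hT]
    rw [symbol_neg _ hn, symbol_natCast _ _ hn, star_mul', star_mul', hu, star_star, neg_neg,
      fourierCoeff_ofReal_neg, star_star]
    simp
  have hA : HasSum (fun k : Mode n => T ((k : ℕ) : ℤ)) ⟪v, field n hn f hf⟫ := by
    simp only [h1]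
    exact lp.hasSum_inner (𝕜 := ℂ) v (field n hn f hf)
  have hB : HasSum (fun k : Mode n => T (-((k : ℕ) : ℤ))) (-star ⟪v, field n hn f hf⟫) := by
    simp only [h2]
    exact hA.star.neg
  have hi1 : Function.Injective fun k : Mode n => ((k : ℕ) : ℤ) := by
    intro a b h; exact Subtype.ext (by simpa using h)
  have hi2 : Function.Injective fun k : Mode n => -((k : ℕ) : ℤ) := by
    intro a b h; exact Subtype.ext (by simpa using h)
  have hA' : HasSum (fun k : ℤ => if (n : ℤ) ≤ k then T k else 0) ⟪v, field n hn f hf⟫ := by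
    refine (hi1.hasSum_iff ?_).1 ?_
    · intro k hk
      rw [if_neg]
      intro h
      exact hk ⟨⟨k.toNat, by omega⟩, by simp; omega⟩
    · refine hA.congr_fun ?_ |> fun h => h
      intro k
      have : (n : ℤ) ≤ ((k : ℕ) : ℤ) := by exact_mod_cast k.2
      simp [this]
  have hB' : HasSum (fun k : ℤ => if k ≤ -(n : ℤ) then T k else 0)
      (-star ⟪v, field n hn f hf⟫) := by
    refine (hi2.hasSum_iff ?_).1 ?_
    · intro k hk
      rw [if_neg]
      intro h
      exact hk ⟨⟨(-k).toNat, by omega⟩, by simp; omega⟩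
    · refine hB.congr_fun ?_ |> fun h => h
      intro k
      have : (n : ℤ) ≤ ((k : ℕ) : ℤ) := by exact_mod_cast k.2
      simp [this]
  have h3 := hA'.add hB'
  have h4 : ⟪v, field n hn f hf⟫ + -star ⟪v, field n hn f hf⟫ =
      2 * (⟪v, field n hn f hf⟫.im : ℂ) * Complex.I := by
    rw [← sub_eq_add_neg, ← starRingEnd_apply, Complex.sub_conj]; push_cast; ring
  rw [h4] at h3
  convert h3 using 2 with k
  by_cases ha : (n : ℤ) ≤ k
  · rw [if_pos ha, if_neg (by omega), add_zero]
  · by_cases hb : k ≤ -(n : ℤ)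
    · rw [if_neg ha, if_pos hb, zero_add]
    · have : T k = 0 := by
        simp only [hT]
        rw [symbol_eq_zero (by omega) (by omega)]
        simp
      rw [if_neg ha, if_neg hb, this, add_zero]

theorem im_inner_field_eq_zero (hn : 1 ≤ n) {f h : UnitAddCircle → ℝ} (hf : SmoothReal f)
    (hh : SmoothReal h) (hd : Disjoint (tsupport h) (tsupport f)) :
    (⟪field n hn h hh, field n hn f hf⟫).im = 0 := by
  have h1 := hasSum_symplectic hn (v := field n hn h hh) (u := fourierCoeff fun x => (h x : ℂ))
    (fun k => field_apply hn hh k) (fun k => by rw [fourierCoeff_ofReal_neg, star_star]) hf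
  obtain ⟨g, hg, hgs, hgc⟩ := hf.ofReal.exists_prod_deriv (Finset.Ioo (-(n : ℤ)) n)
  have h2 := (hh.ofReal.hasSum_fourierCoeff_mul hg.continuous 0).neg
  have h3 : (fun x => (h x : ℂ) * g x) = fun _ => 0 := by
    funext x
    by_cases hx : x ∈ tsupport h
    · have : x ∉ tsupport g := fun hx' => by
        have h4 := hgs hx'
        have h5 : tsupport (fun x => (f x : ℂ)) ⊆ tsupport f :=
          closure_mono fun y hy => by simpa using hy
        exact Set.disjoint_left.1 hd hx (h5 h4)
      rw [image_eq_zero_of_notMem_tsupport this, mul_zero]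
    · rw [image_eq_zero_of_notMem_tsupport hx]; simp
  have h4 : fourierCoeff (fun x => (h x : ℂ) * g x) 0 = 0 := by
    rw [h3]; simp [fourierCoeff_def]
  rw [h4, neg_zero] at h2
  have h5 := h1.unique (h2.congr_fun (fun k => by
    rw [zero_sub, hgc]
    have := symbol_neg n hn k
    have h6 : symbol n (-k) = ∏ j ∈ Finset.Ioo (-(n : ℤ)) n, (((-k : ℤ) : ℂ) - j) := rfl
    rw [← h6, this]
    ring))
  simpa using h5

theorem exists_im_inner_field_ne_zero (hn : 1 ≤ n) {f : UnitAddCircle → ℝ} (hf : SmoothReal f)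
    (h0 : field n hn f hf ≠ 0) : ∃ (g : UnitAddCircle → ℝ) (hg : SmoothReal g),
      tsupport g ⊆ tsupport f ∧ (⟪field n hn f hf, field n hn g hg⟫).im ≠ 0 := by
  obtain ⟨g, hg, hgs, hgc, hgd⟩ := hf.ofReal.exists_deriv
  have him : ∀ x, (g x).im = 0 := by
    intro x
    obtain ⟨t, rfl⟩ := QuotientAddGroup.mk_surjective x
    have h1 := Complex.imCLM.hasFDerivAt.comp_hasDerivAt t (hgd t)
    have h2 : (Complex.imCLM ∘ fun s : ℝ => ((f s : ℝ) : ℂ)) = fun _ => 0 := by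
      funext s; simp
    rw [h2] at h1
    exact h1.unique (hasDerivAt_const t (0 : ℝ))
  have hre : (fun x => (((g x).re : ℝ) : ℂ)) = g := by
    funext x
    exact Complex.ext (by simp) (by simp [him])
  refine ⟨fun x => (g x).re, hg.re, ?_, fun h => h0 ?_⟩
  · refine (closure_mono fun x hx => ?_ : tsupport (fun x => (g x).re) ⊆ tsupport g).trans
      (hgs.trans (closure_mono fun y hy => by simpa using hy))
    intro h; exact hx (by simp [h])
  · have h1 := lp.hasSum_inner (𝕜 := ℂ) (field n hn f hf) (field n hn _ hg.re)
    have h2 := (Complex.hasSum_im h1).neg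
    rw [h, neg_zero] at h2
    have h3 : ∀ k : Mode n, -(⟪field n hn f hf k, field n hn _ hg.re k⟫).im =
        2 * Real.pi * (k : ℕ) * ‖field n hn f hf k‖ ^ 2 := by
      intro k
      have h4 : field n hn _ hg.re k = (-2 * Real.pi * (k : ℕ) * Complex.I) * field n hn f hf k := by
        rw [field_apply, field_apply, hre, hgc]
        push_cast
        ring
      rw [h4, RCLike.inner_apply, mul_assoc, Complex.mul_conj', mul_comm, mul_comm _ Complex.I]
      have : (((‖field n hn f hf k‖ : ℝ) : ℂ) ^ 2 * (Complex.I * (-2 * (Real.pi : ℂ) * ((k : ℕ) : ℂ)))) =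
          ((‖field n hn f hf k‖ ^ 2 * (-2 * Real.pi * (k : ℕ)) : ℝ) : ℂ) * Complex.I := by
        push_cast; ring
      rw [this, Complex.mul_I_im, Complex.ofReal_re]
      ring
    simp only [h3] at h2
    have h5 := (hasSum_zero_iff_of_nonneg (fun k => by positivity)).1 h2
    ext k
    have h6 := congrFun h5 k
    have hk : (0 : ℝ) < (k : ℕ) := by exact_mod_cast lt_of_lt_of_le hn k.2
    have : ‖field n hn f hf k‖ ^ 2 = 0 := by
      simp only [Pi.zero_apply, mul_eq_zero] at h6
      rcases h6 with h6 | h6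
      · have := Real.pi_pos
        exfalso
        rcases h6 with (h6 | h6) | h6 <;> linarith
      · exact h6
    simpa using this

end Symplectic

section Mollify

open MeasureTheory AddCircle Filter Topology
open scoped Pointwise

theorem fourierCoeff_fourier_apply (k l : ℤ) :
    fourierCoeff (fun x : UnitAddCircle => fourier k x) l = if l = k then 1 else 0 := by
  have := congrFun (fourierCoeff_fourier (T := 1) k) l
  rw [Pi.single_apply] at this
  exact this

/-- A rapidly decreasing Fourier series. -/
theorem contDiff_fourierSeries (N : ℕ) {a : ℤ → ℂ} (ha : RapidDecay a) :
    ContDiff ℝ N fun t : ℝ => ∑' k, a k * fourier k (t : UnitAddCircle) := by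
  induction N generalizing a with
  | zero =>
    rw [Nat.cast_zero, contDiff_zero]
    refine continuous_tsum (u := fun k => ‖a k‖) (fun k => ?_) ha.summable_norm fun k t => ?_
    · exact continuous_const.mul ((map_continuous _).comp continuous_coe)
    · rw [norm_mul, fourier_apply, Circle.norm_coe, mul_one]
  | succ N ih =>
    have hb : RapidDecay fun k => (2 * Real.pi * Complex.I * k) * a k :=
      ha.mul_of_le (C := 2 * Real.pi) (N := 1) fun k => by
        simp only [norm_mul, Complex.norm_ofNat, Complex.norm_real, Complex.norm_I, mul_one,
          Complex.norm_intCast, pow_one, Real.norm_eq_abs, abs_of_pos Real.pi_pos]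
        gcongr
        linarith
    have hd : ∀ t : ℝ, HasDerivAt (fun t : ℝ => ∑' k, a k * fourier k (t : UnitAddCircle))
        (∑' k, ((2 * Real.pi * Complex.I * k) * a k) * fourier k (t : UnitAddCircle)) t := by
      intro t
      refine hasDerivAt_tsum (g := fun k (t : ℝ) => a k * fourier k (t : UnitAddCircle))
        (g' := fun k (t : ℝ) => ((2 * Real.pi * Complex.I * k) * a k) * fourier k (t : UnitAddCircle))
        (u := fun k => ‖(2 * Real.pi * Complex.I * k) * a k‖)
        hb.summable_norm (fun k t => ?_) (fun k t => ?_) (y₀ := 0) ?_ t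
      · have := (hasDerivAt_fourier 1 k t).const_mul (a k)
        refine this.congr_deriv ?_
        simp only [Complex.ofReal_one, div_one]
        ring
      · rw [norm_mul, fourier_apply, Circle.norm_coe, mul_one]
      · refine ha.summable_norm.of_norm_bounded fun k => ?_
        rw [norm_mul, fourier_apply, Circle.norm_coe, mul_one]
    rw [Nat.cast_add, Nat.cast_one, contDiff_succ_iff_deriv]
    refine ⟨fun t => (hd t).differentiableAt, by simp, ?_⟩
    have : deriv (fun t : ℝ => ∑' k, a k * fourier k (t : UnitAddCircle)) =
        fun t : ℝ => ∑' k, ((2 * Real.pi * Complex.I * k) * a k) * fourier k (t : UnitAddCircle) :=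
      funext fun t => (hd t).deriv
    rw [this]
    exact ih hb

theorem RapidDecay.exists_smooth {a : ℤ → ℂ} (ha : RapidDecay a) :
    ∃ f : UnitAddCircle → ℂ, SmoothComplex f ∧ (∀ x, HasSum (fun k => a k * fourier k x) (f x)) ∧
      ∀ k, fourierCoeff f k = a k := by
  have hs : ∀ x : UnitAddCircle, Summable fun k => a k * fourier k x := fun x => by
    refine ha.summable_norm.of_norm_bounded fun k => ?_
    rw [norm_mul, fourier_apply, Circle.norm_coe, mul_one]
  refine ⟨fun x => ∑' k, a k * fourier k x, contDiff_infty.2 fun N => contDiff_fourierSeries N ha,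
    fun x => (hs x).hasSum, fun l => ?_⟩
  have h1 := hasSum_integral_of_summable_integral_norm (μ := haarAddCircle)
    (F := fun (k : ℤ) (x : UnitAddCircle) => fourier (-l) x * (a k * fourier k x))
    (fun k => integrable_fourier_mul (by fun_prop) _)
    (by
      refine ha.summable_norm.congr fun k => ?_
      have : ∀ x : UnitAddCircle, ‖fourier (-l) x * (a k * fourier k x)‖ = ‖a k‖ := by
        intro x
        rw [norm_mul, norm_mul, fourier_apply, fourier_apply, Circle.norm_coe,
          Circle.norm_coe, one_mul, mul_one]
      simp only [this]
      simp)
  have h2 : ∀ k, ∫ x : UnitAddCircle, fourier (-l) x * (a k * fourier k x) ∂haarAddCircle =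
      if k = l then a l else 0 := by
    intro k
    rw [← fourierCoeff_def, fourierCoeff_const_mul, fourierCoeff_fourier_apply]
    by_cases h : l = k
    · simp [h]
    · simp [h, Ne.symm h]
  simp only [h2, tsum_mul_left] at h1
  rw [fourierCoeff_def]
  exact h1.unique (hasSum_ite_eq l (a l))

/-- The sequence `u` of Fourier coefficients belongs to the Sobolev space of order `r / 2`. -/
def Sobolev (r : ℕ) (u : ℤ → ℂ) : Prop := Summable fun k => ‖u k‖ ^ 2 * (1 + |(k : ℝ)|) ^ r

theorem Sobolev.exists_bound {r : ℕ} {u : ℤ → ℂ} (hu : Sobolev r u) : ∃ C, 0 ≤ C ∧ ∀ k, ‖u k‖ ≤ C := by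
  refine ⟨1 + ∑' k, ‖u k‖ ^ 2 * (1 + |(k : ℝ)|) ^ r,
    add_nonneg zero_le_one (tsum_nonneg fun k => by positivity), fun k => ?_⟩
  have h1 := hu.le_tsum k (fun j _ => by positivity)
  have h2 : ‖u k‖ ^ 2 ≤ ‖u k‖ ^ 2 * (1 + |(k : ℝ)|) ^ r :=
    le_mul_of_one_le_right (by positivity) (one_le_pow₀ (by linarith [abs_nonneg (k : ℝ)]))
  nlinarith [sq_nonneg (‖u k‖ - 1)]

theorem Sobolev.sub {r : ℕ} {u w : ℤ → ℂ} (hu : Sobolev r u) (hw : Sobolev r w) :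
    Sobolev r fun k => u k - w k := by
  refine ((hu.add hw).mul_left 2).of_nonneg_of_le (fun k => by positivity) fun k => ?_
  have h1 : ‖u k - w k‖ ^ 2 ≤ 2 * (‖u k‖ ^ 2 + ‖w k‖ ^ 2) := by
    have := norm_sub_le (u k) (w k)
    have h2 := norm_nonneg (u k - w k)
    nlinarith [sq_nonneg (‖u k‖ - ‖w k‖)]
  calc _ ≤ 2 * (‖u k‖ ^ 2 + ‖w k‖ ^ 2) * (1 + |(k : ℝ)|) ^ r := by gcongr
    _ = _ := by ring

theorem Sobolev.summable_pairing {r : ℕ} {u : ℤ → ℂ} (hu : Sobolev r u) {φ : UnitAddCircle → ℂ}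
    (hφ : SmoothComplex φ) : Summable fun k => u k * fourierCoeff φ (-k) := by
  obtain ⟨C, hC0, hC⟩ := hu.exists_bound
  refine ((hφ.rapidDecay.summable_norm.comp_injective neg_injective).mul_left C).of_norm_bounded
    fun k => ?_
  rw [norm_mul]
  exact mul_le_mul_of_nonneg_right (hC k) (norm_nonneg _)

/-- The distribution with the Fourier coefficients `u` vanishes on the open set `O`. -/
def VanishesOn (u : ℤ → ℂ) (O : Set UnitAddCircle) : Prop :=
  ∀ φ : UnitAddCircle → ℂ, SmoothComplex φ → tsupport φ ⊆ O →
    HasSum (fun k => u k * fourierCoeff φ (-k)) 0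

variable {n : ℕ}

theorem memlp_realVec (hn : 1 ≤ n) {u : ℤ → ℂ} (hu : Sobolev (2 * n - 1) u) :
    Memℓp (E := fun _ : Mode n => ℂ)
      (fun k => (Real.sqrt (weight n k) : ℂ) * ((u (-((k : ℕ) : ℤ)) + star (u ((k : ℕ) : ℤ))) / 2))
      2 := by
  apply memℓp_gen
  have hi1 : Function.Injective fun k : Mode n => ((k : ℕ) : ℤ) := by
    intro a b h; exact Subtype.ext (by simpa using h)
  have hi2 : Function.Injective fun k : Mode n => -((k : ℕ) : ℤ) := by
    intro a b h; exact Subtype.ext (by simpa using h)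
  have hs := (Summable.comp_injective hu hi2).add (Summable.comp_injective hu hi1)
  simp only [ENNReal.toReal_ofNat, Real.rpow_ofNat]
  refine hs.of_nonneg_of_le (fun k => by positivity) fun k => ?_
  have h1 : ‖(u (-((k : ℕ) : ℤ)) + star (u ((k : ℕ) : ℤ))) / 2‖ ^ 2 ≤
      ‖u (-((k : ℕ) : ℤ))‖ ^ 2 + ‖u ((k : ℕ) : ℤ)‖ ^ 2 := by
    have h2 := norm_add_le (u (-((k : ℕ) : ℤ))) (star (u ((k : ℕ) : ℤ)))
    rw [norm_star] at h2
    rw [norm_div, div_pow, Complex.norm_ofNat]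
    have h3 := norm_nonneg (u (-((k : ℕ) : ℤ)) + star (u ((k : ℕ) : ℤ)))
    nlinarith [sq_nonneg (‖u (-((k : ℕ) : ℤ))‖ - ‖u ((k : ℕ) : ℤ)‖)]
  have h2 := weight_le_pow hn k.2
  have h3 := (weight_pos hn k.2).le
  rw [norm_mul, mul_pow, Complex.norm_real, Real.norm_eq_abs, sq_abs, Real.sq_sqrt h3]
  calc _ ≤ (1 + ((k : ℕ) : ℝ)) ^ (2 * n - 1) *
        (‖u (-((k : ℕ) : ℤ))‖ ^ 2 + ‖u ((k : ℕ) : ℤ)‖ ^ 2) := by gcongr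
    _ = _ := by
      simp only [Function.comp_apply, Int.cast_neg, Int.cast_natCast, abs_neg, Nat.abs_cast]
      ring

/-- The class in the one-particle space of the real part of the distribution with the Fourier
coefficients `u`. -/
noncomputable def realVec (hn : 1 ≤ n) (u : ℤ → ℂ) (hu : Sobolev (2 * n - 1) u) : OneParticle n :=
  ⟨_, memlp_realVec hn hu⟩

theorem realVec_apply (hn : 1 ≤ n) {u : ℤ → ℂ} (hu : Sobolev (2 * n - 1) u) (k : Mode n) :
    realVec hn u hu k = (Real.sqrt (weight n k) : ℂ) *
      ((u (-((k : ℕ) : ℤ)) + star (u ((k : ℕ) : ℤ))) / 2) := rfl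

theorem field_re_apply (hn : 1 ≤ n) {f : UnitAddCircle → ℂ} (hf : SmoothComplex f) (k : Mode n) :
    field n hn _ hf.re k = (Real.sqrt (weight n k) : ℂ) *
      ((fourierCoeff f (-((k : ℕ) : ℤ)) + star (fourierCoeff f ((k : ℕ) : ℤ))) / 2) := by
  rw [field_apply]
  congr 1
  have h1 : (fun x => (((f x).re : ℝ) : ℂ)) = fun x => (1 / 2 : ℂ) * (f x + star (f x)) := by
    funext x
    rw [← starRingEnd_apply, Complex.add_conj]; push_cast; ring
  have hs : Continuous fun x => star (f x) := continuous_star.comp hf.continuous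
  rw [h1, fourierCoeff_const_mul, fourierCoeff_add' hf.continuous hs, fourierCoeff_conj, neg_neg]
  ring

theorem integral_pos_of_bump {f : UnitAddCircle → ℝ} (hf : Continuous f) (h0 : ∀ x, 0 ≤ f x)
    {x₀ : UnitAddCircle} (hx : f x₀ ≠ 0) : 0 < ∫ x, f x ∂haarAddCircle :=
  hf.integral_pos_of_hasCompactSupport_nonneg_nonzero (HasCompactSupport.of_compactSpace _) h0 hx

/-- Normalised smooth bump functions on the circle. -/
theorem exists_mollifier {O : Set UnitAddCircle} (hO : IsOpen O) (hne : O.Nonempty) :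
    ∃ f : UnitAddCircle → ℝ, SmoothReal f ∧ (∀ x, 0 ≤ f x) ∧ tsupport f ⊆ O ∧
      ∫ x, f x ∂haarAddCircle = 1 := by
  obtain ⟨x₀, hx⟩ := hne
  obtain ⟨f, hf, h0, h1, hs⟩ := exists_smooth_bump hO hx
  have hpos := integral_pos_of_bump hf.continuous h0 (x₀ := x₀) (by rw [h1.self_of_nhds]; simp)
  refine ⟨fun x => (∫ x, f x ∂haarAddCircle)⁻¹ * f x, ContDiff.mul contDiff_const hf,
    fun x => mul_nonneg (inv_nonneg.2 hpos.le) (h0 x), ?_, ?_⟩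
  · refine (closure_mono fun x hx => ?_ : _ ⊆ tsupport f).trans hs
    intro h; exact hx (by simp [h])
  · rw [integral_const_mul, inv_mul_cancel₀ hpos.ne']

theorem norm_fourierCoeff_mollifier_sub_one {f : UnitAddCircle → ℝ} (hf : SmoothReal f)
    (h0 : ∀ x, 0 ≤ f x) (h1 : ∫ x, f x ∂haarAddCircle = 1) (k : ℤ) {η : ℝ}
    (hη : ∀ x ∈ tsupport f, ‖(fourier (-k) x : ℂ) - 1‖ ≤ η) :
    ‖fourierCoeff (fun x => (f x : ℂ)) k - 1‖ ≤ η := by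
  have hc := hf.ofReal.continuous
  have hint : Integrable f haarAddCircle :=
    hf.continuous.integrable_of_hasCompactSupport (HasCompactSupport.of_compactSpace _)
  have e1 : fourierCoeff (fun x => (f x : ℂ)) k - 1 =
      ∫ x, (fourier (-k) x - 1) * (f x : ℂ) ∂haarAddCircle := by
    have h2 : ∫ x, (f x : ℂ) ∂haarAddCircle = ((∫ x, f x ∂haarAddCircle : ℝ) : ℂ) := integral_ofReal
    rw [h1, Complex.ofReal_one] at h2
    have h3 := integral_sub (integrable_fourier_mul hc (-k)) hint.ofReal
    simp only [sub_mul, one_mul]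
    rw [fourierCoeff_def]
    refine Eq.trans ?_ h3.symm
    congr 1
    exact h2.symm
  rw [e1]
  calc _ ≤ ∫ x, η * f x ∂haarAddCircle := by
        refine norm_integral_le_of_norm_le (hint.const_mul η) (Eventually.of_forall fun x => ?_)
        rw [norm_mul, Complex.norm_real, Real.norm_eq_abs, abs_of_nonneg (h0 x)]
        by_cases hx : x ∈ tsupport f
        · exact mul_le_mul_of_nonneg_right (hη x hx) (h0 x)
        · simp [image_eq_zero_of_notMem_tsupport hx]
    _ = η := by rw [integral_const_mul, h1, mul_one]

theorem norm_fourierCoeff_mollifier_le_one {f : UnitAddCircle → ℝ} (hf : SmoothReal f)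
    (h0 : ∀ x, 0 ≤ f x) (h1 : ∫ x, f x ∂haarAddCircle = 1) (k : ℤ) :
    ‖fourierCoeff (fun x => (f x : ℂ)) k‖ ≤ 1 := by
  have hint : Integrable f haarAddCircle :=
    hf.continuous.integrable_of_hasCompactSupport (HasCompactSupport.of_compactSpace _)
  rw [fourierCoeff_def]
  refine (norm_integral_le_of_norm_le hint (Eventually.of_forall fun x => ?_)).trans_eq h1
  rw [norm_mul, Complex.norm_real, Real.norm_eq_abs, abs_of_nonneg (h0 x), fourier_apply,
    Circle.norm_coe, one_mul]

/-- Bounded multipliers converging pointwise to `1` converge strongly to `1` on `ℓ²`. -/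
theorem tendsto_of_multiplier {ι : Type*} {v : Ell ι} {w : ℕ → Ell ι} {m : ℕ → ι → ℂ}
    (hw : ∀ N i, w N i = m N i * v i) (hm : ∀ N i, ‖m N i‖ ≤ 1)
    (hlim : ∀ i, Tendsto (fun N => m N i) atTop (𝓝 1)) : Tendsto w atTop (𝓝 v) := by
  rw [tendsto_iff_norm_sub_tendsto_zero]
  have h1 : Tendsto (fun N => ‖w N - v‖ ^ 2) atTop (𝓝 0) := by
    have h2 : ∀ N, ‖w N - v‖ ^ 2 = ∑' i, ‖(m N i - 1) * v i‖ ^ 2 := by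
      intro N
      rw [norm_sq_eq_tsum]
      refine tsum_congr fun i => ?_
      rw [lp.coeFn_sub, Pi.sub_apply, hw, sub_mul, one_mul]
    simp only [h2]
    have h3 : (0 : ℝ) = ∑' _ : ι, (0 : ℝ) := by simp
    rw [h3]
    refine tendsto_tsum_of_dominated_convergence (bound := fun i => 4 * ‖v i‖ ^ 2)
      ((summable_sq v).mul_left 4) (fun i => ?_) (Eventually.of_forall fun N i => ?_)
    · have := (((hlim i).sub_const 1).mul_const (v i)).norm.pow 2
      simpa using this
    · rw [Real.norm_eq_abs, abs_of_nonneg (by positivity), norm_mul, mul_pow]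
      gcongr
      have := (norm_sub_le (m N i) 1).trans (add_le_add (hm N i) norm_one.le)
      nlinarith [norm_nonneg (m N i - 1)]
  have h2 := h1.sqrt
  simpa using h2

/-- Mollification: a distribution in the Sobolev space which can be moved into the interior of `I`
has its class in the local subspace of `I`. -/
theorem realVec_mem_of_mollify (hn : 1 ≤ n) {u : ℤ → ℂ} (hu : Sobolev (2 * n - 1) u)
    {O I : Set UnitAddCircle} (hO : IsOpen O) (hv : VanishesOn u O) (S : ℕ → Set UnitAddCircle)
    (hSo : ∀ N, IsOpen (S N)) (hSne : ∀ N, (S N).Nonempty)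
    (hS0 : ∀ U ∈ 𝓝 (0 : UnitAddCircle), ∀ᶠ N in atTop, S N ⊆ U)
    (hSI : ∀ N, ∀ x ∉ O, ∀ y ∈ S N, x + y ∈ I) :
    realVec hn u hu ∈ localSubspace n hn I := by
  choose ρ hρs hρ0 hρS hρ1 using fun N => exists_mollifier (hSo N) (hSne N)
  obtain ⟨C, hC0, hC⟩ := hu.exists_bound
  have hdec : ∀ N, RapidDecay fun k => u k * fourierCoeff (fun x => (ρ N x : ℂ)) k := fun N =>
    (hρs N).ofReal.rapidDecay.mul_of_le (N := 0) fun k => by simpa using hC k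
  choose F hFs hF hFc using fun N => (hdec N).exists_smooth
  have hsupp : ∀ N, tsupport (F N) ⊆ I := by
    intro N
    have hcpt : IsCompact (Oᶜ + tsupport (ρ N)) :=
      hO.isClosed_compl.isCompact.add (isClosed_tsupport _).isCompact
    have h1 : tsupport (F N) ⊆ Oᶜ + tsupport (ρ N) := by
      refine closure_minimal (fun x hx => ?_) hcpt.isClosed
      by_contra hxn
      apply hx
      have hφ := (hρs N).ofReal.comp_const_sub x
      have h2 := hv _ hφ (by
        have : tsupport (fun y => (ρ N (x - y) : ℂ)) ⊆ {y | x - y ∈ tsupport (ρ N)} := by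
          refine closure_minimal (fun y hy => ?_)
            ((isClosed_tsupport (ρ N)).preimage (by fun_prop))
          refine subset_tsupport _ ?_
          intro h
          exact hy (by simp [h])
        intro y hy
        by_contra hyO
        exact hxn ⟨y, hyO, x - y, this hy, add_sub_cancel y x⟩)
      refine (hF N x).unique (h2.congr_fun fun k => ?_)
      rw [fourierCoeff_const_sub_comp (fun y => (ρ N y : ℂ))]
      ring
    refine h1.trans ?_
    rintro _ ⟨x, hx, y, hy, rfl⟩
    exact hSI N x hx y (hρS N hy)
  have hlim : ∀ k : ℤ, Tendsto (fun N => fourierCoeff (fun x => (ρ N x : ℂ)) k) atTop (𝓝 1) := by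
    intro k
    rw [Metric.tendsto_atTop']
    intro ε hε
    have hU : {x : UnitAddCircle | ‖(fourier (-k) x : ℂ) - 1‖ < ε / 2} ∈ 𝓝 (0 : UnitAddCircle) := by
      have hc : Continuous fun x : UnitAddCircle => ‖(fourier (-k) x : ℂ) - 1‖ := by fun_prop
      refine hc.continuousAt.eventually (gt_mem_nhds ?_)
      simp [hε]
    obtain ⟨N₀, hN₀⟩ := eventually_atTop.1 (hS0 _ hU)
    refine ⟨N₀, fun N hN => ?_⟩
    rw [dist_eq_norm]
    refine (norm_fourierCoeff_mollifier_sub_one (hρs N) (hρ0 N) (hρ1 N) k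
      fun x hx => (hN₀ N hN.le (hρS N hx)).le).trans_lt (by linarith)
  have htend : Tendsto (fun N => field n hn _ (hFs N).re) atTop (𝓝 (realVec hn u hu)) := by
    refine tendsto_of_multiplier
      (m := fun N k => fourierCoeff (fun x => (ρ N x : ℂ)) (-((k : ℕ) : ℤ))) (fun N k => ?_)
      (fun N k => norm_fourierCoeff_mollifier_le_one (hρs N) (hρ0 N) (hρ1 N) _) fun k => hlim _
    rw [field_re_apply hn (hFs N), realVec_apply, hFc, hFc, fourierCoeff_ofReal_neg, star_mul']
    ring
  refine (localSubspace n hn I).isClosed'.mem_of_tendsto htend (Eventually.of_forall fun N => ?_)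
  refine subset_closure (Submodule.subset_span ⟨_, (hFs N).re, ?_, rfl⟩)
  refine (closure_mono fun x hx => ?_ : _ ⊆ tsupport (F N)).trans (hsupp N)
  intro h; exact hx (by simp [h])

/-- The Fourier coefficients of the product of `χ` and the distribution with the Fourier
coefficients `u`. -/
noncomputable def mulSeq (χ : UnitAddCircle → ℂ) (u : ℤ → ℂ) (k : ℤ) : ℂ :=
  ∑' m, fourierCoeff χ m * u (k - m)

/-- The shear `(k, m) ↦ (m, k - m)`. -/
def shear : ℤ × ℤ ≃ ℤ × ℤ where
  toFun p := (p.2, p.1 - p.2)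
  invFun p := (p.1 + p.2, p.1)
  left_inv p := by simp
  right_inv p := by simp

theorem sq_tsum_mul_le {ι : Type*} {w a : ι → ℝ} (hw : ∀ i, 0 ≤ w i) (h1 : Summable w)
    (h2 : Summable fun i => w i * a i) (h3 : Summable fun i => w i * a i ^ 2) :
    (∑' i, w i * a i) ^ 2 ≤ (1 + ∑' i, w i) ^ 2 * ∑' i, w i * a i ^ 2 := by
  set A := ∑' i, w i
  set S := ∑' i, w i * a i
  set Q := ∑' i, w i * a i ^ 2
  have hA : 0 ≤ A := tsum_nonneg hw
  have hQ : 0 ≤ Q := tsum_nonneg fun i => mul_nonneg (hw i) (sq_nonneg _)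
  have h4 : ∀ s : ℝ, 0 ≤ Q - 2 * s * S + s ^ 2 * A := by
    intro s
    have h5 : HasSum (fun i => w i * (a i - s) ^ 2) (Q - 2 * s * S + s ^ 2 * A) := by
      have := (h3.hasSum.sub (h2.hasSum.mul_left (2 * s))).add (h1.hasSum.mul_left (s ^ 2))
      refine this.congr_fun fun i => ?_
      ring
    exact h5.nonneg fun i => mul_nonneg (hw i) (sq_nonneg _)
  have h5 := h4 (S / (1 + A))
  have hA1 : 0 < 1 + A := by linarith
  have h6 : Q - 2 * (S / (1 + A)) * S + (S / (1 + A)) ^ 2 * A =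
      ((1 + A) ^ 2 * Q - S ^ 2 * (2 + A)) / (1 + A) ^ 2 := by
    field_simp
    ring
  rw [h6] at h5
  have h7 := (div_nonneg_iff.1 h5).resolve_right (fun h => by nlinarith [h.2, pow_pos hA1 2])
  nlinarith [sq_nonneg S, h7.1]

theorem Sobolev.mulSeq {r : ℕ} {u : ℤ → ℂ} (hu : Sobolev r u) {χ : UnitAddCircle → ℂ}
    (hχ : SmoothComplex χ) : Sobolev r (mulSeq χ u) := by
  obtain ⟨C, hC0, hC⟩ := hu.exists_bound
  set w : ℤ → ℝ := fun m => ‖fourierCoeff χ m‖ with hw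
  have hws : Summable w := hχ.rapidDecay.summable_norm
  have s1 : ∀ k, Summable fun m => w m * ‖u (k - m)‖ := fun k =>
    (hws.mul_right C).of_nonneg_of_le (fun m => by positivity) fun m => by gcongr; exact hC _
  have s2 : ∀ k, Summable fun m => w m * ‖u (k - m)‖ ^ 2 := fun k =>
    (hws.mul_right (C ^ 2)).of_nonneg_of_le (fun m => by positivity) fun m => by gcongr; exact hC _
  set B : ℤ × ℤ → ℝ := fun p =>
    (w p.1 * (1 + |(p.1 : ℝ)|) ^ r) * (‖u p.2‖ ^ 2 * (1 + |(p.2 : ℝ)|) ^ r) with hB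
  have hBs : Summable B :=
    (hχ.rapidDecay.summable r).mul_of_nonneg hu (fun _ => by positivity) (fun _ => by positivity)
  have hBs' : Summable fun p : ℤ × ℤ => B (shear p) := (Equiv.summable_iff shear).2 hBs
  refine ((hBs'.prod).mul_left ((1 + ∑' m, w m) ^ 2)).of_nonneg_of_le (fun k => by positivity)
    fun k => ?_
  have h1 : ‖FreeNet.mulSeq χ u k‖ ≤ ∑' m, w m * ‖u (k - m)‖ := by
    refine tsum_of_norm_bounded (s1 k).hasSum fun m => ?_
    rw [norm_mul]
  calc _ ≤ (∑' m, w m * ‖u (k - m)‖) ^ 2 * (1 + |(k : ℝ)|) ^ r := by gcongr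
    _ ≤ ((1 + ∑' m, w m) ^ 2 * ∑' m, w m * ‖u (k - m)‖ ^ 2) * (1 + |(k : ℝ)|) ^ r := by
        gcongr
        exact sq_tsum_mul_le (fun _ => norm_nonneg _) hws (s1 k) (s2 k)
    _ = (1 + ∑' m, w m) ^ 2 * ∑' m, (w m * ‖u (k - m)‖ ^ 2) * (1 + |(k : ℝ)|) ^ r := by
        rw [mul_assoc, tsum_mul_right]
    _ ≤ (1 + ∑' m, w m) ^ 2 * ∑' m, B (shear (k, m)) := by
        refine mul_le_mul_of_nonneg_left ?_ (by positivity)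
        refine ((s2 k).mul_right _).tsum_le_tsum (fun m => ?_) (hBs'.prod_factor k)
        simp only [hB, shear, Equiv.coe_fn_mk]
        have h2 : 1 + |(k : ℝ)| ≤ (1 + |(m : ℝ)|) * (1 + |((k - m : ℤ) : ℝ)|) := by
          push_cast
          have h3 : |(k : ℝ)| ≤ |(m : ℝ)| + |(k : ℝ) - m| := by
            calc |(k : ℝ)| = |(m : ℝ) + (k - m)| := by congr 1; ring
              _ ≤ _ := abs_add_le _ _
          nlinarith [mul_nonneg (abs_nonneg (m : ℝ)) (abs_nonneg ((k : ℝ) - m))]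
        calc _ ≤ w m * ‖u (k - m)‖ ^ 2 * ((1 + |(m : ℝ)|) * (1 + |((k - m : ℤ) : ℝ)|)) ^ r := by
              gcongr
          _ = _ := by rw [mul_pow]; ring

theorem Sobolev.hasSum_mulSeq {r : ℕ} {u : ℤ → ℂ} (hu : Sobolev r u) {χ φ : UnitAddCircle → ℂ}
    (hχ : SmoothComplex χ) (hφ : SmoothComplex φ) {s : ℂ}
    (h1 : HasSum (fun k => u k * fourierCoeff (fun x => χ x * φ x) (-k)) s) :
    HasSum (fun k => FreeNet.mulSeq χ u k * fourierCoeff φ (-k)) s := by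
  obtain ⟨C, hC0, hC⟩ := hu.exists_bound
  set H : ℤ × ℤ → ℂ := fun p => fourierCoeff χ p.1 * u p.2 * fourierCoeff φ (-(p.1 + p.2)) with hH
  have hHs : Summable H := by
    have h2 : Summable fun p : ℤ × ℤ => C * (‖fourierCoeff χ p.1‖ * ‖fourierCoeff φ p.2‖) :=
      (hχ.rapidDecay.summable_norm.mul_of_nonneg hφ.rapidDecay.summable_norm
        (fun _ => norm_nonneg _) (fun _ => norm_nonneg _)).mul_left C
    have e : Function.Injective fun p : ℤ × ℤ => (p.1, -(p.1 + p.2)) := by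
      rintro ⟨a, b⟩ ⟨c, d⟩ h
      simp only [Prod.mk.injEq] at h ⊢
      omega
    refine (h2.comp_injective e).of_norm_bounded fun p => ?_
    simp only [hH, norm_mul, Function.comp_apply]
    calc _ ≤ ‖fourierCoeff χ p.1‖ * C * ‖fourierCoeff φ (-(p.1 + p.2))‖ := by
          gcongr; exact hC _
      _ = _ := by ring
  have hsum : ∑' p, H p = s := by
    have h3 : HasSum (fun p : ℤ × ℤ => H p.swap) (∑' p, H p) :=
      (Equiv.prodComm ℤ ℤ).hasSum_iff.2 hHs.hasSum
    refine (h3.prod_fiberwise fun l => ?_).unique h1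
    have h4 := (hχ.hasSum_fourierCoeff_mul hφ.continuous (-l)).mul_left (u l)
    refine h4.congr_fun fun m => ?_
    simp only [hH, Prod.swap_prod_mk]
    rw [show -(m + l) = -l - m by ring]
    ring
  have h5 : HasSum (fun p : ℤ × ℤ => H (shear p)) s := by
    rw [← hsum]
    exact shear.hasSum_iff.2 hHs.hasSum
  refine h5.prod_fiberwise fun k => ?_
  have h6 : Summable fun m => fourierCoeff χ m * u (k - m) := by
    refine (hχ.rapidDecay.summable_norm.mul_right C).of_norm_bounded fun m => ?_
    rw [norm_mul]
    gcongr
    exact hC _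
  refine (h6.hasSum.mul_right _).congr_fun fun m => ?_
  simp only [hH, shear, Equiv.coe_fn_mk]
  rw [show m + (k - m) = k by ring]

theorem tsupport_mul_subset_inter (χ φ : UnitAddCircle → ℂ) :
    tsupport (fun x => χ x * φ x) ⊆ tsupport χ ∩ tsupport φ :=
  Set.subset_inter (closure_mono fun x hx h => hx (by simp [h]))
    (closure_mono fun x hx h => hx (by simp [h]))

theorem VanishesOn.mulSeq {r : ℕ} {u : ℤ → ℂ} {J O : Set UnitAddCircle} (hv : VanishesOn u J)
    (hu : Sobolev r u) {χ : UnitAddCircle → ℂ} (hχ : SmoothComplex χ) (hO : tsupport χ ∩ O ⊆ J) :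
    VanishesOn (mulSeq χ u) O := fun φ hφ hs =>
  hu.hasSum_mulSeq hχ hφ (hv _ (hχ.mul hφ) ((tsupport_mul_subset_inter χ φ).trans
    ((Set.inter_subset_inter_right _ hs).trans hO)))

theorem VanishesOn.sub_mulSeq {r : ℕ} {u : ℤ → ℂ} {J O : Set UnitAddCircle} (hv : VanishesOn u J)
    (hu : Sobolev r u) {χ : UnitAddCircle → ℂ} (hχ : SmoothComplex χ)
    (hO : tsupport (fun x => 1 - χ x) ∩ O ⊆ J) :
    VanishesOn (fun k => u k - FreeNet.mulSeq χ u k) O := by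
  intro φ hφ hs
  have h1 := hv _ ((hχ.const_sub 1).mul hφ)
    ((tsupport_mul_subset_inter (fun x => 1 - χ x) φ).trans
      ((Set.inter_subset_inter_right _ hs).trans hO))
  have h2 := (hu.summable_pairing hφ).hasSum
  have h3 : HasSum (fun k => u k * fourierCoeff (fun x => χ x * φ x) (-k))
      (∑' k, u k * fourierCoeff φ (-k)) := by
    have h4 := h2.sub h1
    rw [sub_zero] at h4
    refine h4.congr_fun fun k => ?_
    have h5 : fourierCoeff φ (-k) = fourierCoeff (fun x => χ x * φ x) (-k) +
        fourierCoeff (fun x => (1 - χ x) * φ x) (-k) := by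
      rw [← fourierCoeff_add' (hχ.mul hφ).continuous ((hχ.const_sub 1).mul hφ).continuous]
      congr 1
      funext x
      ring
    rw [h5]
    ring
  have h6 := h2.sub (hu.hasSum_mulSeq hχ hφ h3)
  rw [sub_self] at h6
  exact h6.congr_fun fun k => sub_mul _ _ _

end Mollify

section Cyclicity

open MeasureTheory AddCircle Filter Topology
open scoped Pointwise

theorem diffContOnCl_powerSeries {b : ℕ → ℂ} (hb : Summable fun k => ‖b k‖) :
    DiffContOnCl ℂ (fun z : ℂ => ∑' k, b k * z ^ k) (Metric.ball 0 1) := by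
  have hle : ∀ k, ∀ z ∈ Metric.closedBall (0 : ℂ) 1, ‖b k * z ^ k‖ ≤ ‖b k‖ := by
    intro k z hz
    rw [norm_mul, norm_pow]
    exact mul_le_of_le_one_right (norm_nonneg _)
      (pow_le_one₀ (norm_nonneg _) (mem_closedBall_zero_iff.1 hz))
  refine ⟨?_, ?_⟩
  · exact Complex.differentiableOn_tsum_of_summable_norm hb (fun k => by fun_prop) Metric.isOpen_ball
      fun k z hz => hle k z (Metric.ball_subset_closedBall hz)
  · rw [closure_ball _ one_ne_zero]
    exact continuousOn_tsum (fun k => by fun_prop) hb hle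

theorem exists_fourier_one_eq {z : ℂ} (hz : ‖z‖ = 1) : ∃ x : UnitAddCircle, fourier 1 x = z := by
  obtain ⟨θ, rfl⟩ := (Complex.norm_eq_one_iff z).1 hz
  refine ⟨((θ / (2 * Real.pi) : ℝ) : UnitAddCircle), ?_⟩
  rw [fourier_coe_apply]
  congr 1
  push_cast
  field_simp

theorem fourier_one_pow (k : ℕ) (x : UnitAddCircle) : (fourier 1 x : ℂ) ^ k = fourier (k : ℤ) x := by
  induction k with
  | zero => simp
  | succ k ih => rw [pow_succ, ih, Nat.cast_succ, fourier_add]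

/-- An absolutely convergent power series whose boundary values vanish on an arc vanishes. -/
theorem eq_zero_of_boundary_eq_zero {a : ℕ → ℂ} (ha : Summable fun k => ‖a k‖)
    {U : Set UnitAddCircle} (hU : IsOpen U) (hne : U.Nonempty)
    (h : ∀ x ∈ U, ∑' k, a k * fourier (k : ℤ) x = 0) : a = 0 := by
  classical
  by_contra hne0
  have hex : ∃ m, a m ≠ 0 := by
    by_contra! hall
    exact hne0 (funext hall)
  set m := Nat.find hex with hm
  have hm0 : a m ≠ 0 := Nat.find_spec hex
  have hlt : ∀ j < m, a j = 0 := fun j hj => not_not.1 (Nat.find_min hex hj)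
  set b : ℕ → ℂ := fun k => a (k + m) with hb
  have hbs : Summable fun k => ‖b k‖ := (summable_nat_add_iff m).2 ha
  have h' : ∀ x ∈ U, ∑' k, b k * (fourier 1 x : ℂ) ^ k = 0 := by
    intro x hx
    have hs : Summable fun k => a k * fourier (k : ℤ) x := by
      refine ha.of_norm_bounded fun k => ?_
      rw [norm_mul, fourier_apply, Circle.norm_coe, mul_one]
    have h1 := hs.sum_add_tsum_nat_add m
    rw [h x hx, Finset.sum_eq_zero fun j hj => by rw [hlt j (Finset.mem_range.1 hj), zero_mul],
      zero_add] at h1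
    have h2 : ∀ k, a (k + m) * fourier ((k + m : ℕ) : ℤ) x =
        (b k * (fourier 1 x : ℂ) ^ k) * fourier (m : ℤ) x := by
      intro k
      rw [Nat.cast_add, fourier_add, fourier_one_pow]
      ring
    simp only [h2, tsum_mul_right] at h1
    refine (mul_eq_zero.1 h1).resolve_right ?_
    rw [fourier_apply]
    exact Circle.coe_ne_zero _
  obtain ⟨T, hT⟩ := isCompact_univ.elim_finite_subcover (fun t : UnitAddCircle => {x | x + t ∈ U})
    (fun t => hU.preimage (by fun_prop)) (by
      intro x _
      obtain ⟨y, hy⟩ := hne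
      exact Set.mem_iUnion.2 ⟨y - x, by simpa using hy⟩)
  set G : UnitAddCircle → ℂ → ℂ := fun t z => ∑' k, (b k * (fourier 1 t : ℂ) ^ k) * z ^ k with hG
  have hGd : ∀ t, DiffContOnCl ℂ (G t) (Metric.ball 0 1) := fun t =>
    diffContOnCl_powerSeries (hbs.congr fun k => by
      rw [norm_mul, norm_pow, fourier_apply, Circle.norm_coe, one_pow, mul_one])
  have hP : DiffContOnCl ℂ (fun z => ∏ t ∈ T, G t z) (Metric.ball 0 1) :=
    ⟨DifferentiableOn.fun_finsetProd fun t _ => (hGd t).differentiableOn,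
      continuousOn_finsetProd _ fun t _ => (hGd t).continuousOn⟩
  have hP0 : Set.EqOn (fun z => ∏ t ∈ T, G t z) (fun _ => 0) (frontier (Metric.ball (0 : ℂ) 1)) := by
    rw [frontier_ball _ one_ne_zero]
    intro z hz
    obtain ⟨x, rfl⟩ := exists_fourier_one_eq (mem_sphere_zero_iff_norm.1 hz)
    obtain ⟨t, ht, hxt⟩ := Set.mem_iUnion₂.1 (hT (Set.mem_univ x))
    refine Finset.prod_eq_zero ht ?_
    rw [← h' (x + t) hxt]
    refine tsum_congr fun k => ?_
    have : (fourier 1 (x + t) : ℂ) = fourier 1 x * fourier 1 t := by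
      simp [toCircle_add]
    rw [this, mul_pow]
    ring
  have h0 := Complex.eqOn_of_eqOn_frontier Metric.isBounded_ball hP diffContOnCl_const hP0
    (Metric.mem_ball_self one_pos)
  obtain ⟨t, -, ht⟩ := Finset.prod_eq_zero_iff.1 h0
  have h1 : G t 0 = a m := by
    simp only [hG]
    rw [tsum_eq_single 0 (fun k hk => by simp [hk])]
    simp [hb]
  exact hm0 (h1 ▸ ht)

variable {n : ℕ}

theorem field_mem_localSubspace (hn : 1 ≤ n) {I : Set UnitAddCircle} {f : UnitAddCircle → ℝ}
    (hf : SmoothReal f) (hs : tsupport f ⊆ I) : field n hn f hf ∈ localSubspace n hn I :=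
  subset_closure (Submodule.subset_span ⟨f, hf, hs, rfl⟩)

/-- The local subspaces are cyclic. -/
theorem eq_zero_of_orthogonal_local (hn : 1 ≤ n) {I O : Set UnitAddCircle} (hO : IsOpen O)
    (hne : O.Nonempty) (hOI : O ⊆ I) {v : OneParticle n}
    (hv : ∀ h ∈ localSubspace n hn I, ⟪h, v⟫ = 0) : v = 0 := by
  obtain ⟨x₀, hx₀⟩ := hne
  ext k₀
  set O' : Set UnitAddCircle :=
    O ∩ {x | 0 < ((fourier ((k₀ : ℕ) : ℤ) x : ℂ) * star (fourier ((k₀ : ℕ) : ℤ) x₀ : ℂ)).re} with hO'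
  have hO'o : IsOpen O' := hO.inter (isOpen_lt continuous_const (by fun_prop))
  have hx₀' : x₀ ∈ O' := by
    refine ⟨hx₀, ?_⟩
    have : (fourier ((k₀ : ℕ) : ℤ) x₀ : ℂ) * star (fourier ((k₀ : ℕ) : ℤ) x₀ : ℂ) = 1 := by
      rw [← starRingEnd_apply, ← fourier_neg, ← fourier_add]; simp
    simp only [Set.mem_ofPred_eq, this, Complex.one_re, zero_lt_one]
  obtain ⟨f, hf, hf0, hf1, hfs⟩ := exists_smooth_bump hO'o hx₀'
  have hcoef : fourierCoeff (fun x => (f x : ℂ)) (-((k₀ : ℕ) : ℤ)) ≠ 0 := by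
    set c := star (fourier ((k₀ : ℕ) : ℤ) x₀ : ℂ) with hc
    have h1 : (c * fourierCoeff (fun x => (f x : ℂ)) (-((k₀ : ℕ) : ℤ))).re =
        ∫ x, f x * ((fourier ((k₀ : ℕ) : ℤ) x : ℂ) * c).re ∂haarAddCircle := by
      rw [fourierCoeff_def, ← integral_const_mul, neg_neg]
      have hint : Integrable (fun x => c * (fourier ((k₀ : ℕ) : ℤ) x * (f x : ℂ))) haarAddCircle :=
        (integrable_fourier_mul hf.ofReal.continuous _).const_mul c
      have h2 := integral_re hint
      refine Eq.trans h2.symm ?_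
      congr 1
      funext x
      change (c * (fourier ((k₀ : ℕ) : ℤ) x * (f x : ℂ))).re = _
      rw [← mul_assoc, mul_comm c, mul_comm _ (f x : ℂ), Complex.re_ofReal_mul]
    have h3 : 0 < ∫ x, f x * ((fourier ((k₀ : ℕ) : ℤ) x : ℂ) * c).re ∂haarAddCircle := by
      refine integral_pos_of_bump (x₀ := x₀) (hf.continuous.mul (by fun_prop)) (fun x => ?_) ?_
      · by_cases hx : x ∈ tsupport f
        · exact mul_nonneg (hf0 x) (hfs hx).2.le
        · rw [image_eq_zero_of_notMem_tsupport hx, zero_mul]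
      · rw [hf1.self_of_nhds, one_mul]
        exact hx₀'.2.ne'
    intro h0
    rw [h0, mul_zero, Complex.zero_re] at h1
    exact h3.ne h1
  set a : ℕ → ℂ := fun j => if h : n ≤ j then ⟪v ⟨j, h⟩, field n hn f hf ⟨j, h⟩⟫ else 0 with ha
  have hval : ∀ k : Mode n, a k = ⟪v k, field n hn f hf k⟫ := fun k => dif_pos k.2
  have hzero : ∀ j ∉ Set.range (Subtype.val : Mode n → ℕ), a j = 0 := by
    intro j hj
    refine dif_neg fun h => hj ⟨⟨j, h⟩, rfl⟩
  have has : Summable fun k => ‖a k‖ := by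
    refine (Subtype.val_injective.summable_iff (f := fun k => ‖a k‖) fun j hj => by
      rw [hzero j hj, norm_zero]).1 ?_
    refine (lp.summable_inner (𝕜 := ℂ) v (field n hn f hf)).norm.congr fun k => ?_
    simp [hval]
  obtain ⟨W, hW, hWK⟩ := compact_open_separated_add_left (isClosed_tsupport f).isCompact hO
    (hfs.trans Set.inter_subset_left)
  have hvan : ∀ y ∈ interior W, ∑' k, a k * fourier (k : ℤ) y = 0 := by
    intro y hy
    have hts : tsupport (fun x => f (x - y)) ⊆ I := by
      have h1 : tsupport (fun x => f (x - y)) ⊆ {x | x - y ∈ tsupport f} :=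
        closure_minimal (fun x hx => subset_tsupport _ hx)
          ((isClosed_tsupport f).preimage (by fun_prop))
      intro x hx
      have h2 : x = y + (x - y) := by abel
      rw [h2]
      exact hOI (hWK (Set.add_mem_add (interior_subset hy) (h1 hx)))
    have h1 := hv _ (field_mem_localSubspace hn (hf.comp_sub y) hts)
    have h2 : ⟪v, field n hn _ (hf.comp_sub y)⟫ = 0 := by
      rw [← inner_conj_symm, h1, map_zero]
    have h3 := lp.hasSum_inner (𝕜 := ℂ) v (field n hn _ (hf.comp_sub y))
    rw [h2] at h3
    have h4 : HasSum (fun k : ℕ => a k * fourier (k : ℤ) y) 0 := by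
      refine (Subtype.val_injective.hasSum_iff fun j hj => by rw [hzero j hj, zero_mul]).1 ?_
      refine h3.congr_fun fun k => ?_
      rw [Function.comp_apply, hval, RCLike.inner_apply, RCLike.inner_apply, field_apply,
        field_apply, fourierCoeff_sub_comp (fun x => (f x : ℂ)), neg_neg]
      ring
    exact h4.tsum_eq
  have h5 := congrFun (eq_zero_of_boundary_eq_zero has isOpen_interior
    ⟨0, mem_interior_iff_mem_nhds.2 hW⟩ hvan) (k₀ : ℕ)
  rw [hval, RCLike.inner_apply, field_apply, Pi.zero_apply, mul_eq_zero, mul_eq_zero] at h5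
  have h6 : (starRingEnd ℂ) (v k₀) = 0 := by
    rcases h5 with (h5 | h5) | h5
    · exact absurd h5 (sqrt_weight_ne_zero hn k₀)
    · exact absurd h5 hcoef
    · exact h5
  simpa using h6

end Cyclicity

section Duality

open MeasureTheory AddCircle Filter Topology

variable {n : ℕ}

/-- The Fourier coefficients, of both signs, of a real distribution with a given class. -/
noncomputable def coeffSeq (v : OneParticle n) (m : ℤ) : ℂ :=
  if h : n ≤ m.natAbs then
    if 0 ≤ m then star (v ⟨m.natAbs, h⟩ / Real.sqrt (weight n m.natAbs))
    else v ⟨m.natAbs, h⟩ / Real.sqrt (weight n m.natAbs)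
  else 0

theorem coeffSeq_natCast (v : OneParticle n) (k : Mode n) :
    coeffSeq v ((k : ℕ) : ℤ) = star (v k / Real.sqrt (weight n k)) := by
  rw [coeffSeq, dif_pos (by simpa using k.2), if_pos (Int.natCast_nonneg _)]
  simp only [Int.natAbs_natCast, Subtype.coe_eta]

theorem coeffSeq_neg_natCast (hn : 1 ≤ n) (v : OneParticle n) (k : Mode n) :
    coeffSeq v (-((k : ℕ) : ℤ)) = v k / Real.sqrt (weight n k) := by
  have hk := k.2
  rw [coeffSeq, dif_pos (by simpa using k.2), if_neg (by omega)]
  simp only [Int.natAbs_neg, Int.natAbs_natCast, Subtype.coe_eta]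

theorem sobolev_coeffSeq (hn : 1 ≤ n) (v : OneParticle n) : Sobolev (2 * n - 1) (coeffSeq v) := by
  obtain ⟨C, hC⟩ := exists_pow_le_weight hn
  have hs : Summable fun k : ℕ => if h : n ≤ k then C * ‖v ⟨k, h⟩‖ ^ 2 else 0 := by
    refine (Subtype.val_injective (p := fun k : ℕ => n ≤ k)).summable_iff (fun j hj => ?_) |>.1 ?_
    · exact dif_neg fun h => hj ⟨⟨j, h⟩, rfl⟩
    · refine ((summable_sq v).mul_left C).congr fun k => ?_
      simp only [Function.comp_apply, dif_pos k.2]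
  have key : ∀ m : ℤ, ‖coeffSeq v m‖ ^ 2 * (1 + |(m : ℝ)|) ^ (2 * n - 1) ≤
      (if h : n ≤ m.natAbs then C * ‖v ⟨m.natAbs, h⟩‖ ^ 2 else 0) := by
    intro m
    by_cases h : n ≤ m.natAbs
    · have h1 : ‖coeffSeq v m‖ ^ 2 = ‖v ⟨m.natAbs, h⟩‖ ^ 2 / weight n m.natAbs := by
        have hw := weight_pos hn h
        have : ‖v ⟨m.natAbs, h⟩ / (Real.sqrt (weight n m.natAbs) : ℂ)‖ ^ 2 =
            ‖v ⟨m.natAbs, h⟩‖ ^ 2 / weight n m.natAbs := by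
          rw [norm_div, div_pow, Complex.norm_real, Real.norm_eq_abs, sq_abs, Real.sq_sqrt hw.le]
        rw [coeffSeq, dif_pos h]
        split_ifs
        · rw [norm_star, this]
        · exact this
      have h2 : |(m : ℝ)| = (m.natAbs : ℝ) := by
        rw [← Int.cast_abs, Int.abs_eq_natAbs]; simp
      rw [h1, h2, dif_pos h, div_mul_eq_mul_div, div_le_iff₀ (weight_pos hn h)]
      have := hC m.natAbs h
      calc _ ≤ ‖v ⟨m.natAbs, h⟩‖ ^ 2 * (C * weight n m.natAbs) := by gcongr
        _ = _ := by ring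
    · rw [coeffSeq, dif_neg h, dif_neg h]; simp
  refine Summable.of_nonneg_of_le (fun k => by positivity) key (Summable.of_nat_of_neg ?_ ?_)
  · simpa using hs
  · simpa using hs

/-- The test functions supported in `J`. -/
def testSpace (J : Set UnitAddCircle) : Submodule ℂ (UnitAddCircle → ℂ) where
  carrier := {φ | SmoothComplex φ ∧ tsupport φ ⊆ J}
  add_mem' := by
    rintro φ ψ ⟨h1, h2⟩ ⟨h3, h4⟩
    exact ⟨h1.add h3, (tsupport_add φ ψ).trans (Set.union_subset h2 h4)⟩
  zero_mem' := ⟨contDiff_const, by simp [tsupport]⟩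
  smul_mem' := by
    rintro c φ ⟨h1, h2⟩
    exact ⟨h1.const_mul c, (closure_mono fun x hx h => hx (by simp [h]) :
      tsupport (c • φ) ⊆ tsupport φ).trans h2⟩

/-- The pairing of the distribution with the Fourier coefficients `u` with test functions. -/
noncomputable def pairing {r : ℕ} {u : ℤ → ℂ} (hu : Sobolev r u) (J : Set UnitAddCircle) :
    testSpace J →ₗ[ℂ] ℂ where
  toFun φ := ∑' k, u k * fourierCoeff φ.1 (-k)
  map_add' φ ψ := by
    rw [← (hu.summable_pairing φ.2.1).tsum_add (hu.summable_pairing ψ.2.1)]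
    refine tsum_congr fun k => ?_
    rw [← mul_add, ← fourierCoeff_add' φ.2.1.continuous ψ.2.1.continuous]
    rfl
  map_smul' c φ := by
    rw [RingHom.id_apply, smul_eq_mul, ← tsum_mul_left]
    refine tsum_congr fun k => ?_
    rw [mul_left_comm, ← fourierCoeff_const_mul φ.1 c (-k)]
    rfl

theorem hasSum_symplectic_complex (hn : 1 ≤ n) {v : OneParticle n} {J : Set UnitAddCircle}
    (hv : ∀ (f : UnitAddCircle → ℝ) (hf : SmoothReal f), tsupport f ⊆ J →
      (⟪v, field n hn f hf⟫).im = 0) {g : UnitAddCircle → ℂ} (hg : SmoothComplex g)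
    (hs : tsupport g ⊆ J) :
    HasSum (fun k : ℤ => symbol n k * coeffSeq v k * fourierCoeff g (-k)) 0 := by
  have h1 : ∀ (f : UnitAddCircle → ℝ), SmoothReal f → tsupport f ⊆ J →
      HasSum (fun k : ℤ => symbol n k * coeffSeq v k * fourierCoeff (fun x => (f x : ℂ)) (-k)) 0 := by
    intro f hf hfs
    have := hasSum_symplectic hn (v := v) (u := coeffSeq v) (fun k => by
      rw [coeffSeq_neg_natCast hn, mul_div_cancel₀ _ (sqrt_weight_ne_zero hn k)])
      (fun k => by rw [coeffSeq_natCast, coeffSeq_neg_natCast hn]) hf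
    rw [hv f hf hfs] at this
    simpa using this
  have h2 := h1 _ hg.re ((closure_mono fun x hx h => hx (by simp [h]) :
    tsupport (fun x => (g x).re) ⊆ tsupport g).trans hs)
  have h3 := h1 _ hg.im ((closure_mono fun x hx h => hx (by simp [h]) :
    tsupport (fun x => (g x).im) ⊆ tsupport g).trans hs)
  have h4 := h2.add (h3.mul_left Complex.I)
  rw [mul_zero, add_zero] at h4
  refine h4.congr_fun fun k => ?_
  have h5 : g = fun x => ((g x).re : ℂ) + Complex.I * ((g x).im : ℂ) := by
    funext x
    rw [mul_comm, Complex.re_add_im]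
  conv_lhs => rw [h5]
  rw [fourierCoeff_add' hg.re.ofReal.continuous (hg.im.ofReal.const_mul _).continuous,
    fourierCoeff_const_mul]
  ring

/-- A class which is symplectically orthogonal to the functions supported in an arc is represented
by a distribution vanishing on the arc. -/
theorem exists_vanishesOn (hn : 1 ≤ n) {v : OneParticle n} {a b : ℝ} (hb : b ≤ a + 1)
    (hv : ∀ (f : UnitAddCircle → ℝ) (hf : SmoothReal f), tsupport f ⊆ arc a b →
      (⟪v, field n hn f hf⟫).im = 0) :
    ∃ (u : ℤ → ℂ) (hu : Sobolev (2 * n - 1) u), VanishesOn u (arc a b) ∧ realVec hn u hu = v := by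
  classical
  have hV := sobolev_coeffSeq hn v
  set F := Finset.Ioo (-(n : ℤ)) n with hF
  let L : F → testSpace (arc a b) →ₗ[ℂ] ℂ := fun j =>
    { toFun := fun φ => fourierCoeff φ.1 (-(j : ℤ))
      map_add' := fun φ ψ => fourierCoeff_add' φ.2.1.continuous ψ.2.1.continuous _
      map_smul' := fun c φ => fourierCoeff_const_mul _ _ _ }
  have hker : ⨅ j, (L j).ker ≤ (pairing hV (arc a b)).ker := by
    intro φ hφ
    rw [Submodule.mem_iInf] at hφ
    have h0 : ∀ j ∈ F, fourierCoeff φ.1 j = 0 := by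
      intro j hj
      have hj' : -j ∈ F := by
        simp only [hF, Finset.mem_Ioo] at hj ⊢; omega
      have := LinearMap.mem_ker.1 (hφ ⟨-j, hj'⟩)
      simpa [L] using this
    obtain ⟨g, hg, hgs, hgc⟩ := φ.2.1.exists_prod_primitive hb φ.2.2 F h0
    have h1 := (hasSum_symplectic_complex hn hv hg hgs).neg
    rw [neg_zero] at h1
    rw [LinearMap.mem_ker]
    refine (h1.congr_fun fun k => ?_).tsum_eq
    have h2 : symbol n (-k) = ∏ j ∈ F, (((-k : ℤ) : ℂ) - j) := rfl
    rw [← hgc, ← h2, symbol_neg n hn]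
    ring
  have hspan := mem_span_of_iInf_ker_le_ker hker
  obtain ⟨c, hc⟩ := (Submodule.mem_span_range_iff_exists_fun ℂ).1 hspan
  set t : ℤ → ℂ := fun k => if h : k ∈ F then c ⟨k, h⟩ else 0 with ht
  have ht0 : ∀ k ∉ F, t k = 0 := fun k hk => dif_neg hk
  have hts : Sobolev (2 * n - 1) t := summable_of_ne_finset_zero (s := F) fun k hk => by
    rw [ht0 k hk]; simp
  refine ⟨fun k => coeffSeq v k - t k, hV.sub hts, fun φ hφ hs => ?_, ?_⟩
  · have h1 := (hV.summable_pairing hφ).hasSum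
    have h2 : HasSum (fun k => t k * fourierCoeff φ (-k)) (∑ k ∈ F, t k * fourierCoeff φ (-k)) :=
      hasSum_sum_of_ne_finset_zero fun k hk => by rw [ht0 k hk, zero_mul]
    have h3 : ∑' k, coeffSeq v k * fourierCoeff φ (-k) = ∑ k ∈ F, t k * fourierCoeff φ (-k) := by
      have h4 := congrArg (fun l => l ⟨φ, hφ, hs⟩) hc
      simp only [LinearMap.sum_apply, LinearMap.smul_apply] at h4
      refine Eq.trans h4.symm ?_
      rw [← Finset.sum_coe_sort F]
      refine Finset.sum_congr rfl fun j _ => ?_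
      have : t j = c j := dif_pos j.2
      rw [this]
      rfl
    have h5 := h1.sub h2
    rw [h3, sub_self] at h5
    exact h5.congr_fun fun k => sub_mul _ _ _
  · ext k
    have hk := k.2
    have e1 : t ((k : ℕ) : ℤ) = 0 := ht0 _ (by simp only [hF, Finset.mem_Ioo]; omega)
    have e2 : t (-((k : ℕ) : ℤ)) = 0 := ht0 _ (by simp only [hF, Finset.mem_Ioo]; omega)
    rw [realVec_apply, e1, e2, sub_zero, sub_zero, coeffSeq_natCast, coeffSeq_neg_natCast hn,
      star_star, add_self_div_two, mul_div_cancel₀ _ (sqrt_weight_ne_zero hn k)]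

theorem eventually_arc_subset {δ : ℝ} {U : Set UnitAddCircle} (hU : U ∈ 𝓝 (0 : UnitAddCircle)) :
    ∀ᶠ N : ℕ in atTop, arc (-(δ / (N + 1))) (δ / (N + 1)) ⊆ U := by
  have h1 : (fun t : ℝ => (t : UnitAddCircle)) ⁻¹' U ∈ 𝓝 (0 : ℝ) :=
    continuous_coe.continuousAt (by simpa using hU)
  obtain ⟨ε, hε, hball⟩ := Metric.mem_nhds_iff.1 h1
  have h2 : Tendsto (fun N : ℕ => δ / ((N : ℝ) + 1)) atTop (𝓝 0) := by
    have := tendsto_one_div_add_atTop_nhds_zero_nat.const_mul δ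
    simpa [div_eq_mul_inv] using this
  filter_upwards [h2.eventually (gt_mem_nhds hε)] with N hN
  rintro _ ⟨t, ht, rfl⟩
  refine hball ?_
  rw [mem_ball_zero_iff, Real.norm_eq_abs, abs_lt]
  constructor <;> linarith [ht.1, ht.2]

theorem exists_coe_Icc_of_notMem {a b : ℝ} {x : UnitAddCircle} (hx : x ∉ arc b (a + 1)) :
    ∃ t, a ≤ t ∧ t ≤ b ∧ (t : UnitAddCircle) = x := by
  obtain ⟨t, ht, rfl⟩ := exists_coe_Ico a x
  exact ⟨t, ht.1, not_lt.1 fun h => hx ⟨t, ⟨h, ht.2⟩, rfl⟩, rfl⟩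

theorem add_mem_localSubspace (hn : 1 ≤ n) {I : Set UnitAddCircle} {v w : OneParticle n}
    (hv : v ∈ localSubspace n hn I) (hw : w ∈ localSubspace n hn I) :
    v + w ∈ localSubspace n hn I :=
  (isRealSubspace_coe (localSubspace n hn I)).add_mem hv hw

/-- A class represented by a distribution supported in the closure of an arc belongs to the local
subspace of the arc. -/
theorem realVec_mem_localSubspace (hn : 1 ≤ n) {u : ℤ → ℂ} (hu : Sobolev (2 * n - 1) u) {a b : ℝ}
    (hab : a < b) (hb : b < a + 1) (hv : VanishesOn u (arc b (a + 1))) {I : Set UnitAddCircle}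
    (hI : arc a b ⊆ I) : realVec hn u hu ∈ localSubspace n hn I := by
  set η := min (b - a) (a + 1 - b) / 2 with hη
  have hη0 : 0 < η := half_pos (lt_min (by linarith) (by linarith))
  have hη1 : η ≤ (b - a) / 2 := by
    rw [hη]; gcongr; exact min_le_left _ _
  have hη2 : η ≤ (a + 1 - b) / 2 := by
    rw [hη]; gcongr; exact min_le_right _ _
  have ha : (a : UnitAddCircle) ∈ (closedArc (b - η) (b + η))ᶜ := by
    rintro ⟨z, hz, hza⟩
    have := eq_of_coe_eq_coe hza (by rw [abs_lt]; constructor <;> linarith [hz.1, hz.2])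
    linarith [hz.1]
  obtain ⟨f, hf, -, hf1, hfs⟩ := exists_smooth_bump
    (isCompact_closedArc (b - η) (b + η)).isClosed.isOpen_compl ha
  have h1 : ∀ᶠ t : ℝ in 𝓝 a, f t = 1 := continuous_coe.continuousAt.eventually hf1
  obtain ⟨η', hη'0, hη'⟩ := Metric.eventually_nhds_iff.1 h1
  have hχ := hf.ofReal
  have hχs : tsupport (fun x => (f x : ℂ)) ⊆ tsupport f := closure_mono fun x hx h => hx (by simp [h])
  set w := mulSeq (fun x => (f x : ℂ)) u with hw
  have hws : Sobolev (2 * n - 1) w := hu.mulSeq hχ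
  have hsplit : realVec hn u hu = realVec hn w hws + realVec hn (fun k => u k - w k) (hu.sub hws) := by
    ext k
    rw [lp.coeFn_add, Pi.add_apply, realVec_apply, realVec_apply, realVec_apply, star_sub]
    ring
  have hδ : ∀ (δ : ℝ) (N : ℕ), 0 < δ → 0 < δ / ((N : ℝ) + 1) ∧ δ / ((N : ℝ) + 1) ≤ δ := by
    intro δ N hδ
    exact ⟨by positivity, div_le_self hδ.le (by linarith [(Nat.cast_nonneg N : (0 : ℝ) ≤ N)])⟩
  rw [hsplit]
  refine add_mem_localSubspace hn ?_ ?_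
  · refine realVec_mem_of_mollify hn hws (O := arc b (a + 1) ∪ arc (b - η) (b + η))
      ((isOpen_arc _ _).union (isOpen_arc _ _)) (hv.mulSeq hu hχ ?_)
      (fun N : ℕ => arc 0 (η / (N + 1))) (fun N => isOpen_arc _ _) (fun N => ?_) (fun U hU => ?_)
      fun N x hx y hy => hI ?_
    · rintro x ⟨hx1, hx2 | hx2⟩
      · exact hx2
      · exact absurd (Set.image_mono Set.Ioo_subset_Icc_self hx2) (hfs (hχs hx1))
    · exact (Set.nonempty_Ioo.2 (hδ η N hη0).1).image _
    · filter_upwards [eventually_arc_subset (δ := η) hU] with N hN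
      refine (Set.image_mono (Set.Ioo_subset_Ioo_left ?_)).trans hN
      linarith [(hδ η N hη0).1]
    · rw [Set.mem_union, not_or] at hx
      obtain ⟨t, hta, htb, rfl⟩ := exists_coe_Icc_of_notMem hx.1
      obtain ⟨s, hs, rfl⟩ := hy
      have h2 : t ≤ b - η := by
        by_contra! h
        exact hx.2 ⟨t, ⟨h, by linarith⟩, rfl⟩
      have h3 := (hδ η N hη0).2
      exact ⟨t + s, ⟨by linarith [hs.1], by linarith [hs.2]⟩, AddCircle.coe_add _ _ _⟩
  · set δ := min η' (b - a) with hδdef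
    have hδ0 : 0 < δ := lt_min hη'0 (by linarith)
    have hδ1 : δ ≤ η' := min_le_left _ _
    have hδ2 : δ ≤ b - a := min_le_right _ _
    refine realVec_mem_of_mollify hn (hu.sub hws) (O := arc b (a + 1) ∪ arc (a - δ) (a + δ))
      ((isOpen_arc _ _).union (isOpen_arc _ _)) ?_
      (fun N : ℕ => arc (-(δ / (N + 1))) 0) (fun N => isOpen_arc _ _) (fun N => ?_)
      (fun U hU => ?_) fun N x hx y hy => hI ?_
    · refine hv.sub_mulSeq hu hχ fun x hx => ?_
      have hcl : tsupport (fun x => 1 - (f x : ℂ)) ⊆ (arc (a - δ) (a + δ))ᶜ := by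
        refine closure_minimal ?_ (isOpen_arc _ _).isClosed_compl
        rintro _ hx ⟨t, ht, rfl⟩
        refine hx ?_
        have : f (t : UnitAddCircle) = 1 := hη' (by
          rw [Real.dist_eq, abs_lt]; constructor <;> linarith [ht.1, ht.2])
        simp only [this, Complex.ofReal_one, sub_self]
      exact hx.2.resolve_right (hcl hx.1)
    · exact (Set.nonempty_Ioo.2 (by linarith [(hδ δ N hδ0).1])).image _
    · filter_upwards [eventually_arc_subset (δ := δ) hU] with N hN
      refine (Set.image_mono (Set.Ioo_subset_Ioo_right ?_)).trans hN
      linarith [(hδ δ N hδ0).1]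
    · rw [Set.mem_union, not_or] at hx
      obtain ⟨t, hta, htb, rfl⟩ := exists_coe_Icc_of_notMem hx.1
      obtain ⟨s, hs, rfl⟩ := hy
      have h2 : a + δ ≤ t := by
        by_contra! h
        exact hx.2 ⟨t, ⟨by linarith, h⟩, rfl⟩
      have h3 := (hδ δ N hδ0).2
      exact ⟨t + s, ⟨by linarith [hs.1], by linarith [hs.2]⟩, AddCircle.coe_add _ _ _⟩

end Duality

section Main

open Filter Topology

theorem coe_mem_of_between {I : Set UnitAddCircle} (hI : IsPreconnected I) {p : ℝ}
    (hp : (p : UnitAddCircle) ∉ I) {s r t : ℝ} (hps : p < s) (hsr : s < r) (hrt : r < t)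
    (htp : t < p + 1) (hs : (s : UnitAddCircle) ∈ I) (ht : (t : UnitAddCircle) ∈ I) :
    (r : UnitAddCircle) ∈ I := by
  by_contra hr
  have hcover : I ⊆ arc p r ∪ arc r (p + 1) := by
    intro x hx
    obtain ⟨y, hy, rfl⟩ := exists_coe_Ico p x
    have h1 : p ≠ y := by rintro rfl; exact hp hx
    have h2 : r ≠ y := by rintro rfl; exact hr hx
    rcases lt_or_gt_of_ne h2 with h | h
    · exact Or.inr ⟨y, ⟨h, hy.2⟩, rfl⟩
    · exact Or.inl ⟨y, ⟨lt_of_le_of_ne hy.1 h1, h⟩, rfl⟩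
  have hdisj : ∀ x, x ∈ arc p r → x ∉ arc r (p + 1) := by
    rintro _ ⟨y, hy, rfl⟩ ⟨z, hz, hzy⟩
    have := eq_of_coe_eq_coe hzy (by
      rw [abs_lt]; constructor <;> linarith [hy.1, hy.2, hz.1, hz.2])
    linarith [hy.2, hz.1]
  rcases isPreconnected_iff_subset_of_disjoint.1 hI _ _ (isOpen_arc _ _) (isOpen_arc _ _) hcover
    (Set.eq_empty_of_forall_notMem fun x hx => hdisj x hx.2.1 hx.2.2) with h | h
  · exact hdisj _ (h ht) ⟨t, ⟨hrt, htp⟩, rfl⟩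
  · exact hdisj _ ⟨s, ⟨hps, hsr⟩, rfl⟩ (h hs)

/-- Up to its end points, an interval is an arc and its complement is the complementary arc. -/
theorem IsInterval.exists_arc {I : Set UnitAddCircle} (hI : IsInterval I) :
    ∃ a b : ℝ, a < b ∧ b < a + 1 ∧ arc a b ⊆ I ∧ arc b (a + 1) ⊆ Iᶜ := by
  obtain ⟨x, hx⟩ := hI.interior_compl_nonempty
  obtain ⟨p, rfl⟩ := QuotientAddGroup.mk_surjective x
  have hp1 : ∀ᶠ t : ℝ in 𝓝 p, (t : UnitAddCircle) ∈ Iᶜ :=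
    continuous_coe.continuousAt.eventually (mem_interior_iff_mem_nhds.1 hx)
  obtain ⟨δ, hδ, hball⟩ := Metric.eventually_nhds_iff.1 hp1
  have hp : (p : UnitAddCircle) ∉ I := hp1.self_of_nhds
  set S : Set ℝ := {t | (p < t ∧ t < p + 1) ∧ (t : UnitAddCircle) ∈ I} with hS
  have hlow : ∀ t ∈ S, p + δ ≤ t := by
    intro t ht
    by_contra! h
    exact hball (by rw [Real.dist_eq, abs_lt]; constructor <;> linarith [ht.1.1]) ht.2
  have hup : ∀ t ∈ S, t ≤ p + 1 - δ := by
    intro t ht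
    by_contra! h
    have h1 : ((t - 1 : ℝ) : UnitAddCircle) = t := by
      rw [AddCircle.coe_sub, AddCircle.coe_period, sub_zero]
    have := hball (y := t - 1)
      (by rw [Real.dist_eq, abs_lt]; constructor <;> linarith [ht.1.2])
    rw [h1] at this
    exact this ht.2
  obtain ⟨q, hq, q', hq', hqq⟩ : ∃ q ∈ S, ∃ q' ∈ S, q < q' := by
    obtain ⟨y, hy⟩ := hI.interior_nonempty
    obtain ⟨q, hq, rfl⟩ := exists_coe_Ico p y
    have h1 : ∀ᶠ t : ℝ in 𝓝 q, (t : UnitAddCircle) ∈ I :=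
      continuous_coe.continuousAt.eventually (mem_interior_iff_mem_nhds.1 hy)
    have hqI : (q : UnitAddCircle) ∈ I := h1.self_of_nhds
    have hpq : p < q := lt_of_le_of_ne hq.1 (by rintro rfl; exact hp hqI)
    have h2 : ∀ᶠ t : ℝ in 𝓝[>] q, (t : UnitAddCircle) ∈ I ∧ t < p + 1 :=
      (h1.and (gt_mem_nhds hq.2)).filter_mono nhdsWithin_le_nhds
    obtain ⟨q', hq', hlt⟩ := (h2.and self_mem_nhdsWithin).exists
    exact ⟨q, ⟨⟨hpq, hq.2⟩, hqI⟩, q', ⟨⟨hpq.trans hlt, hq'.2⟩, hq'.1⟩, hlt⟩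
  have hbelow : BddBelow S := ⟨p + δ, hlow⟩
  have habove : BddAbove S := ⟨p + 1 - δ, hup⟩
  have ha : p + δ ≤ sInf S := le_csInf ⟨q, hq⟩ hlow
  have hb : sSup S ≤ p + 1 - δ := csSup_le ⟨q, hq⟩ hup
  have haq := csInf_le hbelow hq
  have hqb := le_csSup habove hq'
  refine ⟨sInf S, sSup S, by linarith, by linarith, ?_, ?_⟩
  · rintro _ ⟨r, hr, rfl⟩
    obtain ⟨s, hs, hsr⟩ := exists_lt_of_csInf_lt ⟨q, hq⟩ hr.1
    obtain ⟨t, ht, hrt⟩ := exists_lt_of_lt_csSup ⟨q, hq⟩ hr.2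
    exact coe_mem_of_between hI.isConnected.isPreconnected hp hs.1.1 hsr hrt ht.1.2 hs.2 ht.2
  · rintro _ ⟨t, ht, rfl⟩ htI
    rcases lt_trichotomy t (p + 1) with h | h | h
    · have := le_csSup habove (show t ∈ S from ⟨⟨by linarith [ht.1], h⟩, htI⟩)
      linarith [ht.1]
    · apply hp
      have h1 : ((p + 1 : ℝ) : UnitAddCircle) = p := by
        rw [AddCircle.coe_add, AddCircle.coe_period, add_zero]
      rw [← h1, ← h]
      exact htI
    · have h1 : ((t - 1 : ℝ) : UnitAddCircle) = t := by
        rw [AddCircle.coe_sub, AddCircle.coe_period, sub_zero]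
      have := csInf_le hbelow (show t - 1 ∈ S from
        ⟨⟨by linarith, by linarith [ht.2]⟩, by rw [h1]; exact htI⟩)
      linarith [ht.2]

theorem arc_add_one (a b : ℝ) : arc (a + 1) (b + 1) ⊆ arc a b := by
  rintro _ ⟨t, ht, rfl⟩
  refine ⟨t - 1, ⟨by linarith [ht.1], by linarith [ht.2]⟩, ?_⟩
  change ((t - 1 : ℝ) : UnitAddCircle) = t
  rw [AddCircle.coe_sub, AddCircle.coe_period, sub_zero]

variable {n : ℕ}

theorem localSubspace_induction (hn : 1 ≤ n) {I : Set UnitAddCircle} {P : Set (OneParticle n)}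
    (hP : IsRealSubspace P) (hc : IsClosed P)
    (h : ∀ (f : UnitAddCircle → ℝ) (hf : SmoothReal f), tsupport f ⊆ I → field n hn f hf ∈ P) :
    ∀ v ∈ localSubspace n hn I, v ∈ P := by
  have hspan : ∀ v ∈ Submodule.span ℝ {v | ∃ (f : UnitAddCircle → ℝ) (hf : SmoothReal f),
      tsupport f ⊆ I ∧ v = field n hn f hf}, v ∈ P := by
    intro v hv
    induction hv using Submodule.span_induction with
    | mem v hv => obtain ⟨f, hf, hfs, rfl⟩ := hv; exact h f hf hfs
    | zero => exact hP.zero_mem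
    | add x y _ _ hx hy => exact hP.add_mem hx hy
    | smul r x _ hx =>
      have := hP.smul_mem r hx
      rwa [Complex.coe_smul] at this
  intro v hv
  exact closure_minimal hspan hc hv

theorem isRealSubspace_im_inner_eq_zero (w : OneParticle n) :
    IsRealSubspace {v : OneParticle n | (⟪w, v⟫).im = 0} where
  zero_mem := by simp
  add_mem hx hy := by
    rw [Set.mem_ofPred_eq] at *
    rw [inner_add_right, Complex.add_im, hx, hy, add_zero]
  smul_mem r x hx := by
    rw [Set.mem_ofPred_eq] at *
    rw [inner_smul_right, Complex.im_ofReal_mul, hx, mul_zero]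

theorem isClosed_im_inner_eq_zero (w : OneParticle n) :
    IsClosed {v : OneParticle n | (⟪w, v⟫).im = 0} :=
  isClosed_eq (by fun_prop) continuous_const

theorem im_inner_comm_eq_zero {v w : OneParticle n} (h : (⟪v, w⟫).im = 0) : (⟪w, v⟫).im = 0 := by
  rw [← inner_conj_symm, Complex.conj_im, h, neg_zero]

theorem im_inner_eq_zero_of_disjoint (hn : 1 ≤ n) {I J : Set UnitAddCircle} (hIJ : Disjoint I J)
    {v w : OneParticle n} (hv : v ∈ localSubspace n hn I) (hw : w ∈ localSubspace n hn J) :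
    (⟪v, w⟫).im = 0 := by
  refine localSubspace_induction hn (isRealSubspace_im_inner_eq_zero v)
    (isClosed_im_inner_eq_zero v) (fun g hg hgs => im_inner_comm_eq_zero ?_) w hw
  exact localSubspace_induction hn (isRealSubspace_im_inner_eq_zero _)
    (isClosed_im_inner_eq_zero _)
    (fun f hf hfs => im_inner_field_eq_zero hn hf hg (hIJ.symm.mono hgs hfs)) v hv

/-- Haag duality of the one-particle subspaces. -/
theorem mem_localSubspace_iff (hn : 1 ≤ n) {I J : Set UnitAddCircle} (hIJ : Disjoint I J) {a b : ℝ}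
    (hab : a < b) (hb : b < a + 1) (hI : arc a b ⊆ I) (hJ : arc b (a + 1) ⊆ J)
    (v : OneParticle n) :
    v ∈ localSubspace n hn I ↔ ∀ h ∈ localSubspace n hn J, (⟪h, v⟫).im = 0 := by
  refine ⟨fun hv h hh => im_inner_eq_zero_of_disjoint hn hIJ.symm hh hv, fun hv => ?_⟩
  obtain ⟨u, hu, hvan, rfl⟩ := exists_vanishesOn hn (v := v) (a := b) (b := a + 1) (by linarith)
    fun f hf hfs => im_inner_comm_eq_zero (hv _ (field_mem_localSubspace hn hf (hfs.trans hJ)))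
  exact realVec_mem_localSubspace hn hu hab hb hvan hI

theorem eq_zero_of_orthogonal_of_arc (hn : 1 ≤ n) {I : Set UnitAddCircle} {a b : ℝ} (hab : a < b)
    (hI : arc a b ⊆ I) (v : OneParticle n) (hv : ∀ h ∈ localSubspace n hn I, ⟪h, v⟫ = 0) :
    v = 0 :=
  eq_zero_of_orthogonal_local hn (isOpen_arc a b) ((Set.nonempty_Ioo.2 hab).image _) hI hv

theorem exists_im_inner_ne_zero (hn : 1 ≤ n) {I : Set UnitAddCircle}
    (hcyc : ∀ v : OneParticle n, (∀ h ∈ localSubspace n hn I, ⟪h, v⟫ = 0) → v = 0) :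
    ∃ h ∈ localSubspace n hn I, ∃ k ∈ localSubspace n hn I, (⟪h, k⟫).im ≠ 0 := by
  classical
  by_contra! hcon
  have hf0 : ∀ (f : UnitAddCircle → ℝ) (hf : SmoothReal f), tsupport f ⊆ I →
      field n hn f hf = 0 := by
    intro f hf hfs
    by_contra h0
    obtain ⟨g, hg, hgs, hne⟩ := exists_im_inner_field_ne_zero hn hf h0
    exact hne (hcon _ (field_mem_localSubspace hn hf hfs) _
      (field_mem_localSubspace hn hg (hgs.trans hfs)))
  have h0 : ∀ h ∈ localSubspace n hn I, h ∈ ({0} : Set (OneParticle n)) :=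
    localSubspace_induction hn ⟨rfl, by rintro _ _ rfl rfl; exact add_zero 0,
      by rintro r _ rfl; exact smul_zero _⟩ isClosed_singleton hf0
  have h1 := hcyc (lp.single 2 (⟨n, le_rfl⟩ : Mode n) (1 : ℂ)) fun h hh => by
    rw [Set.mem_singleton_iff.1 (h0 h hh), inner_zero_left]
  have h2 := congrArg (fun v : OneParticle n => v ⟨n, le_rfl⟩) h1
  simp at h2

end Main

end FreeNet

theorem mainTheorem12 (n : ℕ) (hn : 1 ≤ n) (I : Set UnitAddCircle) (hI : FreeNet.IsInterval I) :
    FreeNet.netB n hn I = FreeNet.dualNet (FreeNet.netA n hn) I ∧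
    (FreeNet.netA n hn I : Set (FreeNet.FullFock (FreeNet.Mode n) →L[ℂ]
        FreeNet.FullFock (FreeNet.Mode n))) ∩ FreeNet.netB n hn I =
      Set.range (fun c : ℂ => c • ContinuousLinearMap.id ℂ (FreeNet.FullFock (FreeNet.Mode n))) ∧
    (FreeNet.generated ((FreeNet.netA n hn I : Set (FreeNet.FullFock (FreeNet.Mode n) →L[ℂ]
        FreeNet.FullFock (FreeNet.Mode n))) ∪ FreeNet.netB n hn I) :
      Set (FreeNet.FullFock (FreeNet.Mode n) →L[ℂ] FreeNet.FullFock (FreeNet.Mode n))) =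
      Set.univ := by
  obtain ⟨a, b, hab, hb, hI1, hI2⟩ := hI.exists_arc
  have hcyc1 := FreeNet.eq_zero_of_orthogonal_of_arc hn hab hI1
  have hcyc2 := FreeNet.eq_zero_of_orthogonal_of_arc hn hb hI2
  have hd1 := FreeNet.mem_localSubspace_iff hn disjoint_compl_right hab hb hI1 hI2
  have hd2 := FreeNet.mem_localSubspace_iff hn disjoint_compl_left hb (by linarith) hI2
    ((FreeNet.arc_add_one a b).trans hI1)
  have hc2 := FreeNet.commutant_leftAlgebra _ _ hd1 hcyc2
  have hc1 := FreeNet.commutant_leftAlgebra _ _ hd2 hcyc1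
  refine ⟨hc2.symm, ?_, ?_⟩
  · refine Set.Subset.antisymm (fun x hx => ?_) ?_
    · obtain ⟨h, hh, k, hk, hne⟩ := FreeNet.exists_im_inner_ne_zero hn hcyc2
      have h1 : x ∈ (FreeNet.leftAlgebra (FreeNet.localSubspace n hn Iᶜ)).commutant := by
        rw [hc2]; exact hx.2
      have h2 : x ∈ (FreeNet.rightAlgebra (FreeNet.localSubspace n hn Iᶜ)).commutant := by
        rw [← hc1, VonNeumannAlgebra.commutant_commutant]; exact hx.1
      obtain ⟨c, rfl⟩ := FreeNet.scalar_of_commute _ hcyc2 hh hk hne h1 h2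
      exact ⟨c, rfl⟩
    · rintro _ ⟨c, rfl⟩
      exact ⟨(FreeNet.netA n hn I).smul_mem (one_mem _) c,
        (FreeNet.netB n hn I).smul_mem (one_mem _) c⟩
  · obtain ⟨h, hh, k, hk, hne⟩ := FreeNet.exists_im_inner_ne_zero hn hcyc1
    rw [FreeNet.coe_generated, Set.eq_univ_iff_forall]
    intro x
    rw [Set.mem_centralizer_iff]
    intro y hy
    rw [Set.mem_centralizer_iff] at hy
    obtain ⟨c, rfl⟩ := FreeNet.scalar_of_commute _ hcyc1 hh hk hne
      (VonNeumannAlgebra.mem_commutant_iff.2 fun z hz => hy z (Or.inl (Or.inl hz)))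
      (VonNeumannAlgebra.mem_commutant_iff.2 fun z hz => hy z (Or.inl (Or.inr hz)))
    ext1 v
    simp
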